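/- Let $\Phi^A$ be finitely many fields (original fields, ghosts, ghosts for ghosts) on $\mathbb R^n$ with given ghost numbers and Grassmann parities, and let $\Phi^*_A$ be their antifields, with $\mathrm{gh}(\Phi^*_A)=-\mathrm{gh}(\Phi^A)-1$ and opposite parity. Local forms are the elements of the graded commutative algebra generated, over the smooth functions of $x$ and of finitely many derivatives of the Grassmann even fields and antifields, by the anticommuting $dx^\mu$ and derivatives of the Grassmann odd fields and antifields. Let $\partial_\mu$ be the total derivative, $d=dx^\mu\partial_\mu$, and let $\Omega^{g,k}$ be the space of local forms of ghost number $g$ and form degree $k$. The antibracket of two $n$-forms $d^nx\,a$ and $d^nx\,b$ is $$(d^nx\,a,\,d^nx\,b)=d^nx\sum_A\left[\frac{\delta^R a}{\delta\Phi^A}\frac{\delta^L b}{\delta\Phi^*_A}-\frac{\delta^R a}{\delta\Phi^*_A}\frac{\delta^L b}{\delta\Phi^A}\right],$$ with right and left Euler–Lagrange derivatives. Let $S=\int d^nx\,\mathcal L$ be a Grassmann even local functional of ghost number $0$ that satisfies the master equation $\frac12(S,S)=0$ (up to a total divergence), and let $s=(S,\cdot)$ be its BRST differential, i.e. $s\Phi^A=-\delta^R\mathcal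 L/\delta\Phi^*_A$, $s\Phi^*_A=\delta^R\mathcal L/\delta\Phi^A$, extended as a left derivation with $[s,\partial_\mu]=0$, $s\,x^\mu=0$ and $s\,dx^\mu=0$. Let $$H^{g,k}(s|d)=\frac{\{\omega\in\Omega^{g,k}:\ s\omega+dm=0\text{ for some }m\in\Omega^{g+1,k-1}\}}{s\,\Omega^{g-1,k}+d\,\Omega^{g,k-1}} .$$ A nontrivial descent of length $l$ of a class $c\in H^{g,k}(s|d)$ consists of $\omega_i\in\Omega^{g+i,k-i}$, $0\le i\le l$, such that $\omega_0$ represents $c$, $s\omega_i+d\omega_{i+1}=0$ for $i<l$, $s\omega_l=0$, and $\omega_l\notin s\,\Omega^{g+l-1,k-l}$. The depth of $c\ne0$ is the length of its shortest nontrivial descent ($\infty$ if there is none); the class $0$ has depth $0$. **Proposition.** For all ghost numbers $g_1,g_2$ the antibracket of representatives induces a well-defined bilinear map $$(\cdot,\cdot):H^{g_1,n}(s|d)\times H^{g_2,n}(s|d)\to H^{g_1+g_2+1,n}(s|d),$$ and for all $c_1\in H^{g_1,n}(s|d)$, $c_2\in H^{g_2,n}(s|d)$ $$\operatorname{depth}\big((c_1,c_2)\big)\le\min\big(\operatorname{depth}(c_1),\operatorname{depth}(c_2)\big).$$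 -/

import Mathlib

noncomputable section

namespace LocalBRST

universe u

open scoped TensorProduct

/-- The field content of a classical field theory on the spacetime `ℝ ^ dim`: finitely many fields
`Φ^A` (original fields, ghosts, ghosts for ghosts, ...), with their ghost number and Grassmann
parity.  The antifields are added below. -/
structure FieldContent where
  dim : ℕ
  Field : Type u
  [fintype : Fintype Field]
  gh : Field → ℤ
  parity : Field → ZMod 2

attribute [instance] FieldContent.fintype

namespace FieldContent

variable (Φ : FieldContent.{u})

/-! ### Fields, antifields and jet coordinates -/

/-- `Sum.inl A` is the field `Φ^A` and `Sum.inr A` is the antifield `Φ^*_A`. -/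
abbrev Species : Type u := Φ.Field ⊕ Φ.Field

/-- Ghost number, with `gh Φ^*_A = - gh Φ^A - 1`. -/
def ghost : Φ.Species → ℤ
  | Sum.inl A => Φ.gh A
  | Sum.inr A => -Φ.gh A - 1

/-- Grassmann parity; a field and its antifield have opposite parities. -/
def par : Φ.Species → ZMod 2
  | Sum.inl A => Φ.parity A
  | Sum.inr A => Φ.parity A + 1

/-- A symmetric multi-index of derivatives: the derivative `∂_μ` is taken `I μ` times. -/
abbrev MultiIndex : Type := Fin Φ.dim →₀ ℕ

/-- Jet coordinates: the derivative `∂_I z` of a field or antifield `z` is the pair `(z, I)`. -/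
abbrev JetVar : Type u := Φ.Species × Φ.MultiIndex

abbrev EvenVar : Type u := {v : Φ.JetVar // Φ.par v.1 = 0}

abbrev OddVar : Type u := {v : Φ.JetVar // ¬ Φ.par v.1 = 0}

/-- Commuting coordinates: the spacetime coordinates `x^μ` and the Grassmann even jet coordinates. -/
abbrev EvenCoord : Type u := Fin Φ.dim ⊕ Φ.EvenVar

/-- Anticommuting generators: the `dx^μ` and the Grassmann odd jet coordinates. -/
abbrev OddGen : Type u := Fin Φ.dim ⊕ Φ.OddVar

/-! ### Smooth local functions of the commuting coordinates -/

section Smooth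

open scoped ContDiff

/-- `f` is a smooth function of finitely many of the coordinates. -/
def IsSmoothLocal {ι : Type*} (f : (ι → ℝ) → ℝ) : Prop :=
  ∃ (T : Finset ι) (h : (T → ℝ) → ℝ), ContDiff ℝ ∞ h ∧ ∀ p, f p = h (fun t => p t)

theorem IsSmoothLocal.enlarge {ι : Type*} {T T' : Finset ι} (hT : T ⊆ T')
    {h : (T → ℝ) → ℝ} (hh : ContDiff ℝ ∞ h) :
    ContDiff ℝ ∞ (fun q : T' → ℝ => h (fun t => q ⟨t.1, hT t.2⟩)) :=
  hh.comp (contDiff_pi.2 fun t => contDiff_apply ℝ ℝ (⟨t.1, hT t.2⟩ : T'))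

open Classical in
theorem IsSmoothLocal.binary {ι : Type*} {f₁ f₂ : (ι → ℝ) → ℝ} (h₁ : IsSmoothLocal f₁)
    (h₂ : IsSmoothLocal f₂) {m : ℝ × ℝ → ℝ} (hm : ContDiff ℝ ∞ m) :
    IsSmoothLocal (fun p => m (f₁ p, f₂ p)) := by
  obtain ⟨T₁, k₁, hk₁, e₁⟩ := h₁
  obtain ⟨T₂, k₂, hk₂, e₂⟩ := h₂
  refine ⟨T₁ ∪ T₂, _, hm.comp ((IsSmoothLocal.enlarge Finset.subset_union_left hk₁).prodMk
    (IsSmoothLocal.enlarge Finset.subset_union_right hk₂)), fun p => ?_⟩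
  simp [e₁, e₂]

/-- The algebra of smooth functions of `x` and of finitely many even jet coordinates. -/
def LocalFun : Subalgebra ℝ ((Φ.EvenCoord → ℝ) → ℝ) where
  carrier := {f | IsSmoothLocal f}
  mul_mem' h₁ h₂ := h₁.binary h₂ (m := fun q => q.1 * q.2) (contDiff_fst.mul contDiff_snd)
  add_mem' h₁ h₂ := h₁.binary h₂ (m := fun q => q.1 + q.2) (contDiff_fst.add contDiff_snd)
  algebraMap_mem' r := ⟨∅, fun _ => r, contDiff_const, fun _ => rfl⟩

/-- The partial derivative of `f` along the coordinate `c`. -/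
def partialFun {ι : Type*} [DecidableEq ι] (c : ι) (f : (ι → ℝ) → ℝ) (p : ι → ℝ) : ℝ :=
  deriv (fun t => f (Function.update p c t)) (p c)

theorem differentiableAt_slice {ι : Type*} [DecidableEq ι] {f : (ι → ℝ) → ℝ}
    (hf : IsSmoothLocal f) (c : ι) (p : ι → ℝ) (t₀ : ℝ) :
    DifferentiableAt ℝ (fun t => f (Function.update p c t)) t₀ := by
  obtain ⟨T, h, hh, e⟩ := hf
  have : (fun t => f (Function.update p c t)) =
      fun t => h (fun s : T => Function.update p c t s) := by
    funext t; exact e _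
  rw [this]
  refine (hh.differentiable (by simp)).differentiableAt.comp t₀ ?_
  refine differentiableAt_pi.2 fun s => ?_
  by_cases hs : (s : ι) = c
  · have : (fun t : ℝ => Function.update p c t (s : ι)) = fun t => t := by
      funext t; rw [hs]; simp
    rw [this]; exact differentiableAt_id
  · have : (fun t : ℝ => Function.update p c t (s : ι)) = fun _ => p s := by
      funext t; simp [Function.update_of_ne hs]
    rw [this]; exact differentiableAt_const _

theorem partialFun_eq_zero {ι : Type*} [DecidableEq ι] {f : (ι → ℝ) → ℝ} {T : Finset ι}
    {h : (T → ℝ) → ℝ} (e : ∀ p, f p = h (fun t => p t)) {c : ι} (hc : c ∉ T) :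
    partialFun c f = 0 := by
  funext p
  have : (fun t => f (Function.update p c t)) = fun _ => f p := by
    funext t
    rw [e, e p]
    congr 1
    funext s
    exact Function.update_of_ne (fun hs : (s : ι) = c => hc (hs ▸ s.2)) _ _
  simp [partialFun, this]

theorem IsSmoothLocal.partialFun {ι : Type*} [DecidableEq ι] {f : (ι → ℝ) → ℝ}
    (hf : IsSmoothLocal f) (c : ι) : IsSmoothLocal (partialFun c f) := by
  obtain ⟨T, h, hh, e⟩ := hf
  by_cases hc : c ∈ T
  · refine ⟨T, fun q => fderiv ℝ h q (Pi.single ⟨c, hc⟩ 1), ?_, fun p => ?_⟩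
    · exact (hh.fderiv_right (m := ∞) (by simp)).clm_apply contDiff_const
    · have hs : (fun t => f (Function.update p c t)) =
          fun t => h (Function.update (fun s : T => p s) ⟨c, hc⟩ t) := by
        funext t
        rw [e]
        congr 1
        funext s
        by_cases hs : s = ⟨c, hc⟩
        · subst hs; simp
        · rw [Function.update_of_ne hs, Function.update_of_ne]
          exact fun h' => hs (Subtype.ext h')
      have hu := hasDerivAt_update (fun s : T => p s) ⟨c, hc⟩ (p c)
      have hd : HasFDerivAt h (fderiv ℝ h (fun s : T => p s))
          (Function.update (fun s : T => p s) ⟨c, hc⟩ (p c)) := by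
        have : Function.update (fun s : T => p s) ⟨c, hc⟩ (p c) = fun s : T => p s :=
          Function.update_eq_self (⟨c, hc⟩ : T) (fun s : T => p s)
        rw [this]
        exact (hh.differentiable (by simp)).differentiableAt.hasFDerivAt
      have := hd.comp_hasDerivAt (p c) hu
      rw [FieldContent.partialFun, hs]
      exact this.deriv
  · rw [partialFun_eq_zero e hc]
    exact ⟨∅, fun _ => 0, contDiff_const, fun _ => rfl⟩

open Classical in
/-- Partial derivative along an even coordinate, as a derivation of the local functions. -/
def partialEven (c : Φ.EvenCoord) : Derivation ℝ Φ.LocalFun Φ.LocalFun :=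
  Derivation.mk'
    { toFun := fun f => ⟨partialFun c f.1, f.2.partialFun c⟩
      map_add' := fun f g => by
        refine Subtype.ext (funext fun p => ?_)
        exact deriv_fun_add (differentiableAt_slice f.2 c p _) (differentiableAt_slice g.2 c p _)
      map_smul' := fun r f => by
        refine Subtype.ext (funext fun p => ?_)
        exact deriv_fun_const_smul r (differentiableAt_slice f.2 c p _) }
    (fun f g => by
      refine Subtype.ext (funext fun p => ?_)
      have h := deriv_fun_mul (differentiableAt_slice f.2 c p (p c))
        (differentiableAt_slice g.2 c p (p c))
      simp only [Function.update_eq_self] at h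
      change deriv (fun t => f.1 (Function.update p c t) * g.1 (Function.update p c t)) (p c) =
        f.1 p * deriv (fun t => g.1 (Function.update p c t)) (p c) +
          g.1 p * deriv (fun t => f.1 (Function.update p c t)) (p c)
      rw [h]; ring)

/-- An even coordinate as a local function. -/
def coordFun (c : Φ.EvenCoord) : Φ.LocalFun :=
  ⟨fun p => p c, {c}, fun q => q ⟨c, Finset.mem_singleton_self c⟩,
    contDiff_apply ℝ ℝ (⟨c, Finset.mem_singleton_self c⟩ : ({c} : Finset Φ.EvenCoord)),
    fun _ => rfl⟩

end Smooth

/-! ### Local forms -/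

abbrev OddAlgebra : Type u := ExteriorAlgebra ℝ (Φ.OddGen →₀ ℝ)

/-- Local forms: the graded commutative algebra generated over the smooth local functions of the
even coordinates by the anticommuting `dx^μ` and odd jet coordinates. In particular `dx^μ`
anticommutes with the odd fields. -/
abbrev Form : Type u := Φ.LocalFun ⊗[ℝ] Φ.OddAlgebra

instance : Ring Φ.Form := Algebra.TensorProduct.instRing

instance : Algebra ℝ Φ.Form := Algebra.TensorProduct.leftAlgebra

instance : AddCommGroup Φ.Form := Ring.toAddCommGroup

instance : AddCommMonoid Φ.Form := AddCommGroup.toAddCommMonoid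

instance : Module ℝ Φ.Form := Algebra.toModule

/-- Left derivative with respect to an anticommuting generator. -/
def oddD (o : Φ.OddGen) : Φ.Form →ₗ[ℝ] Φ.Form :=
  LinearMap.lTensor Φ.LocalFun (CliffordAlgebra.contractLeft (Finsupp.lapply o))

/-- Derivative with respect to an even coordinate. -/
def evenD (c : Φ.EvenCoord) : Φ.Form →ₗ[ℝ] Φ.Form :=
  LinearMap.rTensor Φ.OddAlgebra (Φ.partialEven c : Φ.LocalFun →ₗ[ℝ] Φ.LocalFun)

/-- An anticommuting generator as a local form. -/
def oddGen (o : Φ.OddGen) : Φ.Form := 1 ⊗ₜ ExteriorAlgebra.ι ℝ (Finsupp.single o 1)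

def dx (μ : Fin Φ.dim) : Φ.Form := Φ.oddGen (Sum.inl μ)

open Classical in
/-- A jet coordinate as a local form (of form degree zero). -/
def jet (v : Φ.JetVar) : Φ.Form :=
  if h : Φ.par v.1 = 0 then Φ.coordFun (Sum.inr ⟨v, h⟩) ⊗ₜ 1 else Φ.oddGen (Sum.inr ⟨v, h⟩)

open Classical in
/-- The left partial derivative with respect to a jet coordinate. -/
def jetD (v : Φ.JetVar) : Φ.Form →ₗ[ℝ] Φ.Form :=
  if h : Φ.par v.1 = 0 then Φ.evenD (Sum.inr ⟨v, h⟩) else Φ.oddD (Sum.inr ⟨v, h⟩)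

/-- The algebra automorphism that is `+1` on even and `-1` on odd elements. -/
def parityInvolution : Φ.Form →ₗ[ℝ] Φ.Form :=
  LinearMap.lTensor Φ.LocalFun (CliffordAlgebra.involute (Q := (0 : QuadraticForm ℝ
    (Φ.OddGen →₀ ℝ)))).toLinearMap

open Classical in
/-- The right partial derivative `∂ᴿf/∂v = (-1) ^ (ε(v) (ε(f) + 1)) ∂f/∂v`; for odd `v` the sign is
the parity of `∂f/∂v`. -/
def jetDR (v : Φ.JetVar) : Φ.Form →ₗ[ℝ] Φ.Form :=
  if Φ.par v.1 = 0 then Φ.jetD v else Φ.parityInvolution ∘ₗ Φ.jetD v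

/-- A local form depends on finitely many jet coordinates only. -/
theorem finite_jetD (ω : Φ.Form) : {v | Φ.jetD v ω ≠ 0}.Finite := by
  classical
  induction ω using TensorProduct.induction_on with
  | zero => simp
  | add a b ha hb =>
    refine (ha.union hb).subset fun v hv => ?_
    by_contra hcon
    simp only [Set.mem_union, Set.mem_ofPred_eq, not_or, not_not] at hcon
    exact hv (by rw [map_add, hcon.1, hcon.2, add_zero])
  | tmul f a =>
    obtain ⟨T, h, -, e⟩ := f.2
    have hodd : ∃ S : Finset Φ.OddGen, ∀ o ∉ S,
        CliffordAlgebra.contractLeft (Q := (0 : QuadraticForm ℝ (Φ.OddGen →₀ ℝ)))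
          (Finsupp.lapply o) a = 0 := by
      induction a using CliffordAlgebra.left_induction with
      | algebraMap r => exact ⟨∅, fun o _ => by simp⟩
      | add x y hx hy =>
        obtain ⟨S, hS⟩ := hx
        obtain ⟨S', hS'⟩ := hy
        refine ⟨S ∪ S', fun o ho => ?_⟩
        rw [Finset.mem_union, not_or] at ho
        rw [map_add, hS o ho.1, hS' o ho.2, add_zero]
      | ι_mul x m hx =>
        obtain ⟨S, hS⟩ := hx
        refine ⟨S ∪ m.support, fun o ho => ?_⟩
        rw [Finset.mem_union, not_or] at ho
        rw [CliffordAlgebra.contractLeft_ι_mul, hS o ho.1]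
        simp [Finsupp.notMem_support_iff.1 ho.2]
    obtain ⟨S, hS⟩ := hodd
    have hfin : ((fun c : Φ.EvenVar => (Sum.inr c : Φ.EvenCoord)) ⁻¹' (T : Set Φ.EvenCoord)).Finite :=
      T.finite_toSet.preimage Sum.inr_injective.injOn
    have hfin' : ((fun c : Φ.OddVar => (Sum.inr c : Φ.OddGen)) ⁻¹' (S : Set Φ.OddGen)).Finite :=
      S.finite_toSet.preimage Sum.inr_injective.injOn
    refine ((hfin.image Subtype.val).union (hfin'.image Subtype.val)).subset fun v hv => ?_
    by_cases hp : Φ.par v.1 = 0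
    · refine Or.inl ⟨⟨v, hp⟩, ?_, rfl⟩
      by_contra hc
      refine hv ?_
      have : Φ.partialEven (Sum.inr ⟨v, hp⟩) f = 0 :=
        Subtype.ext (partialFun_eq_zero e hc)
      simp [jetD, hp, evenD, this]
    · refine Or.inr ⟨⟨v, hp⟩, ?_, rfl⟩
      by_contra hc
      refine hv ?_
      have := hS _ hc
      simp only [jetD, hp, oddD, dif_neg, not_false_eq_true, LinearMap.lTensor_tmul]
      rw [this, TensorProduct.tmul_zero]

theorem finite_mul_jetD (Q : Φ.JetVar → Φ.Form) (ω : Φ.Form) :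
    (Function.support fun v => Q v * Φ.jetD v ω).Finite :=
  (Φ.finite_jetD ω).subset fun v hv h => hv (by simp [h])

/-- The vertical vector field `∑ Q_v ∂/∂v` (a finite sum on every local form). -/
def vectorField (Q : Φ.JetVar → Φ.Form) : Φ.Form →ₗ[ℝ] Φ.Form where
  toFun ω := ∑ᶠ v, Q v * Φ.jetD v ω
  map_add' a b := by
    rw [← finsum_add_distrib (Φ.finite_mul_jetD Q a) (Φ.finite_mul_jetD Q b)]
    simp only [map_add, mul_add]
  map_smul' r a := by
    rw [RingHom.id_apply, smul_finsum' r (Φ.finite_mul_jetD Q a)]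
    simp only [map_smul, mul_smul_comm]

/-! ### Total derivatives, horizontal differential, degrees -/

/-- The total derivative `∂/∂x^μ + ∑ (∂_μ ∂_I z) ∂/∂(∂_I z)`. -/
def totalD (μ : Fin Φ.dim) : Φ.Form →ₗ[ℝ] Φ.Form :=
  Φ.evenD (Sum.inl μ) + Φ.vectorField fun v => Φ.jet (v.1, v.2 + Finsupp.single μ 1)

/-- The iterated total derivative. -/
def totalDI (I : Φ.MultiIndex) : Φ.Form →ₗ[ℝ] Φ.Form :=
  ((List.finRange Φ.dim).map fun μ => (Φ.totalD μ ^ I μ : Module.End ℝ Φ.Form)).prod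

/-- The horizontal differential `d = dx^μ ∂_μ`. -/
def d : Φ.Form →ₗ[ℝ] Φ.Form := ∑ μ, LinearMap.mulLeft ℝ (Φ.dx μ) ∘ₗ Φ.totalD μ

/-- The derivation that counts the ghost number. -/
def ghostOp : Φ.Form →ₗ[ℝ] Φ.Form := Φ.vectorField fun v => (Φ.ghost v.1 : ℝ) • Φ.jet v

/-- The derivation that counts the `dx^μ`. -/
def formOp : Φ.Form →ₗ[ℝ] Φ.Form :=
  ∑ μ, LinearMap.mulLeft ℝ (Φ.dx μ) ∘ₗ Φ.oddD (Sum.inl μ)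

/-- Local forms of ghost number `g` and form degree `k`. -/
def Forms (g k : ℤ) : Submodule ℝ Φ.Form :=
  LinearMap.ker (Φ.ghostOp - (g : ℝ) • LinearMap.id) ⊓
    LinearMap.ker (Φ.formOp - (k : ℝ) • LinearMap.id)

/-- The volume form `dx^0 ⋯ dx^(n-1)`. -/
def vol : Φ.Form := ((List.finRange Φ.dim).map Φ.dx).prod

/-- The density `a` of a form `vol * a` of top degree: strip off `dx^0`, then `dx^1`, and so on. -/
def density (ω : Φ.Form) : Φ.Form :=
  (List.finRange Φ.dim).foldl (fun η μ => Φ.oddD (Sum.inl μ) η) ω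

/-! ### Antibracket and BRST differential -/

/-- Left Euler-Lagrange derivative with respect to the field or antifield `z`. -/
def eulerL (z : Φ.Species) (a : Φ.Form) : Φ.Form :=
  ∑ᶠ I : Φ.MultiIndex, (-1 : ℝ) ^ I.degree • Φ.totalDI I (Φ.jetD (z, I) a)

/-- Right Euler-Lagrange derivative with respect to the field or antifield `z`. -/
def eulerR (z : Φ.Species) (a : Φ.Form) : Φ.Form :=
  ∑ᶠ I : Φ.MultiIndex, (-1 : ℝ) ^ I.degree • Φ.totalDI I (Φ.jetDR (z, I) a)

/-- The density of the antibracket of the functionals with densities `a` and `b`. -/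
def bracketDensity (a b : Φ.Form) : Φ.Form :=
  ∑ A : Φ.Field, (Φ.eulerR (Sum.inl A) a * Φ.eulerL (Sum.inr A) b -
    Φ.eulerR (Sum.inr A) a * Φ.eulerL (Sum.inl A) b)

/-- The antibracket of two forms of top degree, again a form of top degree. -/
def antibracket (ω₁ ω₂ : Φ.Form) : Φ.Form :=
  Φ.vol * Φ.bracketDensity (Φ.density ω₁) (Φ.density ω₂)

/-- `L` is the density of a local functional `S = ∫ d^n x L` of ghost number zero and even parity
that solves the master equation `(S, S) / 2 = 0`. The integral of a form of top degree is zero if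
the form is a total divergence. -/
structure IsMasterLagrangian (L : Φ.Form) : Prop where
  mem : L ∈ Φ.Forms 0 0
  even : Φ.parityInvolution L = L
  master : ∃ m, (1 / 2 : ℝ) • (Φ.vol * Φ.bracketDensity L L) = Φ.d m

/-- `s z = (S, z)` for an undifferentiated field or antifield `z`. -/
def brstGen (L : Φ.Form) : Φ.Species → Φ.Form
  | Sum.inl A => -Φ.eulerR (Sum.inr A) L
  | Sum.inr A => Φ.eulerR (Sum.inl A) L

/-- The BRST differential `s = (S, ·)`, extended to derivatives by `[s, ∂_μ] = 0`. -/
def s (L : Φ.Form) : Φ.Form →ₗ[ℝ] Φ.Form :=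
  Φ.vectorField fun v => Φ.totalDI v.2 (brstGen Φ L v.1)

/-! ### Local BRST cohomology and depth -/

/-- Cocycles: `s ω + d m = 0` for some local form `m`. -/
def cocycles (L : Φ.Form) (g k : ℤ) : Submodule ℝ Φ.Form :=
  Φ.Forms g k ⊓ ((Φ.Forms (g + 1) (k - 1)).map Φ.d).comap (-Φ.s L)

/-- Coboundaries: `s b + d m`. -/
def coboundaries (L : Φ.Form) (g k : ℤ) : Submodule ℝ Φ.Form :=
  (Φ.Forms (g - 1) k).map (Φ.s L) ⊔ (Φ.Forms g (k - 1)).map Φ.d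

/-- The local BRST cohomology `H^{g,k}(s|d)`. -/
def Cohomology (L : Φ.Form) (g k : ℤ) : Type u :=
  Φ.cocycles L g k ⧸ (Φ.coboundaries L g k).submoduleOf (Φ.cocycles L g k)

instance (L : Φ.Form) (g k : ℤ) : AddCommGroup (Φ.Cohomology L g k) :=
  inferInstanceAs (AddCommGroup
    (Φ.cocycles L g k ⧸ (Φ.coboundaries L g k).submoduleOf (Φ.cocycles L g k)))

instance (L : Φ.Form) (g k : ℤ) : Module ℝ (Φ.Cohomology L g k) :=
  inferInstanceAs (Module ℝ
    (Φ.cocycles L g k ⧸ (Φ.coboundaries L g k).submoduleOf (Φ.cocycles L g k)))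

/-- The class of a cocycle. -/
def toClass (L : Φ.Form) (g k : ℤ) : Φ.cocycles L g k →ₗ[ℝ] Φ.Cohomology L g k :=
  Submodule.mkQ ((Φ.coboundaries L g k).submoduleOf (Φ.cocycles L g k))

/-- `η 0, …, η l` is an `(s,d)`-descent of length `l` that starts in ghost number `g` and form
degree `k` and whose last element is a nontrivial element of the cohomology of `s`. -/
structure IsNontrivialDescent (L : Φ.Form) (g k : ℤ) (l : ℕ) (η : ℕ → Φ.Form) : Prop where
  mem : ∀ i ≤ l, η i ∈ Φ.Forms (g + i) (k - i)
  step : ∀ i < l, Φ.s L (η i) + Φ.d (η (i + 1)) = 0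
  last : Φ.s L (η l) = 0
  nontrivial : η l ∉ (Φ.Forms (g + l - 1) (k - l)).map (Φ.s L)

/-- The class `c` has a representative from which a nontrivial descent of length `l` starts. -/
def HasNontrivialDescent (L : Φ.Form) {g k : ℤ} (c : Φ.Cohomology L g k) (l : ℕ) : Prop :=
  ∃ (η : ℕ → Φ.Form) (h : η 0 ∈ Φ.cocycles L g k),
    Φ.toClass L g k ⟨η 0, h⟩ = c ∧ Φ.IsNontrivialDescent L g k l η

open Classical in
/-- The depth of a class: the length of its shortest nontrivial descent. The zero class has depth
`0`, and a nonzero class without any such descent has depth `⊤`. -/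
def depth (L : Φ.Form) {g k : ℤ} (c : Φ.Cohomology L g k) : ℕ∞ :=
  if c = 0 then 0 else ⨅ (l : ℕ) (_ : Φ.HasNontrivialDescent L c l), (l : ℕ∞)

end FieldContent

end LocalBRST

end

/-! With one argument fixed, the antibracket is, up to a `d`-exact form, the action of an operator
that lives on local forms of every degree and not only on `n`-forms. Once this operator is known to
commute, in the graded sense, with both `s` and `d`, it can be applied to a whole descent at once.

For a cocycle `ω₁` with density `a` the operator comes from the Hamiltonian vector field `Φ.s a`,
the evolutionary field whose characteristic is built from the variational derivatives of `a`.
Integration by parts gives `(a, b)` from its action on `b`, modulo a divergence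
(`s_sub_bracketDensity_mem_divergences`). Being evolutionary, it graded commutes with `d`. For the
commutator with `s` it suffices to compare characteristics. As `ω₁` is a cocycle, `(S, a)` is a
divergence, so its variational derivatives vanish. They can be expanded by the variation formula
`eulerL_vectorField_prolong`, and the Helmholtz symmetry of second variational derivatives
(`adjointSum_symbolMul_eulerL`) turns the result into the equality of `s` on the variational
derivatives of `a` with the field of `a` on those of the Lagrangian, up to signs
(`HasParity.s_eulerL`, `HasParity.s_s`).

Hence the operator maps cocycles to cocycles, coboundaries to coboundaries and descents to descents
of the same length. The last element of the image may be trivial, say `s b`. Then subtracting `d b`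
from the element before it makes that one `s`-closed, and the descent becomes shorter by one step.
Repeating this ends in a nontrivial descent or in the zero class
(`IsMasterLagrangian.depth_le_of_descent`). This bounds the depth of the bracket by the depth of the
second argument; graded antisymmetry gives an analogous operator acting on the first argument
(`rightOp`).

Ghost number does not determine Grassmann parity, so forms and fields of mixed parity occur
throughout. Graded identities are therefore written with the parity involution, and passing an odd
operator across a field `X` replaces `X` by `parityConj X`, its even part minus its odd part. -/

noncomputable section

namespace LocalBRST

namespace FieldContent

open scoped TensorProduct

variable {Φ : FieldContent}

/-! ### Partial derivatives of smooth local functions -/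

section Smooth

open scoped ContDiff

theorem partialFun_eq_fderiv {ι : Type*} [DecidableEq ι] {f : (ι → ℝ) → ℝ} {T : Finset ι}
    {h : (T → ℝ) → ℝ} (hh : Differentiable ℝ h) (e : ∀ p, f p = h (fun t => p t)) {c : ι}
    (hc : c ∈ T) (p : ι → ℝ) :
    partialFun c f p = fderiv ℝ h (fun t : T => p t) (Pi.single ⟨c, hc⟩ 1) := by
  have hs : (fun t => f (Function.update p c t)) =
      fun t => h (Function.update (fun s : T => p s) ⟨c, hc⟩ t) := by
    funext t
    rw [e]
    congr 1
    funext s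
    by_cases hs : s = ⟨c, hc⟩
    · subst hs; simp
    · rw [Function.update_of_ne hs, Function.update_of_ne]
      exact fun h' => hs (Subtype.ext h')
  have hu := hasDerivAt_update (fun s : T => p s) ⟨c, hc⟩ (p c)
  have hd : HasFDerivAt h (fderiv ℝ h (fun s : T => p s))
      (Function.update (fun s : T => p s) ⟨c, hc⟩ (p c)) := by
    have : Function.update (fun s : T => p s) ⟨c, hc⟩ (p c) = fun s : T => p s :=
      Function.update_eq_self (⟨c, hc⟩ : T) (fun s : T => p s)
    rw [this]
    exact (hh _).hasFDerivAt
  have := hd.comp_hasDerivAt (p c) hu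
  rw [FieldContent.partialFun, hs]
  exact this.deriv

theorem partialFun_zero {ι : Type*} [DecidableEq ι] (c : ι) :
    partialFun c (0 : (ι → ℝ) → ℝ) = 0 := by
  funext p
  simp [partialFun]

/-- Partial derivatives of a smooth local function commute. -/
theorem partialFun_comm {ι : Type*} [DecidableEq ι] {f : (ι → ℝ) → ℝ} (hf : IsSmoothLocal f)
    (c c' : ι) : partialFun c (partialFun c' f) = partialFun c' (partialFun c f) := by
  obtain ⟨T, h, hh, e⟩ := hf
  have hd : Differentiable ℝ h := hh.differentiable (by simp)
  have hfd : ContDiff ℝ ∞ (fderiv ℝ h) := hh.fderiv_right (by simp)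
  have hg (v : T → ℝ) : Differentiable ℝ fun q => fderiv ℝ h q v :=
    (hfd.clm_apply contDiff_const).differentiable (by simp)
  -- A coordinate outside `T` does not occur in `f`, and then both sides vanish; for two coordinates
  -- in `T` the claim is the symmetry of the second derivative of the finite-dimensional
  -- representative `h`.
  by_cases hc : c ∈ T
  · by_cases hc' : c' ∈ T
    · funext p
      rw [partialFun_eq_fderiv (hg _) (fun p => partialFun_eq_fderiv hd e hc' p) hc,
        partialFun_eq_fderiv (hg _) (fun p => partialFun_eq_fderiv hd e hc p) hc']
      have hdd := (hfd.differentiable (by simp)) (fun t : T => p t)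
      rw [fderiv_clm_apply hdd (by fun_prop), fderiv_clm_apply hdd (by fun_prop)]
      simpa using (hh.contDiffAt.isSymmSndFDerivAt (x := fun t : T => p t)
        (by simpa using (WithTop.coe_le_coe.2 le_top : ((2 : ℕ∞) : WithTop ℕ∞) ≤ ∞))) _ _
    · rw [partialFun_eq_zero e hc', partialFun_zero]
      exact (partialFun_eq_zero (h := fun q => fderiv ℝ h q (Pi.single ⟨c, hc⟩ 1))
        (fun p => partialFun_eq_fderiv hd e hc p) hc').symm
  · rw [partialFun_eq_zero e hc, partialFun_zero]
    by_cases hc' : c' ∈ T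
    · exact partialFun_eq_zero (h := fun q => fderiv ℝ h q (Pi.single ⟨c', hc'⟩ 1))
        (fun p => partialFun_eq_fderiv hd e hc' p) hc
    · rw [partialFun_eq_zero e hc', partialFun_zero]

open Classical in
theorem partialEven_comm (c c' : Φ.EvenCoord) (f : Φ.LocalFun) :
    Φ.partialEven c (Φ.partialEven c' f) = Φ.partialEven c' (Φ.partialEven c f) :=
  Subtype.ext (partialFun_comm f.2 c c')

open Classical in
theorem partialEven_coordFun (c c' : Φ.EvenCoord) :
    Φ.partialEven c (Φ.coordFun c') = if c = c' then 1 else 0 := by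
  refine Subtype.ext (funext fun p => ?_)
  change deriv (fun t => Function.update p c t c') (p c) = _
  split_ifs with h
  · subst h
    simp
  · simp [Function.update_of_ne (Ne.symm h)]

end Smooth

/-! ### The exterior algebra -/

section Exterior

variable {M : Type*} [AddCommGroup M] [Module ℝ M]

local notation "Λ" => CliffordAlgebra (0 : QuadraticForm ℝ M)

local notation "inv" => CliffordAlgebra.involute (Q := (0 : QuadraticForm ℝ M))

theorem involute_contractLeft (δ : Module.Dual ℝ M) (a : Λ) :
    inv (CliffordAlgebra.contractLeft δ a) = -CliffordAlgebra.contractLeft δ (inv a) := by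
  induction a using CliffordAlgebra.left_induction with
  | algebraMap r => simp [CliffordAlgebra.contractLeft_algebraMap]
  | add x y hx hy => simp only [map_add, hx, hy, neg_add]
  | ι_mul x m hx =>
    simp only [CliffordAlgebra.contractLeft_ι_mul, map_sub, map_mul, map_smul,
      CliffordAlgebra.involute_ι, neg_mul, map_neg, hx, mul_neg]
    abel

theorem contractLeft_mul (δ : Module.Dual ℝ M) (a b : Λ) :
    CliffordAlgebra.contractLeft δ (a * b) =
      CliffordAlgebra.contractLeft δ a * b + inv a * CliffordAlgebra.contractLeft δ b := by
  induction a using CliffordAlgebra.left_induction with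
  | algebraMap r =>
    simp [CliffordAlgebra.contractLeft_algebraMap, CliffordAlgebra.contractLeft_algebraMap_mul]
  | add x y hx hy => simp only [map_add, add_mul, hx, hy]; abel
  | ι_mul x m hx =>
    rw [mul_assoc, CliffordAlgebra.contractLeft_ι_mul, CliffordAlgebra.contractLeft_ι_mul, hx]
    simp only [map_mul, CliffordAlgebra.involute_ι, neg_mul, sub_mul, mul_add, smul_mul_assoc,
      mul_assoc]
    abel

theorem ι_mul_eq_involute_mul (m : M) (a : Λ) :
    CliffordAlgebra.ι 0 m * a = inv a * CliffordAlgebra.ι 0 m := by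
  induction a using CliffordAlgebra.left_induction with
  | algebraMap r => simp [Algebra.commutes]
  | add x y hx hy => simp only [map_add, add_mul, mul_add, hx, hy]
  | ι_mul x m' hx =>
    have h := CliffordAlgebra.ι_mul_ι_add_swap (Q := (0 : QuadraticForm ℝ M)) m m'
    -- For the zero quadratic form the Clifford relation has no scalar term, so generators
    -- anticommute.
    have h0 : QuadraticMap.polar (0 : QuadraticForm ℝ M) m m' = 0 := by simp [QuadraticMap.polar]
    rw [h0, map_zero] at h
    have h' := eq_neg_of_add_eq_zero_left h
    rw [map_mul, CliffordAlgebra.involute_ι, mul_assoc, ← hx, ← mul_assoc, h']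
    simp [mul_assoc]

/-- Graded commutativity of the exterior algebra. -/
theorem two_smul_mul_eq (a b : Λ) :
    (2 : ℝ) • (a * b) = b * a + b * inv a + inv b * a - inv b * inv a := by
  induction a using CliffordAlgebra.left_induction with
  | algebraMap r =>
    rw [two_smul, Algebra.commutes]
    simp
  | add x y hx hy => simp only [map_add, add_mul, mul_add, smul_add, hx, hy]; abel
  | ι_mul x m hx =>
    rw [mul_assoc, ← mul_smul_comm, hx]
    simp only [map_mul, CliffordAlgebra.involute_ι, mul_add, mul_sub, ← mul_assoc,
      ι_mul_eq_involute_mul m b, ι_mul_eq_involute_mul m (inv b),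
      CliffordAlgebra.involute_involute, neg_mul, mul_neg]
    abel

end Exterior

/-! ### Shortcut instances -/

instance : Module ℝ Φ.Form := Algebra.toModule

instance : DistribMulAction ℝ Φ.Form := Module.toDistribMulAction

instance : MulAction ℝ Φ.Form := DistribMulAction.toMulAction

instance : SMulZeroClass ℝ Φ.Form := DistribSMul.toSMulZeroClass

instance : SMul ℝ Φ.Form := Algebra.toSMul

instance : AddGroup Φ.Form := AddCommGroup.toAddGroup

instance : SubNegMonoid Φ.Form := AddGroup.toSubNegMonoid

instance : SubtractionMonoid Φ.Form := AddGroup.toSubtractionMonoid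

instance : SubtractionCommMonoid Φ.Form := AddCommGroup.toDivisionAddCommMonoid

instance : AddMonoid Φ.Form := AddCommMonoid.toAddMonoid

instance : Semiring Φ.Form := Ring.toSemiring

instance : NonUnitalNonAssocSemiring Φ.Form := NonAssocSemiring.toNonUnitalNonAssocSemiring

instance : NonUnitalNonAssocRing Φ.Form := NonAssocRing.toNonUnitalNonAssocRing

instance : HasDistribNeg Φ.Form := NonUnitalNonAssocRing.toHasDistribNeg

instance : Distrib Φ.Form := NonUnitalNonAssocSemiring.toDistrib

instance : MulZeroClass Φ.Form := NonUnitalNonAssocSemiring.toMulZeroClass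

instance : Monoid Φ.Form := MonoidWithZero.toMonoid

instance : MulOneClass Φ.Form := Monoid.toMulOneClass

instance : Semigroup Φ.Form := Monoid.toSemigroup

instance : AddCommSemigroup Φ.Form := AddCommMonoid.toAddCommSemigroup

instance : IsScalarTower ℝ Φ.Form Φ.Form := IsScalarTower.right

instance : SMulCommClass ℝ Φ.Form Φ.Form := Algebra.to_smulCommClass

instance : SMulCommClass ℝ ℝ Φ.Form := smulCommClass_self ℝ Φ.Form

instance : SMul ℝ (Φ.Form →ₗ[ℝ] Φ.Form) := LinearMap.instSMul

instance : AddCommGroup (Φ.Form →ₗ[ℝ] Φ.Form) := LinearMap.addCommGroup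

instance : Module ℝ (Φ.Form →ₗ[ℝ] Φ.Form) := LinearMap.module

/-! ### Parity, derivatives and products of local forms -/

theorem parityInvolution_tmul (f : Φ.LocalFun) (a : Φ.OddAlgebra) :
    Φ.parityInvolution (f ⊗ₜ a) =
      f ⊗ₜ CliffordAlgebra.involute (Q := (0 : QuadraticForm ℝ (Φ.OddGen →₀ ℝ))) a := rfl

theorem evenD_tmul (c : Φ.EvenCoord) (f : Φ.LocalFun) (a : Φ.OddAlgebra) :
    Φ.evenD c (f ⊗ₜ a) = Φ.partialEven c f ⊗ₜ a := rfl

theorem oddD_tmul (o : Φ.OddGen) (f : Φ.LocalFun) (a : Φ.OddAlgebra) :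
    Φ.oddD o (f ⊗ₜ a) = f ⊗ₜ CliffordAlgebra.contractLeft
      (Q := (0 : QuadraticForm ℝ (Φ.OddGen →₀ ℝ))) (Finsupp.lapply o) a := rfl

@[simp]
theorem parityInvolution_parityInvolution (f : Φ.Form) :
    Φ.parityInvolution (Φ.parityInvolution f) = f := by
  induction f using TensorProduct.induction_on with
  | zero => simp only [LinearMap.map_zero]
  | add x y hx hy => simp only [map_add, hx, hy]
  | tmul f a => rw [parityInvolution_tmul, parityInvolution_tmul, CliffordAlgebra.involute_involute]

theorem parityInvolution_mul (f g : Φ.Form) :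
    Φ.parityInvolution (f * g) = Φ.parityInvolution f * Φ.parityInvolution g := by
  induction f using TensorProduct.induction_on with
  | zero => simp only [LinearMap.map_zero, zero_mul]
  | add x y hx hy => simp only [map_add, add_mul, hx, hy]
  | tmul f a =>
    induction g using TensorProduct.induction_on with
    | zero => simp only [LinearMap.map_zero, mul_zero]
    | add x y hx hy => simp only [map_add, mul_add, hx, hy]
    | tmul g b =>
      simp only [parityInvolution_tmul, Algebra.TensorProduct.tmul_mul_tmul, map_mul]

theorem evenD_mul (c : Φ.EvenCoord) (f g : Φ.Form) :
    Φ.evenD c (f * g) = Φ.evenD c f * g + f * Φ.evenD c g := by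
  induction f using TensorProduct.induction_on with
  | zero => simp only [LinearMap.map_zero, zero_mul, add_zero]
  | add x y hx hy => simp only [map_add, add_mul, hx, hy]; abel
  | tmul f a =>
    induction g using TensorProduct.induction_on with
    | zero => simp only [LinearMap.map_zero, mul_zero, add_zero]
    | add x y hx hy => simp only [map_add, mul_add, hx, hy]; abel
    | tmul g b =>
      simp only [evenD_tmul, Algebra.TensorProduct.tmul_mul_tmul, Derivation.leibniz, smul_eq_mul,
        TensorProduct.add_tmul]
      rw [add_comm, mul_comm g]

theorem oddD_mul (o : Φ.OddGen) (f g : Φ.Form) :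
    Φ.oddD o (f * g) = Φ.oddD o f * g + Φ.parityInvolution f * Φ.oddD o g := by
  induction f using TensorProduct.induction_on with
  | zero => simp only [LinearMap.map_zero, zero_mul, add_zero]
  | add x y hx hy => simp only [map_add, add_mul, hx, hy]; abel
  | tmul f a =>
    induction g using TensorProduct.induction_on with
    | zero => simp only [LinearMap.map_zero, mul_zero, add_zero]
    | add x y hx hy => simp only [map_add, mul_add, hx, hy]; abel
    | tmul g b =>
      simp only [oddD_tmul, parityInvolution_tmul, Algebra.TensorProduct.tmul_mul_tmul,
        contractLeft_mul, TensorProduct.tmul_add]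

theorem parityInvolution_evenD (c : Φ.EvenCoord) (f : Φ.Form) :
    Φ.parityInvolution (Φ.evenD c f) = Φ.evenD c (Φ.parityInvolution f) := by
  induction f using TensorProduct.induction_on with
  | zero => simp only [LinearMap.map_zero]
  | add x y hx hy => simp only [map_add, hx, hy]
  | tmul f a => rfl

theorem parityInvolution_oddD (o : Φ.OddGen) (f : Φ.Form) :
    Φ.parityInvolution (Φ.oddD o f) = -Φ.oddD o (Φ.parityInvolution f) := by
  induction f using TensorProduct.induction_on with
  | zero => simp only [LinearMap.map_zero, neg_zero]
  | add x y hx hy => simp only [map_add, hx, hy, neg_add]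
  | tmul f a =>
    rw [oddD_tmul, parityInvolution_tmul, parityInvolution_tmul, oddD_tmul, involute_contractLeft,
      TensorProduct.tmul_neg]

theorem evenD_comm (c c' : Φ.EvenCoord) (f : Φ.Form) :
    Φ.evenD c (Φ.evenD c' f) = Φ.evenD c' (Φ.evenD c f) := by
  induction f using TensorProduct.induction_on with
  | zero => simp only [LinearMap.map_zero]
  | add x y hx hy => simp only [map_add, hx, hy]
  | tmul f a => rw [evenD_tmul, evenD_tmul, partialEven_comm]; rfl

theorem evenD_oddD (c : Φ.EvenCoord) (o : Φ.OddGen) (f : Φ.Form) :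
    Φ.evenD c (Φ.oddD o f) = Φ.oddD o (Φ.evenD c f) := by
  induction f using TensorProduct.induction_on with
  | zero => simp only [LinearMap.map_zero]
  | add x y hx hy => simp only [map_add, hx, hy]
  | tmul f a => rfl

theorem oddD_oddD (o o' : Φ.OddGen) (f : Φ.Form) :
    Φ.oddD o (Φ.oddD o' f) = -Φ.oddD o' (Φ.oddD o f) := by
  induction f using TensorProduct.induction_on with
  | zero => simp only [LinearMap.map_zero, neg_zero]
  | add x y hx hy => simp only [map_add, hx, hy, neg_add]
  | tmul f a =>
    rw [oddD_tmul, oddD_tmul, oddD_tmul, oddD_tmul, CliffordAlgebra.contractLeft_comm,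
      TensorProduct.tmul_neg]

@[simp]
theorem oddD_self (o : Φ.OddGen) (f : Φ.Form) : Φ.oddD o (Φ.oddD o f) = 0 := by
  induction f using TensorProduct.induction_on with
  | zero => simp only [LinearMap.map_zero]
  | add x y hx hy => simp only [map_add, hx, hy, add_zero]
  | tmul f a =>
    rw [oddD_tmul, oddD_tmul, CliffordAlgebra.contractLeft_contractLeft, TensorProduct.tmul_zero]

/-- Graded commutativity of local forms. -/
theorem two_smul_mul (f g : Φ.Form) :
    (2 : ℝ) • (f * g) = g * f + g * Φ.parityInvolution f + Φ.parityInvolution g * f -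
      Φ.parityInvolution g * Φ.parityInvolution f := by
  induction f using TensorProduct.induction_on with
  | zero => simp only [LinearMap.map_zero, mul_zero, zero_mul, add_zero, smul_zero, sub_zero]
  | add x y hx hy => simp only [map_add, add_mul, mul_add, smul_add, hx, hy]; abel
  | tmul f a =>
    induction g using TensorProduct.induction_on with
    | zero => simp only [LinearMap.map_zero, mul_zero, zero_mul, add_zero, smul_zero, sub_zero]
    | add x y hx hy => simp only [map_add, add_mul, mul_add, smul_add, hx, hy]; abel
    | tmul g b =>
      simp only [parityInvolution_tmul, Algebra.TensorProduct.tmul_mul_tmul]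
      rw [← TensorProduct.tmul_smul, two_smul_mul_eq, TensorProduct.tmul_sub,
        TensorProduct.tmul_add, TensorProduct.tmul_add, mul_comm f g]

@[simp]
theorem oddD_one (o : Φ.OddGen) : Φ.oddD o (1 : Φ.Form) = 0 := by
  rw [Algebra.TensorProduct.one_def, oddD_tmul, CliffordAlgebra.contractLeft_one,
    TensorProduct.tmul_zero]

open Classical in
theorem oddD_oddGen (o o' : Φ.OddGen) : Φ.oddD o (Φ.oddGen o') = if o = o' then 1 else 0 := by
  have h : CliffordAlgebra.contractLeft (Q := (0 : QuadraticForm ℝ (Φ.OddGen →₀ ℝ)))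
      (Finsupp.lapply o) (CliffordAlgebra.ι 0 (Finsupp.single o' 1)) =
        algebraMap ℝ _ (if o = o' then 1 else 0) := by
    rw [CliffordAlgebra.contractLeft_ι]
    congr 1
    simp [Finsupp.single_apply, eq_comm]
  rw [oddGen, oddD_tmul]
  erw [h]
  split_ifs <;> simp [Algebra.TensorProduct.one_def]

@[simp]
theorem evenD_oddGen (c : Φ.EvenCoord) (o : Φ.OddGen) : Φ.evenD c (Φ.oddGen o) = 0 := by
  rw [oddGen, evenD_tmul, Derivation.map_one_eq_zero, TensorProduct.zero_tmul]

@[simp]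
theorem parityInvolution_oddGen (o : Φ.OddGen) :
    Φ.parityInvolution (Φ.oddGen o) = -Φ.oddGen o := by
  rw [oddGen, parityInvolution_tmul]
  erw [CliffordAlgebra.involute_ι]
  rw [TensorProduct.tmul_neg]

/-! ### Signs -/

/-- The sign `(-1) ^ e`. -/
def sgn (e : ZMod 2) : ℝ := if e = 0 then 1 else -1

/-- The sign `(-1) ^ (e e')`. -/
def sgn₂ (e e' : ZMod 2) : ℝ := if e = 0 ∨ e' = 0 then 1 else -1

variable (Φ) in
/-- The power of the parity involution with exponent `e`. -/
def twist (e : ZMod 2) : Φ.Form →ₗ[ℝ] Φ.Form := if e = 0 then LinearMap.id else Φ.parityInvolution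

theorem ZMod.eq_zero_or_one (e : ZMod 2) : e = 0 ∨ e = 1 := by
  revert e; decide

@[simp] theorem sgn_zero : sgn 0 = 1 := by simp [sgn]

@[simp] theorem sgn_one : sgn 1 = -1 := by simp [sgn]

@[simp] theorem sgn₂_zero_left (e : ZMod 2) : sgn₂ 0 e = 1 := by simp [sgn₂]

@[simp] theorem sgn₂_zero_right (e : ZMod 2) : sgn₂ e 0 = 1 := by simp [sgn₂]

@[simp] theorem sgn₂_one_one : sgn₂ 1 1 = -1 := by simp [sgn₂]

theorem sgn_mul_self (e : ZMod 2) : sgn e * sgn e = 1 := by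
  rcases ZMod.eq_zero_or_one e with rfl | rfl <;> simp

theorem sgn₂_mul_self (e e' : ZMod 2) : sgn₂ e e' * sgn₂ e e' = 1 := by
  rcases ZMod.eq_zero_or_one e with rfl | rfl <;> rcases ZMod.eq_zero_or_one e' with rfl | rfl <;>
    simp

theorem sgn₂_comm (e e' : ZMod 2) : sgn₂ e e' = sgn₂ e' e := by
  simp [sgn₂, or_comm]

@[simp] theorem twist_zero (f : Φ.Form) : Φ.twist 0 f = f := by
  rw [twist, if_pos rfl, LinearMap.id_apply]

@[simp] theorem twist_one (f : Φ.Form) : Φ.twist 1 f = Φ.parityInvolution f := by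
  rw [twist, if_neg one_ne_zero]

theorem twist_mul (e : ZMod 2) (f g : Φ.Form) : Φ.twist e (f * g) = Φ.twist e f * Φ.twist e g := by
  rcases ZMod.eq_zero_or_one e with rfl | rfl <;> simp [parityInvolution_mul]

@[simp]
theorem twist_twist (e : ZMod 2) (f : Φ.Form) : Φ.twist e (Φ.twist e f) = f := by
  rcases ZMod.eq_zero_or_one e with rfl | rfl <;> simp

variable (Φ) in
/-- `f` is an element of parity `e`. -/
def HasParity (e : ZMod 2) (f : Φ.Form) : Prop := Φ.parityInvolution f = sgn e • f

theorem HasParity.twist {e : ZMod 2} {f : Φ.Form} (h : Φ.HasParity e f) (e' : ZMod 2) :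
    Φ.twist e' f = sgn₂ e e' • f := by
  rcases ZMod.eq_zero_or_one e' with rfl | rfl
  · rw [twist_zero, sgn₂_zero_right, one_smul]
  · rw [twist_one, h]
    rcases ZMod.eq_zero_or_one e with rfl | rfl <;> simp

/-- `two_smul_mul` encodes graded commutativity for factors of mixed parity: on even and odd parts
only the odd-odd pair changes sign. If one factor is homogeneous, its four terms collapse to a
single twist of the other factor. -/
theorem HasParity.mul_comm {e : ZMod 2} {f : Φ.Form} (h : Φ.HasParity e f) (g : Φ.Form) :
    g * f = f * Φ.twist e g := by
  refine ((two_ne_zero (α := ℝ)).isUnit.smul_left_cancel).1 ?_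
  rw [two_smul_mul g f]
  rcases ZMod.eq_zero_or_one e with rfl | rfl
  · have h' : Φ.parityInvolution f = f := by simpa [HasParity] using h
    rw [h', twist_zero, two_smul]; abel
  · have h' : Φ.parityInvolution f = -f := by simpa [HasParity] using h
    rw [h', twist_one, two_smul, neg_mul, neg_mul]; abel

/-! ### Jet coordinates -/

theorem jetD_of_even {v : Φ.JetVar} (h : Φ.par v.1 = 0) : Φ.jetD v = Φ.evenD (Sum.inr ⟨v, h⟩) := by
  simp [jetD, h]

theorem jetD_of_odd {v : Φ.JetVar} (h : ¬ Φ.par v.1 = 0) : Φ.jetD v = Φ.oddD (Sum.inr ⟨v, h⟩) := by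
  simp [jetD, h]

theorem jet_of_even {v : Φ.JetVar} (h : Φ.par v.1 = 0) :
    Φ.jet v = Φ.coordFun (Sum.inr ⟨v, h⟩) ⊗ₜ 1 := by
  simp [jet, h]

theorem jet_of_odd {v : Φ.JetVar} (h : ¬ Φ.par v.1 = 0) :
    Φ.jet v = Φ.oddGen (Sum.inr ⟨v, h⟩) := by
  simp [jet, h]

theorem par_eq_one {z : Φ.Species} (h : ¬ Φ.par z = 0) : Φ.par z = 1 :=
  (ZMod.eq_zero_or_one _).resolve_left h

theorem jetD_mul (v : Φ.JetVar) (f g : Φ.Form) :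
    Φ.jetD v (f * g) = Φ.jetD v f * g + Φ.twist (Φ.par v.1) f * Φ.jetD v g := by
  by_cases h : Φ.par v.1 = 0
  · rw [jetD_of_even h, h, evenD_mul, twist_zero]
  · rw [jetD_of_odd h, par_eq_one h, oddD_mul, twist_one]

theorem parityInvolution_jetD (v : Φ.JetVar) (f : Φ.Form) :
    Φ.parityInvolution (Φ.jetD v f) = sgn (Φ.par v.1) • Φ.jetD v (Φ.parityInvolution f) := by
  by_cases h : Φ.par v.1 = 0
  · rw [jetD_of_even h, h, parityInvolution_evenD, sgn_zero, one_smul]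
  · rw [jetD_of_odd h, par_eq_one h, parityInvolution_oddD, sgn_one, neg_one_smul]

theorem jetD_jetD (v u : Φ.JetVar) (f : Φ.Form) :
    Φ.jetD v (Φ.jetD u f) = sgn₂ (Φ.par v.1) (Φ.par u.1) • Φ.jetD u (Φ.jetD v f) := by
  by_cases h : Φ.par v.1 = 0 <;> by_cases h' : Φ.par u.1 = 0
  · rw [jetD_of_even h, jetD_of_even h', evenD_comm, h, sgn₂_zero_left, one_smul]
  · rw [jetD_of_even h, jetD_of_odd h', evenD_oddD, h, sgn₂_zero_left, one_smul]
  · rw [jetD_of_odd h, jetD_of_even h', evenD_oddD, h', sgn₂_zero_right, one_smul]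
  · rw [jetD_of_odd h, jetD_of_odd h', oddD_oddD, par_eq_one h, par_eq_one h', sgn₂_one_one,
      neg_one_smul]

theorem evenD_coordFun_tmul (c c' : Φ.EvenCoord) (h : c ≠ c') (a : Φ.OddAlgebra) :
    Φ.evenD c (Φ.coordFun c' ⊗ₜ a) = 0 := by
  rw [evenD_tmul, partialEven_coordFun, if_neg h, TensorProduct.zero_tmul]

theorem oddD_tmul_one (o : Φ.OddGen) (f : Φ.LocalFun) : Φ.oddD o (f ⊗ₜ 1) = 0 := by
  rw [oddD_tmul, CliffordAlgebra.contractLeft_one, TensorProduct.tmul_zero]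

open Classical in
theorem jetD_jet (v u : Φ.JetVar) : Φ.jetD v (Φ.jet u) = if v = u then 1 else 0 := by
  by_cases h : Φ.par v.1 = 0 <;> by_cases h' : Φ.par u.1 = 0
  · rw [jetD_of_even h, jet_of_even h', evenD_tmul, partialEven_coordFun]
    by_cases e : v = u
    · subst e; simp [Algebra.TensorProduct.one_def]
    · simp [e]
  · rw [jetD_of_even h, jet_of_odd h', evenD_oddGen, if_neg]
    rintro rfl; exact h' h
  · rw [jetD_of_odd h, jet_of_even h', oddD_tmul_one, if_neg]
    rintro rfl; exact h h'
  · rw [jetD_of_odd h, jet_of_odd h', oddD_oddGen]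
    by_cases e : v = u
    · subst e; simp
    · simp [e]

@[simp]
theorem evenD_inl_jet (μ : Fin Φ.dim) (v : Φ.JetVar) : Φ.evenD (Sum.inl μ) (Φ.jet v) = 0 := by
  by_cases h : Φ.par v.1 = 0
  · rw [jet_of_even h, evenD_coordFun_tmul _ _ (by simp)]
  · rw [jet_of_odd h, evenD_oddGen]

@[simp]
theorem oddD_inl_jet (μ : Fin Φ.dim) (v : Φ.JetVar) : Φ.oddD (Sum.inl μ) (Φ.jet v) = 0 := by
  by_cases h : Φ.par v.1 = 0
  · rw [jet_of_even h, oddD_tmul_one]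
  · rw [jet_of_odd h, oddD_oddGen, if_neg (by simp)]

@[simp]
theorem jetD_dx (v : Φ.JetVar) (μ : Fin Φ.dim) : Φ.jetD v (Φ.dx μ) = 0 := by
  by_cases h : Φ.par v.1 = 0
  · rw [jetD_of_even h, dx, evenD_oddGen]
  · rw [jetD_of_odd h, dx, oddD_oddGen, if_neg (by simp)]

@[simp]
theorem evenD_dx (c : Φ.EvenCoord) (μ : Fin Φ.dim) : Φ.evenD c (Φ.dx μ) = 0 :=
  evenD_oddGen _ _

open Classical in
theorem oddD_inl_dx (μ ν : Fin Φ.dim) :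
    Φ.oddD (Sum.inl μ) (Φ.dx ν) = if μ = ν then 1 else 0 := by
  rw [dx, oddD_oddGen]
  simp

theorem hasParity_dx (μ : Fin Φ.dim) : Φ.HasParity 1 (Φ.dx μ) := by
  simp [HasParity, dx]

theorem hasParity_jet (v : Φ.JetVar) : Φ.HasParity (Φ.par v.1) (Φ.jet v) := by
  by_cases h : Φ.par v.1 = 0
  · rw [HasParity, jet_of_even h, parityInvolution_tmul, map_one, h, sgn_zero, one_smul]
  · rw [HasParity, jet_of_odd h, parityInvolution_oddGen, par_eq_one h, sgn_one, neg_one_smul]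

theorem jetD_evenD_inl (v : Φ.JetVar) (μ : Fin Φ.dim) (f : Φ.Form) :
    Φ.jetD v (Φ.evenD (Sum.inl μ) f) = Φ.evenD (Sum.inl μ) (Φ.jetD v f) := by
  by_cases h : Φ.par v.1 = 0
  · rw [jetD_of_even h, evenD_comm]
  · rw [jetD_of_odd h, evenD_oddD]

theorem oddD_inl_jetD (v : Φ.JetVar) (μ : Fin Φ.dim) (f : Φ.Form) :
    Φ.oddD (Sum.inl μ) (Φ.jetD v f) = sgn (Φ.par v.1) • Φ.jetD v (Φ.oddD (Sum.inl μ) f) := by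
  by_cases h : Φ.par v.1 = 0
  · rw [jetD_of_even h, evenD_oddD, h, sgn_zero, one_smul]
  · rw [jetD_of_odd h, oddD_oddD, par_eq_one h, sgn_one, neg_one_smul]

theorem HasParity.mul {e e' : ZMod 2} {f g : Φ.Form} (hf : Φ.HasParity e f)
    (hg : Φ.HasParity e' g) : Φ.HasParity (e + e') (f * g) := by
  rw [HasParity, parityInvolution_mul, hf, hg, smul_mul_smul_comm]
  congr 1
  rcases ZMod.eq_zero_or_one e with rfl | rfl <;> rcases ZMod.eq_zero_or_one e' with rfl | rfl <;>
    simp [show (1 + 1 : ZMod 2) = 0 from rfl]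

theorem HasParity.jetD {e : ZMod 2} {f : Φ.Form} (hf : Φ.HasParity e f) (v : Φ.JetVar) :
    Φ.HasParity (e + Φ.par v.1) (Φ.jetD v f) := by
  rw [HasParity, parityInvolution_jetD, hf, map_smul, smul_smul]
  congr 1
  rcases ZMod.eq_zero_or_one e with rfl | rfl <;>
    rcases ZMod.eq_zero_or_one (Φ.par v.1) with h | h <;>
    simp [h, show (1 + 1 : ZMod 2) = 0 from rfl]

/-! ### Vertical vector fields -/

theorem vectorField_apply (Q : Φ.JetVar → Φ.Form) (f : Φ.Form) :
    Φ.vectorField Q f = ∑ᶠ v, Q v * Φ.jetD v f := rfl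

theorem vectorField_eq_sum (Q : Φ.JetVar → Φ.Form) {f : Φ.Form} {S : Finset Φ.JetVar}
    (hS : ∀ v, Φ.jetD v f ≠ 0 → v ∈ S) : Φ.vectorField Q f = ∑ v ∈ S, Q v * Φ.jetD v f :=
  finsum_eq_sum_of_support_subset _ fun v hv => hS v fun h => hv (by simp only [h, mul_zero])

theorem exists_finset_jetD (f : Φ.Form) :
    ∃ S : Finset Φ.JetVar, ∀ v, Φ.jetD v f ≠ 0 → v ∈ S :=
  ⟨(Φ.finite_jetD f).toFinset, fun _ hv => (Φ.finite_jetD f).mem_toFinset.2 hv⟩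

theorem exists_finset_jetD₂ (f g : Φ.Form) : ∃ S : Finset Φ.JetVar,
    (∀ v, Φ.jetD v f ≠ 0 → v ∈ S) ∧ ∀ v, Φ.jetD v g ≠ 0 → v ∈ S := by
  classical
  obtain ⟨S, hS⟩ := exists_finset_jetD f
  obtain ⟨T, hT⟩ := exists_finset_jetD g
  exact ⟨S ∪ T, fun v hv => Finset.mem_union_left _ (hS v hv),
    fun v hv => Finset.mem_union_right _ (hT v hv)⟩

/-- The vector field with components `Q` is homogeneous of parity `e`. -/
def IsHomogeneous (e : ZMod 2) (Q : Φ.JetVar → Φ.Form) : Prop :=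
  ∀ v, Φ.HasParity (e + Φ.par v.1) (Q v)

theorem twist_add (e e' : ZMod 2) (f : Φ.Form) :
    Φ.twist (e + e') f = Φ.twist e (Φ.twist e' f) := by
  rcases ZMod.eq_zero_or_one e with rfl | rfl <;> rcases ZMod.eq_zero_or_one e' with rfl | rfl
  · rw [add_zero, twist_zero, twist_zero]
  · rw [zero_add, twist_zero]
  · rw [add_zero, twist_zero]
  · rw [show (1 + 1 : ZMod 2) = 0 from rfl, twist_twist, twist_zero]

theorem sgn₂_add (e e' e'' : ZMod 2) : sgn₂ e (e' + e'') = sgn₂ e e' * sgn₂ e e'' := by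
  rcases ZMod.eq_zero_or_one e with rfl | rfl <;> rcases ZMod.eq_zero_or_one e' with rfl | rfl <;>
    rcases ZMod.eq_zero_or_one e'' with rfl | rfl <;> simp [show (1 + 1 : ZMod 2) = 0 from rfl]

theorem sgn_add (e e' : ZMod 2) : sgn (e + e') = sgn e * sgn e' := by
  rcases ZMod.eq_zero_or_one e with rfl | rfl <;> rcases ZMod.eq_zero_or_one e' with rfl | rfl <;>
    simp [show (1 + 1 : ZMod 2) = 0 from rfl]

theorem jetD_ne_zero_of_jetD {v u : Φ.JetVar} {f : Φ.Form} (h : Φ.jetD u (Φ.jetD v f) ≠ 0) :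
    Φ.jetD u f ≠ 0 := by
  intro h'
  rw [jetD_jetD, h', LinearMap.map_zero, smul_zero] at h
  exact h rfl

/-- Moving the component `Q v`, of parity `e + par v`, past `f` cancels the twist `par v` left by
the derivative itself, so the same twist `e` remains in every summand. -/
theorem vectorField_mul {e : ZMod 2} {Q : Φ.JetVar → Φ.Form} (hQ : IsHomogeneous e Q)
    (f g : Φ.Form) :
    Φ.vectorField Q (f * g) = Φ.vectorField Q f * g + Φ.twist e f * Φ.vectorField Q g := by
  classical
  obtain ⟨S, hS, hS'⟩ := exists_finset_jetD₂ f g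
  have hm : ∀ v, Φ.jetD v (f * g) ≠ 0 → v ∈ S := by
    intro v hv
    by_contra h
    refine hv ?_
    rw [jetD_mul, not_not.1 (mt (hS v) h), not_not.1 (mt (hS' v) h), zero_mul, mul_zero, add_zero]
  rw [vectorField_eq_sum Q hS, vectorField_eq_sum Q hS', vectorField_eq_sum Q hm, Finset.sum_mul,
    Finset.mul_sum, ← Finset.sum_add_distrib]
  refine Finset.sum_congr rfl fun v _ => ?_
  rw [jetD_mul, mul_add, ← mul_assoc, ← mul_assoc, ← mul_assoc, (hQ v).mul_comm, add_comm e,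
    twist_add, twist_twist]

/-- The sign from passing the component and the sign from exchanging the two derivatives share the
factor that depends on `u`; it squares to one and only the parities of `v` and of the field survive.
-/
theorem jetD_vectorField {e : ZMod 2} {Q : Φ.JetVar → Φ.Form} (hQ : IsHomogeneous e Q)
    (v : Φ.JetVar) (f : Φ.Form) :
    Φ.jetD v (Φ.vectorField Q f) = Φ.vectorField (fun u => Φ.jetD v (Q u)) f +
      sgn₂ (Φ.par v.1) e • Φ.vectorField Q (Φ.jetD v f) := by
  obtain ⟨S, hS⟩ := exists_finset_jetD f
  have hS' : ∀ u, Φ.jetD u (Φ.jetD v f) ≠ 0 → u ∈ S := fun u hu => hS u (jetD_ne_zero_of_jetD hu)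
  rw [vectorField_eq_sum Q hS, vectorField_eq_sum _ hS, vectorField_eq_sum Q hS', map_sum,
    Finset.smul_sum, ← Finset.sum_add_distrib]
  refine Finset.sum_congr rfl fun u _ => ?_
  rw [jetD_mul, (hQ u).twist, jetD_jetD, smul_mul_smul_comm, sgn₂_comm (e + _), sgn₂_add, mul_assoc, sgn₂_mul_self,
    mul_one]

theorem evenD_inl_vectorField (μ : Fin Φ.dim) (Q : Φ.JetVar → Φ.Form) (f : Φ.Form) :
    Φ.evenD (Sum.inl μ) (Φ.vectorField Q f) =
      Φ.vectorField (fun u => Φ.evenD (Sum.inl μ) (Q u)) f +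
        Φ.vectorField Q (Φ.evenD (Sum.inl μ) f) := by
  obtain ⟨S, hS⟩ := exists_finset_jetD f
  have hS' : ∀ u, Φ.jetD u (Φ.evenD (Sum.inl μ) f) ≠ 0 → u ∈ S := fun u hu => hS u fun h => hu (by
    rw [jetD_evenD_inl, h, LinearMap.map_zero])
  rw [vectorField_eq_sum Q hS, vectorField_eq_sum _ hS, vectorField_eq_sum Q hS', map_sum,
    ← Finset.sum_add_distrib]
  refine Finset.sum_congr rfl fun u _ => ?_
  rw [evenD_mul, jetD_evenD_inl]

/-- A linear operator conjugated by the parity involution. -/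
def parityConj (X : Φ.Form →ₗ[ℝ] Φ.Form) : Φ.Form →ₗ[ℝ] Φ.Form :=
  Φ.parityInvolution ∘ₗ X ∘ₗ Φ.parityInvolution

theorem parityConj_apply (X : Φ.Form →ₗ[ℝ] Φ.Form) (f : Φ.Form) :
    parityConj X f = Φ.parityInvolution (X (Φ.parityInvolution f)) := rfl

/-- Conjugation fixes the even part of a field and reverses the odd part. It replaces the sign in a
graded commutator with an odd operator when the field has no definite parity. -/
theorem parityConj_vectorField (Q : Φ.JetVar → Φ.Form) :
    parityConj (Φ.vectorField Q) =
      Φ.vectorField fun v => sgn (Φ.par v.1) • Φ.parityInvolution (Q v) := by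
  refine LinearMap.ext fun f => ?_
  obtain ⟨S, hS, hS'⟩ := exists_finset_jetD₂ f (Φ.parityInvolution f)
  rw [parityConj_apply, vectorField_eq_sum _ hS, vectorField_eq_sum _ hS', map_sum]
  refine Finset.sum_congr rfl fun u _ => ?_
  rw [parityInvolution_mul, parityInvolution_jetD, parityInvolution_parityInvolution,
    mul_smul_comm, smul_mul_assoc]

theorem parityConj_vectorField_of_isHomogeneous {e : ZMod 2} {Q : Φ.JetVar → Φ.Form}
    (hQ : IsHomogeneous e Q) : parityConj (Φ.vectorField Q) = sgn e • Φ.vectorField Q := by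
  rw [parityConj_vectorField]
  refine LinearMap.ext fun f => ?_
  obtain ⟨S, hS⟩ := exists_finset_jetD f
  rw [LinearMap.smul_apply, vectorField_eq_sum _ hS, vectorField_eq_sum _ hS, Finset.smul_sum]
  refine Finset.sum_congr rfl fun u _ => ?_
  rw [hQ u, smul_smul, sgn_add, mul_comm (sgn e), ← mul_assoc, sgn_mul_self, one_mul,
    smul_mul_assoc]

/-- The derivative along `dx^μ` is odd, so it conjugates a field that it passes. The hypothesis on
`Q` removes the term in which it hits the components. -/
theorem oddD_inl_vectorField (μ : Fin Φ.dim) {Q : Φ.JetVar → Φ.Form}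
    (hQ : ∀ v, Φ.oddD (Sum.inl μ) (Q v) = 0) (f : Φ.Form) :
    Φ.oddD (Sum.inl μ) (Φ.vectorField Q f) =
      parityConj (Φ.vectorField Q) (Φ.oddD (Sum.inl μ) f) := by
  obtain ⟨S, hS⟩ := exists_finset_jetD f
  have hS' : ∀ u, Φ.jetD u (Φ.oddD (Sum.inl μ) f) ≠ 0 → u ∈ S := fun u hu => hS u fun h => hu (by
    have := oddD_inl_jetD u μ f
    rw [h, LinearMap.map_zero] at this
    rw [← one_smul ℝ (Φ.jetD u _), ← sgn_mul_self (Φ.par u.1), mul_smul, ← this, smul_zero])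
  rw [parityConj_vectorField, vectorField_eq_sum _ hS, vectorField_eq_sum _ hS', map_sum]
  refine Finset.sum_congr rfl fun u _ => ?_
  rw [oddD_mul, hQ, zero_mul, zero_add, oddD_inl_jetD, mul_smul_comm, smul_mul_assoc]

theorem vectorField_dx_mul (Q : Φ.JetVar → Φ.Form) (μ : Fin Φ.dim) (f : Φ.Form) :
    Φ.dx μ * Φ.vectorField Q f = parityConj (Φ.vectorField Q) (Φ.dx μ * f) := by
  have h : ∀ u, Φ.jetD u (Φ.dx μ * f) = sgn (Φ.par u.1) • (Φ.dx μ * Φ.jetD u f) := fun u => by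
    rw [jetD_mul, jetD_dx, zero_mul, zero_add, (hasParity_dx μ).twist, smul_mul_assoc]
    congr 1
    rcases ZMod.eq_zero_or_one (Φ.par u.1) with h | h <;> simp [h]
  obtain ⟨S, hS⟩ := exists_finset_jetD f
  have hS' : ∀ u, Φ.jetD u (Φ.dx μ * f) ≠ 0 → u ∈ S := fun u hu => hS u fun h' => hu (by
    rw [h, h', mul_zero, smul_zero])
  rw [parityConj_vectorField, vectorField_eq_sum _ hS, vectorField_eq_sum _ hS', Finset.mul_sum]
  refine Finset.sum_congr rfl fun u _ => ?_
  rw [h, smul_mul_smul_comm, sgn_mul_self, one_smul, ← mul_assoc, ← mul_assoc,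
    (hasParity_dx μ).mul_comm, twist_one, parityInvolution_parityInvolution]

/-! ### Total derivatives -/

/-- The jet coordinate `∂_μ v`. -/
def shift (μ : Fin Φ.dim) (v : Φ.JetVar) : Φ.JetVar := (v.1, v.2 + Finsupp.single μ 1)

theorem shift_injective (μ : Fin Φ.dim) : Function.Injective (shift (Φ := Φ) μ) := by
  rintro ⟨z, I⟩ ⟨z', I'⟩ h
  simpa [shift] using h

theorem isHomogeneous_jet_shift (μ : Fin Φ.dim) :
    IsHomogeneous 0 fun v : Φ.JetVar => Φ.jet (shift μ v) := fun v => by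
  rw [zero_add]; exact hasParity_jet (shift μ v)

theorem totalD_apply (μ : Fin Φ.dim) (f : Φ.Form) :
    Φ.totalD μ f = Φ.evenD (Sum.inl μ) f + Φ.vectorField (fun v => Φ.jet (shift μ v)) f := rfl

theorem totalD_mul (μ : Fin Φ.dim) (f g : Φ.Form) :
    Φ.totalD μ (f * g) = Φ.totalD μ f * g + f * Φ.totalD μ g := by
  simp only [totalD_apply, evenD_mul, vectorField_mul (isHomogeneous_jet_shift μ), twist_zero,
    add_mul, mul_add]
  abel

theorem parityInvolution_totalD (μ : Fin Φ.dim) (f : Φ.Form) :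
    Φ.parityInvolution (Φ.totalD μ f) = Φ.totalD μ (Φ.parityInvolution f) := by
  have h := parityConj_vectorField_of_isHomogeneous (isHomogeneous_jet_shift (Φ := Φ) μ)
  replace h := LinearMap.congr_fun h (Φ.parityInvolution f)
  rw [parityConj_apply, parityInvolution_parityInvolution, sgn_zero, one_smul] at h
  rw [totalD_apply, totalD_apply, LinearMap.map_add, h, parityInvolution_evenD]

theorem twist_totalD (e : ZMod 2) (μ : Fin Φ.dim) (f : Φ.Form) :
    Φ.twist e (Φ.totalD μ f) = Φ.totalD μ (Φ.twist e f) := by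
  rcases ZMod.eq_zero_or_one e with rfl | rfl
  · simp only [twist_zero]
  · simp only [twist_one, parityInvolution_totalD]

theorem oddD_inl_totalD (ν μ : Fin Φ.dim) (f : Φ.Form) :
    Φ.oddD (Sum.inl ν) (Φ.totalD μ f) = Φ.totalD μ (Φ.oddD (Sum.inl ν) f) := by
  rw [totalD_apply, totalD_apply, LinearMap.map_add,
    oddD_inl_vectorField ν (fun v => oddD_inl_jet ν _),
    parityConj_vectorField_of_isHomogeneous (isHomogeneous_jet_shift μ), sgn_zero, one_smul,
    evenD_oddD]

theorem vectorField_jet (Q : Φ.JetVar → Φ.Form) (v : Φ.JetVar) :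
    Φ.vectorField Q (Φ.jet v) = Q v := by
  classical
  rw [vectorField_eq_sum (S := {v}) Q]
  · rw [Finset.sum_singleton, jetD_jet, if_pos rfl, mul_one]
  · intro u hu
    rw [jetD_jet] at hu
    by_contra h
    exact hu (if_neg fun h' => h (Finset.mem_singleton.2 h'))

@[simp]
theorem totalD_jet (μ : Fin Φ.dim) (v : Φ.JetVar) :
    Φ.totalD μ (Φ.jet v) = Φ.jet (shift μ v) := by
  rw [totalD_apply, evenD_inl_jet, zero_add, vectorField_jet]

@[simp]
theorem vectorField_dx (Q : Φ.JetVar → Φ.Form) (μ : Fin Φ.dim) :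
    Φ.vectorField Q (Φ.dx μ) = 0 := by
  rw [vectorField_eq_sum (S := ∅) Q]
  · simp
  · intro v hv; simp at hv

@[simp]
theorem totalD_dx (ν μ : Fin Φ.dim) : Φ.totalD ν (Φ.dx μ) = 0 := by
  rw [totalD_apply, evenD_dx, vectorField_dx, add_zero]

open Classical in
theorem jetD_totalD (v : Φ.JetVar) (μ : Fin Φ.dim) (f : Φ.Form) :
    Φ.jetD v (Φ.totalD μ f) = Φ.totalD μ (Φ.jetD v f) +
      Φ.vectorField (fun u => if v = shift μ u then 1 else 0) f := by
  rw [totalD_apply, totalD_apply, LinearMap.map_add, jetD_vectorField (isHomogeneous_jet_shift μ),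
    sgn₂_zero_right, one_smul, jetD_evenD_inl]
  simp only [jetD_jet]
  abel

/-- The total derivative contains the term with coefficient `∂_μ v`, and by injectivity of the shift
no other term has this coefficient. This commutator is the origin of the momentum `p_μ` in
`symbolD`. -/
theorem jetD_shift_totalD (v : Φ.JetVar) (μ : Fin Φ.dim) (f : Φ.Form) :
    Φ.jetD (shift μ v) (Φ.totalD μ f) = Φ.totalD μ (Φ.jetD (shift μ v) f) + Φ.jetD v f := by
  classical
  rw [jetD_totalD]
  congr 1
  obtain ⟨S, hS⟩ := exists_finset_jetD f
  rw [vectorField_eq_sum (S := insert v S) _ fun u hu => Finset.mem_insert_of_mem (hS u hu),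
    Finset.sum_eq_single v]
  · rw [if_pos rfl, one_mul]
  · intro u _ hu
    rw [if_neg fun h => hu (shift_injective μ h).symm, zero_mul]
  · intro h; exact absurd (Finset.mem_insert_self _ _) h

theorem jetD_totalD_of_notMem_range (v : Φ.JetVar) (μ : Fin Φ.dim) (hv : v ∉ Set.range (shift μ))
    (f : Φ.Form) : Φ.jetD v (Φ.totalD μ f) = Φ.totalD μ (Φ.jetD v f) := by
  classical
  rw [jetD_totalD, vectorField_apply, finsum_eq_zero_of_forall_eq_zero, add_zero]
  intro u
  rw [if_neg fun h => hv ⟨u, h.symm⟩, zero_mul]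

/-- A vector field whose components are compatible with total derivatives commutes with them. -/
theorem totalD_vectorField {μ : Fin Φ.dim} {Q : Φ.JetVar → Φ.Form}
    (hQ : ∀ v, Q (shift μ v) = Φ.totalD μ (Q v)) (f : Φ.Form) :
    Φ.totalD μ (Φ.vectorField Q f) = Φ.vectorField Q (Φ.totalD μ f) := by
  classical
  obtain ⟨S, hS, hS'⟩ := exists_finset_jetD₂ f (Φ.totalD μ f)
  have hT : ∀ v, Φ.jetD v f ≠ 0 → v ∈ S ∪ S.image (shift μ) :=
    fun v hv => Finset.mem_union_left _ (hS v hv)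
  have hT' : ∀ v, Φ.jetD v (Φ.totalD μ f) ≠ 0 → v ∈ S ∪ S.image (shift μ) :=
    fun v hv => Finset.mem_union_left _ (hS' v hv)
  -- The commutator of `∂/∂v` with the total derivative vanishes unless `v` is a shifted coordinate,
  -- where it is the derivative along the unshifted one. Reindexing along the shift, compatibility
  -- of `Q` supplies exactly the terms in which the total derivative acts on the components.
  have key : ∑ v ∈ S ∪ S.image (shift μ),
      Q v * (Φ.jetD v (Φ.totalD μ f) - Φ.totalD μ (Φ.jetD v f)) =
        ∑ v ∈ S, Φ.totalD μ (Q v) * Φ.jetD v f := by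
    have h1 : ∑ v ∈ S.image (shift μ),
        Q v * (Φ.jetD v (Φ.totalD μ f) - Φ.totalD μ (Φ.jetD v f)) =
          ∑ v ∈ S, Φ.totalD μ (Q v) * Φ.jetD v f := by
      rw [Finset.sum_image fun a _ b _ h => shift_injective μ h]
      refine Finset.sum_congr rfl fun v _ => ?_
      rw [jetD_shift_totalD, add_sub_cancel_left, hQ]
    rw [← h1]
    refine (Finset.sum_subset Finset.subset_union_right fun v _ hv => ?_).symm
    by_cases hr : v ∈ Set.range (shift μ)
    · obtain ⟨u, rfl⟩ := hr
      have hu : Φ.jetD u f = 0 := by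
        by_contra h
        exact hv (Finset.mem_image_of_mem _ (hS u h))
      rw [jetD_shift_totalD, hu, add_zero, sub_self, mul_zero]
    · rw [jetD_totalD_of_notMem_range v μ hr, sub_self, mul_zero]
  have hz : ∑ v ∈ S, Q v * Φ.totalD μ (Φ.jetD v f) =
      ∑ v ∈ S ∪ S.image (shift μ), Q v * Φ.totalD μ (Φ.jetD v f) :=
    Finset.sum_subset Finset.subset_union_left fun v _ hv => by
      rw [not_not.1 (mt (hS v) hv), LinearMap.map_zero, mul_zero]
  rw [vectorField_eq_sum Q hT', vectorField_eq_sum Q hS, map_sum]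
  simp only [totalD_mul]
  rw [Finset.sum_add_distrib, ← key, hz, ← Finset.sum_add_distrib]
  refine Finset.sum_congr rfl fun v _ => ?_
  rw [← mul_add, sub_add_cancel]

theorem shift_comm (μ ν : Fin Φ.dim) (v : Φ.JetVar) :
    shift μ (shift ν v) = shift ν (shift μ v) := by
  simp only [shift, add_right_comm]

theorem evenD_inl_totalD (ν μ : Fin Φ.dim) (f : Φ.Form) :
    Φ.evenD (Sum.inl ν) (Φ.totalD μ f) = Φ.totalD μ (Φ.evenD (Sum.inl ν) f) := by
  rw [totalD_apply, totalD_apply, LinearMap.map_add, evenD_inl_vectorField, evenD_comm]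
  congr 1
  rw [vectorField_apply, finsum_eq_zero_of_forall_eq_zero, zero_add]
  intro v
  rw [evenD_inl_jet, zero_mul]

/-- Apart from the explicit `x`-derivative, a total derivative is itself a field with components
compatible with the other total derivatives, so `totalD_vectorField` applies to it. -/
theorem totalD_comm (μ ν : Fin Φ.dim) (f : Φ.Form) :
    Φ.totalD μ (Φ.totalD ν f) = Φ.totalD ν (Φ.totalD μ f) := by
  rw [totalD_apply ν, totalD_apply ν, LinearMap.map_add, evenD_inl_totalD, totalD_vectorField]
  intro v
  rw [totalD_jet, shift_comm]

/-! ### Iterated total derivatives. -/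

/-- An iterated derivative is an ordered product over the list of directions. Commutativity brings
the additional factors to the front, one for each occurrence of `i`; in `List.finRange` there is
exactly one. -/
theorem prod_map_pow_add_single {R ι : Type*} [Monoid R] [DecidableEq ι] (D : ι → R)
    (hD : ∀ i j, Commute (D i) (D j)) (I : ι →₀ ℕ) (i : ι) (l : List ι) :
    (l.map fun j => D j ^ (I + Finsupp.single i 1 : ι →₀ ℕ) j).prod =
      D i ^ l.count i * (l.map fun j => D j ^ I j).prod := by
  induction l with
  | nil => simp
  | cons j l ih =>
    rw [List.map_cons, List.prod_cons, ih, List.map_cons, List.prod_cons]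
    by_cases h : j = i
    · subst h
      rw [List.count_cons_self, Finsupp.add_apply, Finsupp.single_eq_same, ← mul_assoc,
        ← mul_assoc, ← pow_add, ← pow_add]
      congr 2
      omega
    · rw [List.count_cons_of_ne h, Finsupp.add_apply, Finsupp.single_eq_of_ne h, add_zero,
        ← mul_assoc, ← mul_assoc, ((hD i j).pow_pow _ _).eq]

@[simp]
theorem totalDI_zero (f : Φ.Form) : Φ.totalDI 0 f = f := by
  have : Φ.totalDI 0 = 1 := List.prod_eq_one fun x hx => by
    obtain ⟨μ, -, rfl⟩ := List.mem_map.1 hx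
    rw [Finsupp.zero_apply, pow_zero]
  rw [this, Module.End.one_apply]

theorem totalDI_add_single (I : Φ.MultiIndex) (μ : Fin Φ.dim) (f : Φ.Form) :
    Φ.totalDI (I + Finsupp.single μ 1) f = Φ.totalD μ (Φ.totalDI I f) := by
  have h := prod_map_pow_add_single (R := Module.End ℝ Φ.Form) Φ.totalD
    (fun i j => LinearMap.ext fun f => totalD_comm i j f) I μ (List.finRange Φ.dim)
  rw [(List.nodup_finRange _).count, if_pos (List.mem_finRange μ), pow_one] at h
  exact LinearMap.congr_fun h f

theorem MultiIndex.induction {p : Φ.MultiIndex → Prop} (zero : p 0)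
    (add : ∀ I μ, p I → p (I + Finsupp.single μ 1)) (I : Φ.MultiIndex) : p I := by
  induction I using Finsupp.induction with
  | zero => exact zero
  | single_add μ n I _ _ ih =>
    clear * - ih add
    induction n with
    | zero => simpa using ih
    | succ n ihn =>
      have : Finsupp.single μ (n + 1) + I = Finsupp.single μ n + I + Finsupp.single μ 1 := by
        rw [Finsupp.single_add]; abel
      rw [this]
      exact add _ _ ihn

theorem totalDI_totalD (I : Φ.MultiIndex) (μ : Fin Φ.dim) (f : Φ.Form) :
    Φ.totalDI I (Φ.totalD μ f) = Φ.totalD μ (Φ.totalDI I f) := by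
  induction I using MultiIndex.induction with
  | zero => simp only [totalDI_zero]
  | add I ν ih => rw [totalDI_add_single, totalDI_add_single, ih, totalD_comm]

/-- A linear map that commutes with total derivatives commutes with iterated ones. -/
theorem totalDI_comm_of_totalD {X : Φ.Form →ₗ[ℝ] Φ.Form}
    (hX : ∀ μ f, X (Φ.totalD μ f) = Φ.totalD μ (X f)) (I : Φ.MultiIndex) (f : Φ.Form) :
    X (Φ.totalDI I f) = Φ.totalDI I (X f) := by
  induction I using MultiIndex.induction with
  | zero => simp only [totalDI_zero]
  | add I μ ih => rw [totalDI_add_single, totalDI_add_single, hX, ih]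

/-! ### Evolutionary vector fields -/

variable (Φ) in
/-- The components of the evolutionary vector field with characteristic `q`. -/
def prolong (q : Φ.Species → Φ.Form) (v : Φ.JetVar) : Φ.Form := Φ.totalDI v.2 (q v.1)

theorem prolong_shift (q : Φ.Species → Φ.Form) (μ : Fin Φ.dim) (v : Φ.JetVar) :
    Φ.prolong q (shift μ v) = Φ.totalD μ (Φ.prolong q v) :=
  totalDI_add_single _ _ _

theorem totalD_vectorField_prolong (q : Φ.Species → Φ.Form) (μ : Fin Φ.dim) (f : Φ.Form) :
    Φ.totalD μ (Φ.vectorField (Φ.prolong q) f) = Φ.vectorField (Φ.prolong q) (Φ.totalD μ f) :=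
  totalD_vectorField (prolong_shift q μ) f

theorem s_eq (L : Φ.Form) : Φ.s L = Φ.vectorField (Φ.prolong (Φ.brstGen L)) := rfl

theorem parityInvolution_totalDI (I : Φ.MultiIndex) (f : Φ.Form) :
    Φ.parityInvolution (Φ.totalDI I f) = Φ.totalDI I (Φ.parityInvolution f) :=
  totalDI_comm_of_totalD parityInvolution_totalD I f

theorem twist_totalDI (e : ZMod 2) (I : Φ.MultiIndex) (f : Φ.Form) :
    Φ.twist e (Φ.totalDI I f) = Φ.totalDI I (Φ.twist e f) :=
  totalDI_comm_of_totalD (twist_totalD e) I f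

theorem oddD_inl_totalDI (ν : Fin Φ.dim) (I : Φ.MultiIndex) (f : Φ.Form) :
    Φ.oddD (Sum.inl ν) (Φ.totalDI I f) = Φ.totalDI I (Φ.oddD (Sum.inl ν) f) :=
  totalDI_comm_of_totalD (oddD_inl_totalD ν) I f

theorem HasParity.totalDI {e : ZMod 2} {f : Φ.Form} (hf : Φ.HasParity e f) (I : Φ.MultiIndex) :
    Φ.HasParity e (Φ.totalDI I f) := by
  rw [HasParity, parityInvolution_totalDI, hf, LinearMap.map_smul]

theorem isHomogeneous_prolong {e : ZMod 2} {q : Φ.Species → Φ.Form}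
    (hq : ∀ z, Φ.HasParity (e + Φ.par z) (q z)) : IsHomogeneous e (Φ.prolong q) :=
  fun v => (hq v.1).totalDI v.2

/-! ### Ghost number -/

theorem isHomogeneous_ghost :
    IsHomogeneous 0 fun v : Φ.JetVar => (Φ.ghost v.1 : ℝ) • Φ.jet v := fun v => by
  rw [zero_add, HasParity, LinearMap.map_smul, hasParity_jet v, smul_comm]

theorem ghostOp_apply (f : Φ.Form) :
    Φ.ghostOp f = Φ.vectorField (fun v => (Φ.ghost v.1 : ℝ) • Φ.jet v) f := rfl

theorem ghostOp_mul (f g : Φ.Form) : Φ.ghostOp (f * g) = Φ.ghostOp f * g + f * Φ.ghostOp g := by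
  simp only [ghostOp_apply, vectorField_mul isHomogeneous_ghost, twist_zero]

theorem totalD_ghostOp (μ : Fin Φ.dim) (f : Φ.Form) :
    Φ.totalD μ (Φ.ghostOp f) = Φ.ghostOp (Φ.totalD μ f) := by
  refine totalD_vectorField (fun v => ?_) f
  rw [LinearMap.map_smul, totalD_jet]
  rfl

theorem parityInvolution_ghostOp (f : Φ.Form) :
    Φ.parityInvolution (Φ.ghostOp f) = Φ.ghostOp (Φ.parityInvolution f) := by
  have h := parityConj_vectorField_of_isHomogeneous (isHomogeneous_ghost (Φ := Φ))
  replace h := LinearMap.congr_fun h (Φ.parityInvolution f)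
  rw [parityConj_apply, parityInvolution_parityInvolution, sgn_zero, one_smul] at h
  exact h

theorem oddD_inl_ghostOp (ν : Fin Φ.dim) (f : Φ.Form) :
    Φ.oddD (Sum.inl ν) (Φ.ghostOp f) = Φ.ghostOp (Φ.oddD (Sum.inl ν) f) := by
  rw [ghostOp_apply, oddD_inl_vectorField ν,
    parityConj_vectorField_of_isHomogeneous isHomogeneous_ghost, sgn_zero, one_smul]
  · rfl
  · intro v
    rw [LinearMap.map_smul, oddD_inl_jet, smul_zero]

theorem jetD_ghostOp (v : Φ.JetVar) (f : Φ.Form) :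
    Φ.jetD v (Φ.ghostOp f) = Φ.ghostOp (Φ.jetD v f) + (Φ.ghost v.1 : ℝ) • Φ.jetD v f := by
  classical
  rw [ghostOp_apply, jetD_vectorField isHomogeneous_ghost, sgn₂_zero_right, one_smul, add_comm]
  congr 1
  obtain ⟨S, hS⟩ := exists_finset_jetD f
  rw [vectorField_eq_sum (S := insert v S) _ fun u hu => Finset.mem_insert_of_mem (hS u hu),
    Finset.sum_eq_single v]
  · rw [LinearMap.map_smul, jetD_jet, if_pos rfl, smul_mul_assoc, one_mul]
  · intro u _ hu
    rw [LinearMap.map_smul, jetD_jet, if_neg (Ne.symm hu), smul_zero, zero_mul]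
  · intro h; exact absurd (Finset.mem_insert_self _ _) h

variable (Φ) in
/-- `f` has ghost number `g`. -/
def HasGhost (g : ℝ) (f : Φ.Form) : Prop := Φ.ghostOp f = g • f

theorem HasGhost.mul {g g' : ℝ} {f f' : Φ.Form} (h : Φ.HasGhost g f) (h' : Φ.HasGhost g' f') :
    Φ.HasGhost (g + g') (f * f') := by
  rw [HasGhost, ghostOp_mul, h, h', smul_mul_assoc, mul_smul_comm, add_smul]

theorem HasGhost.of_eq {g g' : ℝ} {f : Φ.Form} (h : Φ.HasGhost g f) (e : g = g') :
    Φ.HasGhost g' f := e ▸ h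

theorem HasGhost.totalD {g : ℝ} {f : Φ.Form} (h : Φ.HasGhost g f) (μ : Fin Φ.dim) :
    Φ.HasGhost g (Φ.totalD μ f) := by
  rw [HasGhost, ← totalD_ghostOp, h, LinearMap.map_smul]

theorem HasGhost.totalDI {g : ℝ} {f : Φ.Form} (h : Φ.HasGhost g f) (I : Φ.MultiIndex) :
    Φ.HasGhost g (Φ.totalDI I f) := by
  rw [HasGhost, totalDI_comm_of_totalD (fun μ f => (totalD_ghostOp μ f).symm), h,
    LinearMap.map_smul]

theorem HasGhost.parityInvolution {g : ℝ} {f : Φ.Form} (h : Φ.HasGhost g f) :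
    Φ.HasGhost g (Φ.parityInvolution f) := by
  rw [HasGhost, ← parityInvolution_ghostOp, h, LinearMap.map_smul]

theorem HasGhost.twist {g : ℝ} {f : Φ.Form} (h : Φ.HasGhost g f) (e : ZMod 2) :
    Φ.HasGhost g (Φ.twist e f) := by
  rcases ZMod.eq_zero_or_one e with rfl | rfl
  · rwa [twist_zero]
  · rw [twist_one]; exact h.parityInvolution

theorem HasGhost.oddD_inl {g : ℝ} {f : Φ.Form} (h : Φ.HasGhost g f) (μ : Fin Φ.dim) :
    Φ.HasGhost g (Φ.oddD (Sum.inl μ) f) := by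
  rw [HasGhost, ← oddD_inl_ghostOp, h, LinearMap.map_smul]

theorem HasGhost.jetD {g : ℝ} {f : Φ.Form} (h : Φ.HasGhost g f) (v : Φ.JetVar) :
    Φ.HasGhost (g - Φ.ghost v.1) (Φ.jetD v f) := by
  have h' := jetD_ghostOp v f
  rw [h, LinearMap.map_smul] at h'
  rw [HasGhost, sub_smul, h', add_sub_cancel_right]

theorem HasGhost.add {g : ℝ} {f f' : Φ.Form} (h : Φ.HasGhost g f) (h' : Φ.HasGhost g f') :
    Φ.HasGhost g (f + f') := by
  rw [HasGhost, LinearMap.map_add, h, h', smul_add]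

theorem HasGhost.smul {g : ℝ} {f : Φ.Form} (h : Φ.HasGhost g f) (r : ℝ) :
    Φ.HasGhost g (r • f) := by
  rw [HasGhost, LinearMap.map_smul, h, smul_comm]

theorem HasGhost.sum {ι : Type*} {g : ℝ} {f : ι → Φ.Form} {S : Finset ι}
    (h : ∀ i ∈ S, Φ.HasGhost g (f i)) : Φ.HasGhost g (∑ i ∈ S, f i) := by
  rw [HasGhost, map_sum, Finset.smul_sum]
  exact Finset.sum_congr rfl h

theorem hasGhost_dx (μ : Fin Φ.dim) : Φ.HasGhost 0 (Φ.dx μ) := by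
  rw [HasGhost, ghostOp_apply, vectorField_dx, zero_smul]

theorem hasGhost_one : Φ.HasGhost 0 (1 : Φ.Form) := by
  have h := ghostOp_mul (1 : Φ.Form) 1
  rw [one_mul, one_mul, mul_one] at h
  rw [HasGhost, zero_smul]
  exact left_eq_add.1 h

theorem HasGhost.vectorField {g g' : ℝ} {Q : Φ.JetVar → Φ.Form}
    (hQ : ∀ v, Φ.HasGhost (g + Φ.ghost v.1) (Q v)) {f : Φ.Form} (hf : Φ.HasGhost g' f) :
    Φ.HasGhost (g' + g) (Φ.vectorField Q f) := by
  obtain ⟨S, hS⟩ := exists_finset_jetD f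
  rw [vectorField_eq_sum Q hS]
  exact HasGhost.sum fun v _ => ((hQ v).mul (hf.jetD v)).of_eq (by ring)

/-! ### Symbols of variational derivatives

A finitely supported family `G` of local forms indexed by multi-indices stands for the polynomial
`∑ p ^ I G_I` in formal momenta `p_μ`. -/

variable (Φ) in
abbrev Symbol := Φ.MultiIndex →₀ Φ.Form

theorem finite_jetCoeffs (z : Φ.Species) (f : Φ.Form) :
    (Function.support fun I : Φ.MultiIndex => Φ.jetD (z, I) f).Finite :=
  (Φ.finite_jetD f).preimage (f := fun I : Φ.MultiIndex => (z, I))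
    (fun _ _ _ _ h => (Prod.ext_iff.1 h).2)

variable (Φ) in
/-- The symbol `∑ p ^ I ∂f/∂(∂_I z)`. -/
def jetCoeffs (z : Φ.Species) : Φ.Form →ₗ[ℝ] Φ.Symbol where
  toFun f := Finsupp.ofSupportFinite (fun I => Φ.jetD (z, I) f) (finite_jetCoeffs z f)
  map_add' f g := Finsupp.ext fun _ => LinearMap.map_add _ f g
  map_smul' r f := Finsupp.ext fun _ => LinearMap.map_smul _ r f

theorem jetCoeffs_apply (z : Φ.Species) (f : Φ.Form) (I : Φ.MultiIndex) :
    Φ.jetCoeffs z f I = Φ.jetD (z, I) f := rfl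

variable (Φ) in
/-- The symbol of the operator `∂_μ + p_μ`. -/
def symbolD (μ : Fin Φ.dim) : Φ.Symbol →ₗ[ℝ] Φ.Symbol :=
  Finsupp.mapRange.linearMap (Φ.totalD μ) +
    Finsupp.lmapDomain Φ.Form ℝ fun I : Φ.MultiIndex => I + Finsupp.single μ 1

theorem symbolD_single (μ : Fin Φ.dim) (I : Φ.MultiIndex) (f : Φ.Form) :
    Φ.symbolD μ (Finsupp.single I f) =
      Finsupp.single I (Φ.totalD μ f) + Finsupp.single (I + Finsupp.single μ 1) f := by
  rw [symbolD, LinearMap.add_apply, Finsupp.mapRange.linearMap_apply, Finsupp.mapRange_single,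
    Finsupp.lmapDomain_apply, Finsupp.mapDomain_single]

/-- The commutator of the jet derivatives with a total derivative, in generating form: the unshifted
term is coefficientwise differentiation and the commutator term is multiplication by `p_μ`. -/
theorem jetCoeffs_totalD (z : Φ.Species) (μ : Fin Φ.dim) (f : Φ.Form) :
    Φ.jetCoeffs z (Φ.totalD μ f) = Φ.symbolD μ (Φ.jetCoeffs z f) := by
  refine Finsupp.ext fun I => ?_
  rw [symbolD, LinearMap.add_apply, Finsupp.add_apply, Finsupp.mapRange.linearMap_apply,
    Finsupp.mapRange_apply, Finsupp.lmapDomain_apply, jetCoeffs_apply, jetCoeffs_apply]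
  by_cases hI : ∃ J : Φ.MultiIndex, J + Finsupp.single μ 1 = I
  · obtain ⟨J, rfl⟩ := hI
    rw [Finsupp.mapDomain_apply (add_left_injective _), jetCoeffs_apply]
    exact jetD_shift_totalD (z, J) μ f
  · rw [Finsupp.mapDomain_of_notMem_range _ _ (by rintro ⟨J, hJ⟩; exact hI ⟨J, hJ⟩), add_zero]
    refine jetD_totalD_of_notMem_range _ μ ?_ f
    rintro ⟨⟨w, J⟩, hJ⟩
    exact hI ⟨J, (Prod.ext_iff.1 hJ).2⟩

/-! ### Adjoint evaluation of symbols and integration by parts. -/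

variable (Φ) in
/-- Evaluation of a symbol at `p = -∂`, the derivatives acting last. -/
def adjointSum : Φ.Symbol →ₗ[ℝ] Φ.Form :=
  Finsupp.lsum ℝ fun I : Φ.MultiIndex => (-1 : ℝ) ^ I.degree • Φ.totalDI I

theorem adjointSum_single (I : Φ.MultiIndex) (f : Φ.Form) :
    Φ.adjointSum (Finsupp.single I f) = (-1 : ℝ) ^ I.degree • Φ.totalDI I f := by
  rw [adjointSum, Finsupp.lsum_single, LinearMap.smul_apply]

theorem eulerL_eq (z : Φ.Species) (f : Φ.Form) : Φ.eulerL z f = Φ.adjointSum (Φ.jetCoeffs z f) := by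
  rw [adjointSum, Finsupp.lsum_apply, Finsupp.sum, eulerL]
  refine finsum_eq_sum_of_support_subset _ fun I hI => ?_
  rw [Finset.mem_coe, Finsupp.mem_support_iff]
  intro h
  rw [jetCoeffs_apply] at h
  rw [Function.mem_support, h, LinearMap.map_zero, smul_zero] at hI
  exact hI rfl

@[simp]
-- At `p = -∂` the operator `∂_μ + p_μ` becomes zero: the shifted term carries one more derivative
-- and one more sign.
theorem adjointSum_symbolD (μ : Fin Φ.dim) (G : Φ.Symbol) : Φ.adjointSum (Φ.symbolD μ G) = 0 := by
  induction G using Finsupp.induction_linear with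
  | zero => rw [LinearMap.map_zero, LinearMap.map_zero]
  | add F G hF hG => rw [LinearMap.map_add, LinearMap.map_add, hF, hG, add_zero]
  | single I f =>
    rw [symbolD_single, LinearMap.map_add, adjointSum_single, adjointSum_single,
      totalDI_add_single, totalDI_totalD, map_add, Finsupp.degree_single, pow_succ, mul_neg_one,
      neg_smul, add_neg_cancel]

/-- The Euler-Lagrange derivatives of a total divergence vanish. -/
theorem eulerL_totalD (z : Φ.Species) (μ : Fin Φ.dim) (f : Φ.Form) :
    Φ.eulerL z (Φ.totalD μ f) = 0 := by
  rw [eulerL_eq, jetCoeffs_totalD, adjointSum_symbolD]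

variable (Φ) in
/-- Right multiplication of the coefficients of a symbol. -/
def symbolMul (B : Φ.Form) : Φ.Symbol →ₗ[ℝ] Φ.Symbol :=
  Finsupp.mapRange.linearMap (LinearMap.mulRight ℝ B)

theorem symbolMul_single (B : Φ.Form) (I : Φ.MultiIndex) (f : Φ.Form) :
    Φ.symbolMul B (Finsupp.single I f) = Finsupp.single I (f * B) := by
  rw [symbolMul, Finsupp.mapRange.linearMap_apply, Finsupp.mapRange_single,
    LinearMap.mulRight_apply]

theorem symbolD_symbolMul (μ : Fin Φ.dim) (B : Φ.Form) (G : Φ.Symbol) :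
    Φ.symbolD μ (Φ.symbolMul B G) = Φ.symbolMul B (Φ.symbolD μ G) + Φ.symbolMul (Φ.totalD μ B) G := by
  induction G using Finsupp.induction_linear with
  | zero => simp only [LinearMap.map_zero, add_zero]
  | add F G hF hG => simp only [LinearMap.map_add, hF, hG]; abel
  | single I f =>
    rw [symbolMul_single, symbolD_single, symbolD_single, LinearMap.map_add, symbolMul_single,
      symbolMul_single, symbolMul_single, totalD_mul, Finsupp.single_add]
    abel

/-- The total divergence of a product evaluates to zero, so the derivative can be moved from the
symbol to the factor `B` at the price of a sign. -/
theorem adjointSum_symbolMul_symbolD (μ : Fin Φ.dim) (B : Φ.Form) (G : Φ.Symbol) :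
    Φ.adjointSum (Φ.symbolMul B (Φ.symbolD μ G)) = -Φ.adjointSum (Φ.symbolMul (Φ.totalD μ B) G) := by
  have h := congrArg Φ.adjointSum (symbolD_symbolMul μ B G)
  rw [adjointSum_symbolD, LinearMap.map_add] at h
  exact eq_neg_of_add_eq_zero_left h.symm

/-- Iterated integration by parts. -/
theorem adjointSum_symbolMul_totalDI (z : Φ.Species) (I : Φ.MultiIndex) (f B : Φ.Form) :
    Φ.adjointSum (Φ.symbolMul B (Φ.jetCoeffs z (Φ.totalDI I f))) =
      (-1 : ℝ) ^ I.degree • Φ.adjointSum (Φ.symbolMul (Φ.totalDI I B) (Φ.jetCoeffs z f)) := by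
  induction I using MultiIndex.induction generalizing B with
  | zero => rw [totalDI_zero, totalDI_zero, map_zero, pow_zero, one_smul]
  | add I μ ih =>
    rw [totalDI_add_single, jetCoeffs_totalD, adjointSum_symbolMul_symbolD, ih, totalDI_totalD,
      ← totalDI_add_single, map_add, Finsupp.degree_single, pow_succ, mul_neg_one, neg_smul]

variable (Φ) in
/-- Evaluation of a symbol at momenta that act as total derivatives on a factor on the right. -/
def symbolApply (B : Φ.Form) : Φ.Symbol →ₗ[ℝ] Φ.Form :=
  Finsupp.lsum ℝ fun I : Φ.MultiIndex => LinearMap.mulRight ℝ (Φ.totalDI I B)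

theorem symbolApply_single (B : Φ.Form) (I : Φ.MultiIndex) (f : Φ.Form) :
    Φ.symbolApply B (Finsupp.single I f) = f * Φ.totalDI I B := by
  rw [symbolApply, Finsupp.lsum_single, LinearMap.mulRight_apply]

/-- With the momenta acting on the right factor, `∂_μ + p_μ` is the Leibniz rule. -/
theorem symbolApply_symbolD (μ : Fin Φ.dim) (B : Φ.Form) (G : Φ.Symbol) :
    Φ.symbolApply B (Φ.symbolD μ G) = Φ.totalD μ (Φ.symbolApply B G) := by
  induction G using Finsupp.induction_linear with
  | zero => simp only [LinearMap.map_zero]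
  | add F G hF hG => simp only [LinearMap.map_add, hF, hG]
  | single I f =>
    rw [symbolD_single, LinearMap.map_add, symbolApply_single, symbolApply_single,
      symbolApply_single, totalD_mul, totalDI_add_single]

theorem symbolApply_jetCoeffs_totalDI (w : Φ.Species) (B f : Φ.Form) (K : Φ.MultiIndex) :
    Φ.symbolApply B (Φ.jetCoeffs w (Φ.totalDI K f)) = Φ.totalDI K (Φ.symbolApply B (Φ.jetCoeffs w f)) := by
  induction K using MultiIndex.induction with
  | zero => rw [totalDI_zero, totalDI_zero]
  | add K μ ih =>
    rw [totalDI_add_single, totalDI_add_single, jetCoeffs_totalD, symbolApply_symbolD, ih]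

theorem adjointSum_eq_sum {G : Φ.Symbol} {S : Finset Φ.MultiIndex} (hS : ∀ I, G I ≠ 0 → I ∈ S) :
    Φ.adjointSum G = ∑ I ∈ S, (-1 : ℝ) ^ I.degree • Φ.totalDI I (G I) := by
  rw [adjointSum, Finsupp.lsum_apply]
  refine Finsupp.sum_of_support_subset _ (fun I hI => hS I (Finsupp.mem_support_iff.1 hI)) _
    fun I _ => LinearMap.map_zero _

theorem symbolApply_eq_sum (B : Φ.Form) {G : Φ.Symbol} {S : Finset Φ.MultiIndex}
    (hS : ∀ I, G I ≠ 0 → I ∈ S) : Φ.symbolApply B G = ∑ I ∈ S, G I * Φ.totalDI I B := by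
  rw [symbolApply, Finsupp.lsum_apply]
  refine Finsupp.sum_of_support_subset _ (fun I hI => hS I (Finsupp.mem_support_iff.1 hI)) _
    fun I _ => LinearMap.map_zero _

theorem exists_finset_jetCoeffs (z : Φ.Species) (f : Φ.Form) :
    ∃ S : Finset Φ.MultiIndex, ∀ I, Φ.jetD (z, I) f ≠ 0 → I ∈ S :=
  ⟨(finite_jetCoeffs z f).toFinset, fun _ hI => (finite_jetCoeffs z f).mem_toFinset.2 hI⟩

/-- The second variational derivative is graded symmetric. -/
theorem adjointSum_symbolMul_eulerL (z w : Φ.Species) (f B : Φ.Form) :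
    Φ.adjointSum (Φ.symbolMul B (Φ.jetCoeffs z (Φ.eulerL w f))) =
      sgn₂ (Φ.par z) (Φ.par w) • Φ.symbolApply B (Φ.jetCoeffs w (Φ.eulerL z f)) := by
  obtain ⟨S, hS⟩ := exists_finset_jetCoeffs w f
  obtain ⟨T, hT⟩ := exists_finset_jetCoeffs z f
  -- Both sides expand into the same double sum over `K` and `I`, apart from the order of the two
  -- jet derivatives. In this one the sign `(-1) ^ |I|` of the Euler operator cancels against the
  -- one from integrating `∂_I` by parts.
  have hl : Φ.adjointSum (Φ.symbolMul B (Φ.jetCoeffs z (Φ.eulerL w f))) =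
      ∑ I ∈ S, ∑ K ∈ T, (-1 : ℝ) ^ K.degree •
        Φ.totalDI K (Φ.jetD (z, K) (Φ.jetD (w, I) f) * Φ.totalDI I B) := by
    rw [eulerL_eq, adjointSum_eq_sum (G := Φ.jetCoeffs w f) hS, map_sum, map_sum, map_sum]
    refine Finset.sum_congr rfl fun I _ => ?_
    rw [LinearMap.map_smul, LinearMap.map_smul, LinearMap.map_smul, adjointSum_symbolMul_totalDI,
      smul_smul, ← mul_pow, neg_one_mul, neg_neg, one_pow, one_smul, jetCoeffs_apply]
    refine adjointSum_eq_sum fun K hK => ?_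
    by_contra h
    refine hK ?_
    change Φ.jetD (z, K) (Φ.jetD (w, I) f) * Φ.totalDI I B = 0
    rw [jetD_jetD, not_not.1 (mt (hT K) h), LinearMap.map_zero, smul_zero, zero_mul]
  have hr : Φ.symbolApply B (Φ.jetCoeffs w (Φ.eulerL z f)) =
      ∑ K ∈ T, ∑ I ∈ S, (-1 : ℝ) ^ K.degree •
        Φ.totalDI K (Φ.jetD (w, I) (Φ.jetD (z, K) f) * Φ.totalDI I B) := by
    rw [eulerL_eq, adjointSum_eq_sum (G := Φ.jetCoeffs z f) hT, map_sum, map_sum]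
    refine Finset.sum_congr rfl fun K _ => ?_
    rw [LinearMap.map_smul, LinearMap.map_smul, symbolApply_jetCoeffs_totalDI, jetCoeffs_apply,
      symbolApply_eq_sum (S := S), map_sum, Finset.smul_sum]
    · rfl
    · intro I hI
      by_contra h
      refine hI ?_
      rw [jetCoeffs_apply, jetD_jetD, not_not.1 (mt (hS I) h), LinearMap.map_zero, smul_zero]
  rw [hl, hr, Finset.sum_comm, Finset.smul_sum]
  refine Finset.sum_congr rfl fun K _ => ?_
  rw [Finset.smul_sum]
  refine Finset.sum_congr rfl fun I _ => ?_
  rw [jetD_jetD, smul_mul_assoc, LinearMap.map_smul, smul_comm]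

/-! ### Composition of vector fields -/

theorem exists_finset_jetD_family (f : Φ.Form) {ι : Type*} (S : Finset ι) (Q : ι → Φ.Form) :
    ∃ T : Finset Φ.JetVar, (∀ v, Φ.jetD v f ≠ 0 → v ∈ T) ∧
      ∀ u ∈ S, ∀ v, Φ.jetD v (Q u) ≠ 0 → v ∈ T := by
  classical
  refine ⟨(Φ.finite_jetD f).toFinset ∪ S.biUnion fun u => (Φ.finite_jetD (Q u)).toFinset,
    fun v hv => Finset.mem_union_left _ ((Φ.finite_jetD f).mem_toFinset.2 hv),
    fun u hu v hv => Finset.mem_union_right _ (Finset.mem_biUnion.2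
      ⟨u, hu, (Φ.finite_jetD (Q u)).mem_toFinset.2 hv⟩)⟩

/-- A composition of two fields has a first order part, where the outer field differentiates the
components, and a second order part. This lemma and `vectorField_vectorField_right` write the second
order parts of the two orders of composition in the same shape, so that they can be cancelled in a
graded commutator. -/
theorem vectorField_vectorField_left {e : ZMod 2} {Q : Φ.JetVar → Φ.Form}
    (hQ : IsHomogeneous e Q) (R : Φ.JetVar → Φ.Form) {f : Φ.Form} {S : Finset Φ.JetVar}
    (hS : ∀ v, Φ.jetD v f ≠ 0 → v ∈ S) :
    Φ.vectorField R (Φ.vectorField Q f) = Φ.vectorField (fun u => Φ.vectorField R (Q u)) f +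
      ∑ v ∈ S, sgn₂ (Φ.par v.1) e • (R v * Φ.vectorField Q (Φ.jetD v f)) := by
  classical
  obtain ⟨T, hT, hT'⟩ := exists_finset_jetD_family (Φ.vectorField Q f) S Q
  have hTS : ∀ v, Φ.jetD v (Φ.vectorField Q f) ≠ 0 → v ∈ T ∪ S :=
    fun v hv => Finset.mem_union_left _ (hT v hv)
  have h1 : ∑ v ∈ S, sgn₂ (Φ.par v.1) e • (R v * Φ.vectorField Q (Φ.jetD v f)) =
      ∑ v ∈ T ∪ S, sgn₂ (Φ.par v.1) e • (R v * Φ.vectorField Q (Φ.jetD v f)) :=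
    Finset.sum_subset Finset.subset_union_right fun v _ hv => by
      rw [not_not.1 (mt (hS v) hv), LinearMap.map_zero, mul_zero, smul_zero]
  have h2 : Φ.vectorField (fun u => Φ.vectorField R (Q u)) f =
      ∑ v ∈ T ∪ S, R v * Φ.vectorField (fun u => Φ.jetD v (Q u)) f := by
    rw [vectorField_eq_sum _ hS]
    have : ∀ u ∈ S, Φ.vectorField R (Q u) * Φ.jetD u f =
        ∑ v ∈ T ∪ S, R v * (Φ.jetD v (Q u) * Φ.jetD u f) := fun u hu => by
      rw [vectorField_eq_sum R fun v hv => Finset.mem_union_left S (hT' u hu v hv), Finset.sum_mul]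
      simp only [mul_assoc]
    rw [Finset.sum_congr rfl this, Finset.sum_comm]
    refine Finset.sum_congr rfl fun v _ => ?_
    rw [vectorField_eq_sum _ hS, Finset.mul_sum]
  rw [vectorField_eq_sum R hTS, h1, h2, ← Finset.sum_add_distrib]
  refine Finset.sum_congr rfl fun v _ => ?_
  rw [jetD_vectorField hQ, mul_add, mul_smul_comm]

theorem vectorField_vectorField_right {e : ZMod 2} {Q : Φ.JetVar → Φ.Form}
    (hQ : IsHomogeneous e Q) (R : Φ.JetVar → Φ.Form) {f : Φ.Form} {S : Finset Φ.JetVar}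
    (hS : ∀ v, Φ.jetD v f ≠ 0 → v ∈ S) :
    Φ.vectorField Q (Φ.vectorField R f) = Φ.vectorField (fun u => Φ.vectorField Q (R u)) f +
      ∑ v ∈ S, Φ.twist e (R v) * Φ.vectorField Q (Φ.jetD v f) := by
  rw [vectorField_eq_sum R hS, vectorField_eq_sum _ hS, map_sum, ← Finset.sum_add_distrib]
  refine Finset.sum_congr rfl fun v _ => ?_
  rw [vectorField_mul hQ]

/-! ### Euler-Lagrange derivatives of an evolutionary variation -/

theorem symbolMul_apply (B : Φ.Form) (G : Φ.Symbol) (I : Φ.MultiIndex) :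
    Φ.symbolMul B G I = G I * B := rfl

theorem adjointSum_mapRange {X : Φ.Form →ₗ[ℝ] Φ.Form}
    (hX : ∀ μ f, X (Φ.totalD μ f) = Φ.totalD μ (X f)) (G : Φ.Symbol) :
    Φ.adjointSum (Finsupp.mapRange.linearMap X G) = X (Φ.adjointSum G) := by
  induction G using Finsupp.induction_linear with
  | zero => simp only [LinearMap.map_zero]
  | add F G hF hG => simp only [LinearMap.map_add, hF, hG]
  | single I f =>
    rw [Finsupp.mapRange.linearMap_apply, Finsupp.mapRange_single, adjointSum_single,
      adjointSum_single, LinearMap.map_smul, totalDI_comm_of_totalD hX]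

theorem exists_finset_product (f : Φ.Form) : ∃ T : Finset Φ.MultiIndex,
    ∀ v, Φ.jetD v f ≠ 0 → v ∈ (Finset.univ : Finset Φ.Species) ×ˢ T := by
  classical
  refine ⟨(Φ.finite_jetD f).toFinset.image Prod.snd, fun v hv => Finset.mem_product.2
    ⟨Finset.mem_univ _, Finset.mem_image_of_mem _ ((Φ.finite_jetD f).mem_toFinset.2 hv)⟩⟩

theorem eulerL_eq_sum (z : Φ.Species) {f : Φ.Form} {T : Finset Φ.MultiIndex}
    (hT : ∀ v, Φ.jetD v f ≠ 0 → v ∈ (Finset.univ : Finset Φ.Species) ×ˢ T) :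
    Φ.eulerL z f = ∑ I ∈ T, (-1 : ℝ) ^ I.degree • Φ.totalDI I (Φ.jetD (z, I) f) := by
  rw [eulerL_eq, adjointSum_eq_sum (G := Φ.jetCoeffs z f)
    fun I hI => (Finset.mem_product.1 (hT (z, I) hI)).2]
  rfl

theorem symbolMul_sum {ι : Type*} (S : Finset ι) (c : ι → ℝ) (B : ι → Φ.Form) (G : Φ.Symbol) :
    Φ.symbolMul (∑ i ∈ S, c i • B i) G = ∑ i ∈ S, c i • Φ.symbolMul (B i) G := by
  refine Finsupp.ext fun I => ?_
  rw [symbolMul_apply, Finset.mul_sum, Finsupp.finsetSum_apply]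
  refine Finset.sum_congr rfl fun i _ => ?_
  rw [mul_smul_comm]
  rfl

/-- Where the jet derivative passes the field, the adjoint sum passes it too, since an evolutionary
field commutes with total derivatives. Where it hits the component `∂_I q_w`, integration by parts
moves `∂_I` onto `∂f/∂(∂_I w)`, and the sum over `I` rebuilds the variational derivative of `f` with
respect to `w`. -/
theorem eulerL_vectorField_prolong {e : ZMod 2} {q : Φ.Species → Φ.Form}
    (hq : IsHomogeneous e (Φ.prolong q)) (z : Φ.Species) (f : Φ.Form) :
    Φ.eulerL z (Φ.vectorField (Φ.prolong q) f) =
      sgn₂ (Φ.par z) e • Φ.vectorField (Φ.prolong q) (Φ.eulerL z f) +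
        ∑ w, Φ.adjointSum (Φ.symbolMul (Φ.eulerL w f) (Φ.jetCoeffs z (q w))) := by
  obtain ⟨T, hT⟩ := exists_finset_product f
  have h : Φ.jetCoeffs z (Φ.vectorField (Φ.prolong q) f) =
      sgn₂ (Φ.par z) e • Finsupp.mapRange.linearMap (Φ.vectorField (Φ.prolong q))
          (Φ.jetCoeffs z f) +
        ∑ v ∈ (Finset.univ : Finset Φ.Species) ×ˢ T,
          Φ.symbolMul (Φ.jetD v f) (Φ.jetCoeffs z (Φ.totalDI v.2 (q v.1))) := by
    refine Finsupp.ext fun I => ?_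
    rw [jetCoeffs_apply, jetD_vectorField hq, vectorField_eq_sum _ hT, Finsupp.add_apply,
      Finsupp.finsetSum_apply, add_comm]
    rfl
  rw [eulerL_eq, h, LinearMap.map_add, LinearMap.map_smul,
    adjointSum_mapRange fun μ f => (totalD_vectorField_prolong q μ f).symm, ← eulerL_eq, map_sum,
    Finset.sum_product]
  congr 1
  refine Finset.sum_congr rfl fun w _ => ?_
  rw [eulerL_eq_sum w hT, symbolMul_sum, map_sum]
  refine Finset.sum_congr rfl fun I _ => ?_
  rw [adjointSum_symbolMul_totalDI, LinearMap.map_smul]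

/-! ### The Hamiltonian vector field of a density -/

variable (Φ) in
/-- The sign of a field or antifield in the antibracket. -/
def orient : Φ.Species → ℝ
  | Sum.inl _ => -1
  | Sum.inr _ => 1

theorem orient_swap (z : Φ.Species) : Φ.orient z.swap = -Φ.orient z := by
  rcases z with A | A <;> simp [orient]

theorem par_swap (z : Φ.Species) : Φ.par z.swap = Φ.par z + 1 := by
  rcases z with A | A
  · rfl
  · change Φ.parity A = Φ.parity A + 1 + 1
    rw [add_assoc, show (1 + 1 : ZMod 2) = 0 from rfl, add_zero]

theorem ghost_swap (z : Φ.Species) : Φ.ghost z.swap = -Φ.ghost z - 1 := by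
  rcases z with A | A
  · rfl
  · change Φ.gh A = -(-Φ.gh A - 1) - 1
    ring

theorem jetDR_eq (v : Φ.JetVar) (f : Φ.Form) :
    Φ.jetDR v f = Φ.twist (Φ.par v.1) (Φ.jetD v f) := by
  by_cases h : Φ.par v.1 = 0
  · rw [jetDR, if_pos h, h, twist_zero]
  · rw [jetDR, if_neg h, par_eq_one h, twist_one]; rfl

theorem eulerR_eq (z : Φ.Species) (f : Φ.Form) :
    Φ.eulerR z f = Φ.twist (Φ.par z) (Φ.eulerL z f) := by
  obtain ⟨T, hT⟩ := exists_finset_product f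
  rw [eulerL_eq_sum z hT, map_sum, eulerR]
  simp only [jetDR_eq]
  rw [finsum_eq_sum_of_support_subset (s := T)]
  · refine Finset.sum_congr rfl fun I _ => ?_
    rw [LinearMap.map_smul, twist_totalDI]
  · intro I hI
    by_contra h
    refine hI ?_
    have : Φ.jetD (z, I) f = 0 := by
      by_contra h'
      exact h (Finset.mem_product.1 (hT (z, I) h')).2
    simp only [this, LinearMap.map_zero, smul_zero]

/-- Fields and antifields enter symmetrically up to `orient`, so later arguments run over all
species at once, with `Sum.swap` as the pairing. -/
theorem brstGen_eq (f : Φ.Form) (z : Φ.Species) :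
    Φ.brstGen f z =
      Φ.orient z • Φ.twist (Φ.par z.swap) (Φ.eulerL z.swap f) := by
  rw [← eulerR_eq]
  rcases z with A | A
  · rw [orient, neg_one_smul]; rfl
  · rw [orient, one_smul]; rfl

theorem HasParity.sum {ι : Type*} {e : ZMod 2} {f : ι → Φ.Form} {S : Finset ι}
    (h : ∀ i ∈ S, Φ.HasParity e (f i)) : Φ.HasParity e (∑ i ∈ S, f i) := by
  rw [HasParity, map_sum, Finset.smul_sum]
  exact Finset.sum_congr rfl h

theorem HasParity.smul {e : ZMod 2} {f : Φ.Form} (h : Φ.HasParity e f) (r : ℝ) :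
    Φ.HasParity e (r • f) := by
  rw [HasParity, LinearMap.map_smul, h, smul_comm]

theorem HasParity.of_eq {e e' : ZMod 2} {f : Φ.Form} (h : Φ.HasParity e f) (he : e = e') :
    Φ.HasParity e' f := he ▸ h

theorem HasParity.eulerL {e : ZMod 2} {f : Φ.Form} (h : Φ.HasParity e f) (z : Φ.Species) :
    Φ.HasParity (e + Φ.par z) (Φ.eulerL z f) := by
  obtain ⟨T, hT⟩ := exists_finset_product f
  rw [eulerL_eq_sum z hT]
  exact HasParity.sum fun I _ => ((h.jetD (z, I)).totalDI I).smul _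

theorem sgn₂_self (e : ZMod 2) : sgn₂ e e = sgn e := by
  rcases ZMod.eq_zero_or_one e with rfl | rfl <;> simp

theorem sgn₂_one (e : ZMod 2) : sgn₂ e 1 = sgn e := by
  rcases ZMod.eq_zero_or_one e with rfl | rfl <;> simp

theorem HasParity.brstGen_eq {L : Φ.Form} (hL : Φ.HasParity 0 L) (z : Φ.Species) :
    Φ.brstGen L z =
      (Φ.orient z * sgn (Φ.par z.swap)) • Φ.eulerL z.swap L := by
  rw [FieldContent.brstGen_eq, ((hL.eulerL z.swap).of_eq (zero_add _)).twist, sgn₂_self, smul_smul]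

/-- The Lagrangian is even, and conjugate variables have opposite parities; this makes `s` odd. -/
theorem HasParity.isHomogeneous_brstGen {L : Φ.Form} (hL : Φ.HasParity 0 L) :
    IsHomogeneous 1 (Φ.prolong (Φ.brstGen L)) := by
  refine isHomogeneous_prolong fun z => ?_
  rw [hL.brstGen_eq]
  refine ((hL.eulerL z.swap).smul _).of_eq ?_
  rw [zero_add, par_swap, add_comm]

theorem totalD_s (a : Φ.Form) (μ : Fin Φ.dim) (f : Φ.Form) :
    Φ.s a (Φ.totalD μ f) = Φ.totalD μ (Φ.s a f) :=
  (totalD_vectorField_prolong _ μ f).symm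

theorem HasParity.twist_s {L : Φ.Form} (hL : Φ.HasParity 0 L) (e : ZMod 2) (f : Φ.Form) :
    Φ.twist e (Φ.s L f) = sgn e • Φ.s L (Φ.twist e f) := by
  rcases ZMod.eq_zero_or_one e with rfl | rfl
  · rw [twist_zero, twist_zero, sgn_zero, one_smul]
  · have h := parityConj_vectorField_of_isHomogeneous hL.isHomogeneous_brstGen
    replace h := LinearMap.congr_fun h (Φ.parityInvolution f)
    rw [parityConj_apply, parityInvolution_parityInvolution] at h
    rw [twist_one, twist_one]
    exact h

/-- The Hamiltonian vector field of `a` applied to a variational derivative of `L`. -/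
theorem HasParity.twist_s_eulerL {L : Φ.Form} (hL : Φ.HasParity 0 L) (a : Φ.Form)
    (z : Φ.Species) :
    Φ.twist (Φ.par z + 1) (Φ.s a (Φ.eulerL z L)) =
      ∑ w : Φ.Species, (Φ.orient w * (sgn (Φ.par w) * sgn₂ (Φ.par z) (Φ.par w))) •
        Φ.symbolApply (Φ.eulerL w.swap a) (Φ.jetCoeffs w (Φ.eulerL z L)) := by
  obtain ⟨T, hT⟩ := exists_finset_product (Φ.eulerL z L)
  rw [s_eq, vectorField_eq_sum _ hT, map_sum, Finset.sum_product]
  refine Finset.sum_congr rfl fun w _ => ?_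
  rw [symbolApply_eq_sum (S := T) _ fun I hI => (Finset.mem_product.1 (hT (w, I) hI)).2,
    Finset.smul_sum]
  refine Finset.sum_congr rfl fun I _ => ?_
  have hp : Φ.HasParity (Φ.par z + Φ.par w) (Φ.jetD (w, I) (Φ.eulerL z L)) :=
    ((hL.eulerL z).of_eq (zero_add _)).jetD (w, I)
  rw [prolong, FieldContent.brstGen_eq, LinearMap.map_smul, smul_mul_assoc, LinearMap.map_smul,
    hp.mul_comm, twist_mul, hp.twist, ← twist_totalDI, ← twist_add, ← twist_add, smul_mul_assoc,
    smul_smul, par_swap, jetCoeffs_apply]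
  -- The exponents of the outer twist, of the exchange of the two factors and of the right
  -- derivative of `a` add up to zero; only the sign in `h2` is left.
  have h1 : Φ.par z + 1 + (Φ.par z + Φ.par w) + (Φ.par w + 1) = 0 := by
    generalize Φ.par z = x; generalize Φ.par w = y; revert x y; decide
  have h2 : sgn₂ (Φ.par z + Φ.par w) (Φ.par z + 1) = sgn (Φ.par w) * sgn₂ (Φ.par z) (Φ.par w) := by
    rcases ZMod.eq_zero_or_one (Φ.par z) with h | h <;>
      rcases ZMod.eq_zero_or_one (Φ.par w) with h' | h' <;>
      simp [h, h', show (1 + 1 : ZMod 2) = 0 from rfl]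
  dsimp only
  rw [h1, h2, twist_zero]

/-- If the variational derivatives of `(S, a)` vanish, then those of `a` and of `S` are related. -/
theorem HasParity.s_eulerL {L : Φ.Form} (hL : Φ.HasParity 0 L) {a : Φ.Form}
    (ha : ∀ z, Φ.eulerL z (Φ.s L a) = 0) (z : Φ.Species) :
    sgn (Φ.par z) • Φ.s L (Φ.eulerL z a) =
      Φ.twist (Φ.par z + 1) (Φ.s a (Φ.eulerL z L)) := by
  have h := eulerL_vectorField_prolong hL.isHomogeneous_brstGen z a
  rw [← s_eq, ha, sgn₂_one] at h
  -- The characteristic of `s` at `w` is a variational derivative at the conjugate species. The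
  -- second variation is therefore symmetrised between `z` and `w.swap`, and the sums match after
  -- reindexing by the swap.
  rw [eq_neg_of_add_eq_zero_left h.symm, hL.twist_s_eulerL, ← Finset.sum_neg_distrib,
    ← Equiv.sum_comp (Equiv.sumComm Φ.Field Φ.Field)]
  refine Finset.sum_congr rfl fun w _ => ?_
  rw [Equiv.sumComm_apply, hL.brstGen_eq, Sum.swap_swap, LinearMap.map_smul, LinearMap.map_smul,
    LinearMap.map_smul, adjointSum_symbolMul_eulerL, smul_smul, orient_swap, ← neg_smul]
  congr 1
  ring

/-- The graded commutator of the BRST differential with the Hamiltonian vector field of a density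
`a` vanishes if `(S, a)` is a total divergence. -/
theorem HasParity.s_s {L : Φ.Form} (hL : Φ.HasParity 0 L) {a : Φ.Form}
    (ha : ∀ z, Φ.eulerL z (Φ.s L a) = 0) (f : Φ.Form) :
    Φ.s L (Φ.s a f) = parityConj (Φ.s a) (Φ.s L f) := by
  obtain ⟨S, hS⟩ := exists_finset_jetD f
  -- On an undifferentiated variable this is `HasParity.s_eulerL` at the conjugate species; the
  -- commutation of both operators with total derivatives extends it to all jet coordinates in
  -- `hprol`.
  have hgen : ∀ w, Φ.s L (Φ.brstGen a w) = parityConj (Φ.s a) (Φ.brstGen L w) := fun w => by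
    have h := congrArg (Φ.twist (Φ.par w.swap)) (hL.s_eulerL ha w.swap)
    have hp := (hL.eulerL w.swap).of_eq (zero_add _)
    rw [← twist_add, ← add_assoc, show Φ.par w.swap + Φ.par w.swap + 1 = 1 by
      generalize Φ.par w.swap = x; revert x; decide, twist_one, LinearMap.map_smul,
      hL.twist_s, smul_smul, sgn_mul_self, one_smul] at h
    rw [FieldContent.brstGen_eq, LinearMap.map_smul, h, hL.brstGen_eq, LinearMap.map_smul,
      parityConj_apply, hp, LinearMap.map_smul, LinearMap.map_smul, smul_smul, mul_assoc,
      sgn_mul_self, mul_one]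
  have hconj : ∀ μ f, parityConj (Φ.s a) (Φ.totalD μ f) = Φ.totalD μ (parityConj (Φ.s a) f) := by
    intro μ f
    rw [parityConj_apply, parityInvolution_totalD, totalD_s, parityInvolution_totalD]
    rfl
  have hprol : ∀ v, Φ.s L (Φ.prolong (Φ.brstGen a) v) =
      parityConj (Φ.s a) (Φ.prolong (Φ.brstGen L) v) := fun v => by
    rw [prolong, prolong, totalDI_comm_of_totalD (totalD_s L), totalDI_comm_of_totalD hconj, hgen]
  -- The first order parts agree by `hprol`, and the second order parts coincide once the sign of
  -- the conjugated components is absorbed.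
  have hr := vectorField_vectorField_right hL.isHomogeneous_brstGen (Φ.prolong (Φ.brstGen a)) hS
  have hl := vectorField_vectorField_left hL.isHomogeneous_brstGen
    (fun v => sgn (Φ.par v.1) • Φ.parityInvolution (Φ.prolong (Φ.brstGen a) v)) hS
  rw [← parityConj_vectorField] at hl
  simp only [← s_eq, hprol, twist_one] at hl hr
  rw [hl, hr]
  congr 1
  refine Finset.sum_congr rfl fun v _ => ?_
  rw [smul_mul_assoc, smul_smul, sgn₂_one, sgn_mul_self, one_smul]

/-! ### Commuting idempotents -/

section Idempotents

variable {M ι : Type*} [AddCommGroup M] [Module ℝ M] {E : ι → M →ₗ[ℝ] M}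

/-- A sum of commuting idempotents has no negative eigenvalue. -/
theorem eq_zero_of_sum_idempotent_eq_smul (hE : ∀ i x, E i (E i x) = E i x)
    (hc : ∀ i j x, E i (E j x) = E j (E i x)) (S : Finset ι) {c : ℝ} (h0 : c < 0) {x : M}
    (h : ∑ i ∈ S, E i x = c • x) : x = 0 := by
  classical
  induction S using Finset.induction_on generalizing c x with
  | empty =>
    rw [Finset.sum_empty] at h
    exact (smul_eq_zero.1 h.symm).resolve_left h0.ne
  | insert j S hj ih =>
    rw [Finset.sum_insert hj] at h
    -- Applying `E j` shows that `E j x` is an eigenvector of the remaining sum with eigenvalue `c -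
    -- 1`, which is still negative. By induction it vanishes, and `x` is then an eigenvector of the
    -- smaller sum.
    have h1 := congrArg (E j) h
    rw [map_add, map_sum, hE, map_smul, Finset.sum_congr rfl fun i _ => hc j i x] at h1
    have h2 : E j x = 0 := ih (c := c - 1) (by linarith) (by
      rw [sub_smul, one_smul, ← h1, add_sub_cancel_left])
    rw [h2, zero_add] at h
    exact ih h0 h

/-- Isolating one idempotent makes `E j x` an eigenvector of the others with eigenvalue `-1`. This
is how the eigenvalue definition of form degree is turned into statements about each single `dx^μ`.
-/
theorem idempotent_eq_zero_of_sum_eq_zero (hE : ∀ i x, E i (E i x) = E i x)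
    (hc : ∀ i j x, E i (E j x) = E j (E i x)) (S : Finset ι) {x : M}
    (h : ∑ i ∈ S, E i x = 0) {j : ι} (hj : j ∈ S) : E j x = 0 := by
  classical
  rw [← Finset.insert_erase hj, Finset.sum_insert (Finset.notMem_erase j S)] at h
  have h1 := congrArg (E j) h
  rw [map_add, map_sum, hE, map_zero, Finset.sum_congr rfl fun i _ => hc j i x] at h1
  refine eq_zero_of_sum_idempotent_eq_smul hE hc (S.erase j) (c := -1) (by norm_num) ?_
  rw [neg_one_smul]
  exact eq_neg_of_add_eq_zero_right h1

end Idempotents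

/-! ### Form degree -/

variable (Φ) in
/-- `f` has form degree `k`. -/
def HasDegree (k : ℝ) (f : Φ.Form) : Prop := Φ.formOp f = k • f

theorem mem_Forms {g k : ℤ} {f : Φ.Form} :
    f ∈ Φ.Forms g k ↔ Φ.HasGhost g f ∧ Φ.HasDegree k f := by
  rw [Forms, Submodule.mem_inf, LinearMap.mem_ker, LinearMap.mem_ker, LinearMap.sub_apply,
    LinearMap.sub_apply, sub_eq_zero, sub_eq_zero]
  rfl

theorem formOp_apply (f : Φ.Form) :
    Φ.formOp f = ∑ μ, Φ.dx μ * Φ.oddD (Sum.inl μ) f := by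
  rw [formOp, LinearMap.sum_apply]
  rfl

theorem d_apply (f : Φ.Form) : Φ.d f = ∑ μ, Φ.dx μ * Φ.totalD μ f := by
  rw [d, LinearMap.sum_apply]
  rfl

theorem mul_dx (μ : Fin Φ.dim) (f : Φ.Form) : f * Φ.dx μ = Φ.dx μ * Φ.parityInvolution f := by
  rw [(hasParity_dx μ).mul_comm, twist_one]

theorem parityInvolution_dx_mul (μ : Fin Φ.dim) (f : Φ.Form) :
    Φ.parityInvolution (Φ.dx μ * f) = -(Φ.dx μ * Φ.parityInvolution f) := by
  rw [parityInvolution_mul, hasParity_dx μ, sgn_one, neg_one_smul, neg_mul]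

theorem dx_mul_dx (μ : Fin Φ.dim) : Φ.dx μ * Φ.dx μ = 0 := by
  have h := mul_dx μ (Φ.dx μ)
  rw [hasParity_dx μ, sgn_one, neg_one_smul, mul_neg] at h
  have h2 : (2 : ℝ) • (Φ.dx μ * Φ.dx μ) = 0 := by
    rw [two_smul]
    exact add_eq_zero_iff_eq_neg.2 h
  rw [← one_smul ℝ (Φ.dx μ * Φ.dx μ), show (1 : ℝ) = 1 / 2 * 2 by norm_num, mul_smul, h2,
    smul_zero]

theorem oddD_dx_mul_self (μ : Fin Φ.dim) (f : Φ.Form) :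
    Φ.oddD (Sum.inl μ) (Φ.dx μ * f) = f - Φ.dx μ * Φ.oddD (Sum.inl μ) f := by
  rw [oddD_mul, oddD_inl_dx, if_pos rfl, one_mul, hasParity_dx μ, sgn_one, neg_one_smul, neg_mul,
    sub_eq_add_neg]

theorem oddD_dx_mul_of_ne {μ ν : Fin Φ.dim} (h : μ ≠ ν) (f : Φ.Form) :
    Φ.oddD (Sum.inl μ) (Φ.dx ν * f) = -(Φ.dx ν * Φ.oddD (Sum.inl μ) f) := by
  rw [oddD_mul, oddD_inl_dx, if_neg h, zero_mul, zero_add, hasParity_dx ν, sgn_one, neg_one_smul,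
    neg_mul]

theorem dx_mul_dx_mul (μ ν : Fin Φ.dim) (f : Φ.Form) :
    Φ.dx μ * (Φ.dx ν * f) = -(Φ.dx ν * (Φ.dx μ * f)) := by
  rw [← mul_assoc, mul_dx, hasParity_dx μ, sgn_one, neg_one_smul, mul_neg, neg_mul, mul_assoc]

/-! ### The form degree as a sum of commuting projections. -/

variable (Φ) in
/-- The projection `dx^μ ∂/∂(dx^μ)` onto the forms that contain `dx^μ`. -/
def dxProj (μ : Fin Φ.dim) : Φ.Form →ₗ[ℝ] Φ.Form :=
  LinearMap.mulLeft ℝ (Φ.dx μ) ∘ₗ Φ.oddD (Sum.inl μ)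

theorem dxProj_apply (μ : Fin Φ.dim) (f : Φ.Form) :
    Φ.dxProj μ f = Φ.dx μ * Φ.oddD (Sum.inl μ) f := rfl

theorem oddD_dxProj (μ : Fin Φ.dim) (f : Φ.Form) :
    Φ.oddD (Sum.inl μ) (Φ.dxProj μ f) = Φ.oddD (Sum.inl μ) f := by
  rw [dxProj_apply, oddD_dx_mul_self, oddD_self, mul_zero, sub_zero]

theorem oddD_dxProj_of_ne {μ ν : Fin Φ.dim} (h : μ ≠ ν) (f : Φ.Form) :
    Φ.oddD (Sum.inl μ) (Φ.dxProj ν f) = Φ.dxProj ν (Φ.oddD (Sum.inl μ) f) := by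
  rw [dxProj_apply, oddD_dx_mul_of_ne h, oddD_oddD, mul_neg, neg_neg, dxProj_apply]

theorem dxProj_dxProj (μ : Fin Φ.dim) (f : Φ.Form) : Φ.dxProj μ (Φ.dxProj μ f) = Φ.dxProj μ f := by
  rw [dxProj_apply, oddD_dxProj, ← dxProj_apply]

theorem dxProj_comm (μ ν : Fin Φ.dim) (f : Φ.Form) :
    Φ.dxProj μ (Φ.dxProj ν f) = Φ.dxProj ν (Φ.dxProj μ f) := by
  by_cases h : μ = ν
  · rw [h]
  · rw [dxProj_apply μ, oddD_dxProj_of_ne h, dxProj_apply ν (Φ.dxProj μ f),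
      oddD_dxProj_of_ne (Ne.symm h), dxProj_apply, dxProj_apply, dx_mul_dx_mul, oddD_oddD, mul_neg,
      mul_neg, neg_neg]

theorem formOp_eq_sum (f : Φ.Form) : Φ.formOp f = ∑ μ, Φ.dxProj μ f := formOp_apply f

variable (Φ) in
/-- `f` does not contain any `dx^μ`. -/
def IsDxFree (f : Φ.Form) : Prop := ∀ μ, Φ.oddD (Sum.inl μ) f = 0

theorem HasDegree.isDxFree {f : Φ.Form} (h : Φ.HasDegree 0 f) : Φ.IsDxFree f := fun μ => by
  rw [HasDegree, formOp_eq_sum, zero_smul] at h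
  have h' := idempotent_eq_zero_of_sum_eq_zero dxProj_dxProj dxProj_comm Finset.univ h
    (Finset.mem_univ μ)
  rw [← oddD_dxProj, h', LinearMap.map_zero]

/-- A form of top degree contains every `dx^μ`. -/
theorem HasDegree.dxProj_eq {f : Φ.Form} (h : Φ.HasDegree Φ.dim f) (μ : Fin Φ.dim) :
    Φ.dxProj μ f = f := by
  -- The complementary projections sum to the dimension minus the form degree, which is zero on `f`.
  have hs : ∑ μ, (LinearMap.id - Φ.dxProj μ : Φ.Form →ₗ[ℝ] Φ.Form) f = 0 := by
    rw [HasDegree, formOp_eq_sum] at h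
    simp only [LinearMap.sub_apply, LinearMap.id_apply]
    rw [Finset.sum_sub_distrib, h, Finset.sum_const, Finset.card_univ, Fintype.card_fin,
      Nat.cast_smul_eq_nsmul, sub_self]
  have h' := idempotent_eq_zero_of_sum_eq_zero (E := fun μ => LinearMap.id - Φ.dxProj μ)
    (fun μ x => by
      simp only [LinearMap.sub_apply, LinearMap.id_apply, LinearMap.map_sub, dxProj_dxProj,
        sub_self, sub_zero])
    (fun μ ν x => by
      simp only [LinearMap.sub_apply, LinearMap.id_apply, LinearMap.map_sub, dxProj_comm μ ν]
      abel) Finset.univ hs (Finset.mem_univ μ)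
  exact (sub_eq_zero.1 h').symm

theorem formOp_mul (f g : Φ.Form) : Φ.formOp (f * g) = Φ.formOp f * g + f * Φ.formOp g := by
  rw [formOp_apply, formOp_apply, formOp_apply, Finset.sum_mul, Finset.mul_sum,
    ← Finset.sum_add_distrib]
  refine Finset.sum_congr rfl fun μ _ => ?_
  rw [oddD_mul, mul_add, mul_assoc, ← mul_assoc f, mul_dx, mul_assoc (Φ.dx μ) (Φ.parityInvolution f)]

theorem HasDegree.mul {k k' : ℝ} {f f' : Φ.Form} (h : Φ.HasDegree k f) (h' : Φ.HasDegree k' f') :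
    Φ.HasDegree (k + k') (f * f') := by
  rw [HasDegree, formOp_mul, h, h', smul_mul_assoc, mul_smul_comm, add_smul]

theorem HasDegree.of_eq {k k' : ℝ} {f : Φ.Form} (h : Φ.HasDegree k f) (e : k = k') :
    Φ.HasDegree k' f := e ▸ h

theorem IsDxFree.hasDegree {f : Φ.Form} (h : Φ.IsDxFree f) : Φ.HasDegree 0 f := by
  rw [HasDegree, formOp_apply, zero_smul]
  exact Finset.sum_eq_zero fun μ _ => by rw [h μ, mul_zero]

theorem hasDegree_dx (μ : Fin Φ.dim) : Φ.HasDegree 1 (Φ.dx μ) := by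
  rw [HasDegree, formOp_apply, one_smul, Finset.sum_eq_single μ]
  · rw [oddD_inl_dx, if_pos rfl, mul_one]
  · intro ν _ h
    rw [oddD_inl_dx, if_neg h, mul_zero]
  · intro h; exact absurd (Finset.mem_univ μ) h

theorem formOp_totalD (μ : Fin Φ.dim) (f : Φ.Form) :
    Φ.formOp (Φ.totalD μ f) = Φ.totalD μ (Φ.formOp f) := by
  rw [formOp_apply, formOp_apply, map_sum]
  refine Finset.sum_congr rfl fun ν _ => ?_
  rw [totalD_mul, totalD_dx, zero_mul, zero_add, oddD_inl_totalD]

theorem HasDegree.totalD {k : ℝ} {f : Φ.Form} (h : Φ.HasDegree k f) (μ : Fin Φ.dim) :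
    Φ.HasDegree k (Φ.totalD μ f) := by
  rw [HasDegree, formOp_totalD, h, LinearMap.map_smul]

theorem HasDegree.sum {ι : Type*} {k : ℝ} {f : ι → Φ.Form} {S : Finset ι}
    (h : ∀ i ∈ S, Φ.HasDegree k (f i)) : Φ.HasDegree k (∑ i ∈ S, f i) := by
  rw [HasDegree, map_sum, Finset.smul_sum]
  exact Finset.sum_congr rfl h

theorem HasDegree.parityInvolution {k : ℝ} {f : Φ.Form} (h : Φ.HasDegree k f) :
    Φ.HasDegree k (Φ.parityInvolution f) := by
  have : Φ.formOp (Φ.parityInvolution f) = Φ.parityInvolution (Φ.formOp f) := by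
    rw [formOp_apply, formOp_apply, map_sum]
    refine Finset.sum_congr rfl fun ν _ => ?_
    rw [parityInvolution_dx_mul, parityInvolution_oddD, mul_neg, neg_neg]
  rw [HasDegree, this, h, LinearMap.map_smul]

theorem HasDegree.oddD {k : ℝ} {f : Φ.Form} (h : Φ.HasDegree k f) (μ : Fin Φ.dim) :
    Φ.HasDegree (k - 1) (Φ.oddD (Sum.inl μ) f) := by
  have h' : Φ.oddD (Sum.inl μ) (Φ.formOp f) =
      Φ.formOp (Φ.oddD (Sum.inl μ) f) + Φ.oddD (Sum.inl μ) f := by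
    rw [formOp_eq_sum, formOp_eq_sum, map_sum, ← Finset.add_sum_erase _ _ (Finset.mem_univ μ),
      ← Finset.add_sum_erase (a := μ) _ (fun ν => Φ.dxProj ν (Φ.oddD (Sum.inl μ) f))
        (Finset.mem_univ μ), oddD_dxProj, dxProj_apply, oddD_self, mul_zero, zero_add, add_comm]
    congr 1
    exact Finset.sum_congr rfl fun ν hν => oddD_dxProj_of_ne (Finset.ne_of_mem_erase hν).symm f
  rw [h, LinearMap.map_smul] at h'
  rw [HasDegree, sub_smul, one_smul, h', add_sub_cancel_right]

theorem parityInvolution_mem_Forms {g k : ℤ} {f : Φ.Form} (h : f ∈ Φ.Forms g k) :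
    Φ.parityInvolution f ∈ Φ.Forms g k :=
  mem_Forms.2 ⟨(mem_Forms.1 h).1.parityInvolution, (mem_Forms.1 h).2.parityInvolution⟩

theorem d_mem_Forms {g k : ℤ} {f : Φ.Form} (h : f ∈ Φ.Forms g (k - 1)) : Φ.d f ∈ Φ.Forms g k := by
  obtain ⟨h1, h2⟩ := mem_Forms.1 h
  rw [d_apply]
  refine mem_Forms.2 ⟨HasGhost.sum fun μ _ => ?_, HasDegree.sum fun μ _ => ?_⟩
  · exact ((hasGhost_dx μ).mul (h1.totalD μ)).of_eq (zero_add _)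
  · exact ((hasDegree_dx μ).mul (h2.totalD μ)).of_eq (by push_cast; ring)

theorem parityInvolution_d (f : Φ.Form) :
    Φ.parityInvolution (Φ.d f) = -Φ.d (Φ.parityInvolution f) := by
  rw [d_apply, d_apply, map_sum, ← Finset.sum_neg_distrib]
  refine Finset.sum_congr rfl fun ν _ => ?_
  rw [parityInvolution_dx_mul, parityInvolution_totalD]

/-- The graded commutator of the horizontal differential with an evolutionary vector field
vanishes. -/
theorem d_s (a f : Φ.Form) : Φ.d (Φ.s a f) = parityConj (Φ.s a) (Φ.d f) := by
  rw [d_apply, d_apply, map_sum]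
  refine Finset.sum_congr rfl fun ν _ => ?_
  rw [← totalD_s, s_eq, vectorField_dx_mul]

/-! ### Closure properties of forms without `dx` -/

theorem IsDxFree.mul {f g : Φ.Form} (hf : Φ.IsDxFree f) (hg : Φ.IsDxFree g) :
    Φ.IsDxFree (f * g) := fun μ => by
  rw [oddD_mul, hf, hg, zero_mul, mul_zero, add_zero]

theorem IsDxFree.sum {ι : Type*} {f : ι → Φ.Form} {S : Finset ι}
    (h : ∀ i ∈ S, Φ.IsDxFree (f i)) : Φ.IsDxFree (∑ i ∈ S, f i) := fun μ => by
  rw [map_sum]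
  exact Finset.sum_eq_zero fun i hi => h i hi μ

theorem IsDxFree.smul {f : Φ.Form} (h : Φ.IsDxFree f) (r : ℝ) : Φ.IsDxFree (r • f) := fun μ => by
  rw [LinearMap.map_smul, h, smul_zero]

theorem IsDxFree.totalDI {f : Φ.Form} (h : Φ.IsDxFree f) (I : Φ.MultiIndex) :
    Φ.IsDxFree (Φ.totalDI I f) := fun μ => by
  rw [oddD_inl_totalDI, h, LinearMap.map_zero]

theorem IsDxFree.totalD {f : Φ.Form} (h : Φ.IsDxFree f) (ν : Fin Φ.dim) :
    Φ.IsDxFree (Φ.totalD ν f) := fun μ => by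
  rw [oddD_inl_totalD, h, LinearMap.map_zero]

theorem IsDxFree.jetD {f : Φ.Form} (h : Φ.IsDxFree f) (v : Φ.JetVar) :
    Φ.IsDxFree (Φ.jetD v f) := fun μ => by
  rw [oddD_inl_jetD, h, LinearMap.map_zero, smul_zero]

theorem IsDxFree.parityInvolution {f : Φ.Form} (h : Φ.IsDxFree f) :
    Φ.IsDxFree (Φ.parityInvolution f) := fun μ => by
  rw [← neg_neg (Φ.oddD _ _), ← parityInvolution_oddD, h, LinearMap.map_zero, neg_zero]

theorem IsDxFree.twist {f : Φ.Form} (h : Φ.IsDxFree f) (e : ZMod 2) :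
    Φ.IsDxFree (Φ.twist e f) := by
  rcases ZMod.eq_zero_or_one e with rfl | rfl
  · rwa [twist_zero]
  · rw [twist_one]; exact h.parityInvolution

theorem IsDxFree.eulerL {f : Φ.Form} (h : Φ.IsDxFree f) (z : Φ.Species) :
    Φ.IsDxFree (Φ.eulerL z f) := by
  obtain ⟨T, hT⟩ := exists_finset_product f
  rw [eulerL_eq_sum z hT]
  exact IsDxFree.sum fun I _ => ((h.jetD (z, I)).totalDI I).smul _

theorem IsDxFree.brstGen {f : Φ.Form} (h : Φ.IsDxFree f) (z : Φ.Species) :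
    Φ.IsDxFree (Φ.brstGen f z) := by
  rw [brstGen_eq]
  exact ((h.eulerL _).twist _).smul _

theorem IsDxFree.oddD_inl_s {a : Φ.Form} (ha : Φ.IsDxFree a) (μ : Fin Φ.dim) (f : Φ.Form) :
    Φ.oddD (Sum.inl μ) (Φ.s a f) = parityConj (Φ.s a) (Φ.oddD (Sum.inl μ) f) :=
  oddD_inl_vectorField (Q := Φ.prolong (Φ.brstGen a)) μ
    (fun v => (ha.brstGen v.1).totalDI v.2 μ) f

theorem IsDxFree.s {a : Φ.Form} (ha : Φ.IsDxFree a) {f : Φ.Form} (h : Φ.IsDxFree f) :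
    Φ.IsDxFree (Φ.s a f) := fun μ => by
  rw [ha.oddD_inl_s, h, LinearMap.map_zero]

theorem HasGhost.eulerL {g : ℝ} {f : Φ.Form} (h : Φ.HasGhost g f) (z : Φ.Species) :
    Φ.HasGhost (g - Φ.ghost z) (Φ.eulerL z f) := by
  obtain ⟨T, hT⟩ := exists_finset_product f
  rw [eulerL_eq_sum z hT]
  exact HasGhost.sum fun I _ => ((h.jetD (z, I)).totalDI I).smul _

theorem HasGhost.brstGen {g : ℝ} {f : Φ.Form} (h : Φ.HasGhost g f) (z : Φ.Species) :
    Φ.HasGhost (g + 1 + Φ.ghost z) (Φ.brstGen f z) := by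
  rw [brstGen_eq]
  refine (((h.eulerL _).twist _).smul _).of_eq ?_
  rw [ghost_swap]
  push_cast
  ring

theorem parityConj_parityConj (X : Φ.Form →ₗ[ℝ] Φ.Form) : parityConj (parityConj X) = X :=
  LinearMap.ext fun f => by
    rw [parityConj_apply, parityConj_apply, parityInvolution_parityInvolution,
      parityInvolution_parityInvolution]

theorem s_mem_Forms {g₁ g k : ℤ} {a f : Φ.Form} (ha : Φ.IsDxFree a) (hg : Φ.HasGhost g₁ a)
    (h : f ∈ Φ.Forms g k) : Φ.s a f ∈ Φ.Forms (g + (g₁ + 1)) k := by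
  obtain ⟨h1, h2⟩ := mem_Forms.1 h
  refine mem_Forms.2 ⟨?_, ?_⟩
  · refine (HasGhost.vectorField (fun v => (hg.brstGen v.1).totalDI v.2) h1).of_eq ?_
    push_cast
    ring
  · have h' : Φ.formOp (Φ.s a f) = Φ.s a (Φ.formOp f) := by
      rw [formOp_apply, formOp_apply, map_sum]
      refine Finset.sum_congr rfl fun μ _ => ?_
      rw [ha.oddD_inl_s, s_eq, parityConj_vectorField, vectorField_dx_mul, ← parityConj_vectorField,
        parityConj_parityConj]
    rw [HasDegree, h', h2, LinearMap.map_smul]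

/-! ### The volume form and densities -/

variable (Φ) in
/-- The product of the `dx^μ` along a list. -/
def dxProd (l : List (Fin Φ.dim)) : Φ.Form := (l.map Φ.dx).prod

variable (Φ) in
/-- The `dx^μ` along a list are stripped off one after the other. -/
def strip (l : List (Fin Φ.dim)) : Φ.Form →ₗ[ℝ] Φ.Form :=
  l.foldl (fun X μ => Φ.oddD (Sum.inl μ) ∘ₗ X) LinearMap.id

theorem foldl_comp_apply (l : List (Fin Φ.dim)) (X : Φ.Form →ₗ[ℝ] Φ.Form) (f : Φ.Form) :
    l.foldl (fun X μ => Φ.oddD (Sum.inl μ) ∘ₗ X) X f =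
      l.foldl (fun η μ => Φ.oddD (Sum.inl μ) η) (X f) := by
  induction l generalizing X with
  | nil => rfl
  | cons μ l ih => rw [List.foldl_cons, ih]; rfl

theorem density_eq_strip (f : Φ.Form) : Φ.density f = Φ.strip (List.finRange Φ.dim) f := by
  rw [strip, foldl_comp_apply]
  rfl

theorem vol_eq_dxProd : Φ.vol = Φ.dxProd (List.finRange Φ.dim) := rfl

theorem strip_nil (f : Φ.Form) : Φ.strip [] f = f := rfl

theorem strip_cons (μ : Fin Φ.dim) (l : List (Fin Φ.dim)) (f : Φ.Form) :
    Φ.strip (μ :: l) f = Φ.strip l (Φ.oddD (Sum.inl μ) f) := by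
  rw [strip, foldl_comp_apply, strip, foldl_comp_apply]
  rfl

theorem dxProd_nil : Φ.dxProd [] = 1 := rfl

theorem dxProd_cons (μ : Fin Φ.dim) (l : List (Fin Φ.dim)) :
    Φ.dxProd (μ :: l) = Φ.dx μ * Φ.dxProd l := by
  rw [dxProd, List.map_cons, List.prod_cons, dxProd]

/-- Stripping one `dx^ν` and putting it back is the projection `dxProj ν`. Each stripping commutes
with the projections for the remaining directions, so the fixed-point hypothesis passes to the tail.
-/
theorem dxProd_mul_strip {l : List (Fin Φ.dim)} (hl : l.Nodup) {f : Φ.Form}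
    (hf : ∀ μ ∈ l, Φ.dxProj μ f = f) : Φ.dxProd l * Φ.strip l f = f := by
  induction l generalizing f with
  | nil => rw [dxProd_nil, strip_nil, one_mul]
  | cons ν l ih =>
    rw [List.nodup_cons] at hl
    rw [dxProd_cons, strip_cons, mul_assoc, ih hl.2, ← dxProj_apply]
    · exact hf ν List.mem_cons_self
    · intro μ hμ
      have hne : ν ≠ μ := fun h => hl.1 (h ▸ hμ)
      rw [← oddD_dxProj_of_ne hne, hf μ (List.mem_cons_of_mem _ hμ)]

theorem oddD_strip {l : List (Fin Φ.dim)} {μ : Fin Φ.dim} {f : Φ.Form}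
    (h : μ ∈ l ∨ Φ.oddD (Sum.inl μ) f = 0) : Φ.oddD (Sum.inl μ) (Φ.strip l f) = 0 := by
  induction l generalizing f with
  | nil => exact h.resolve_left List.not_mem_nil
  | cons ν l ih =>
    rw [strip_cons]
    refine ih ?_
    rcases h with h | h
    · rcases List.mem_cons.1 h with rfl | h
      · exact Or.inr (oddD_self _ _)
      · exact Or.inl h
    · exact Or.inr (by rw [oddD_oddD, h, LinearMap.map_zero, neg_zero])

theorem oddD_dxProd_mul {l : List (Fin Φ.dim)} {μ : Fin Φ.dim} (hμ : μ ∉ l) {f : Φ.Form}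
    (h : Φ.oddD (Sum.inl μ) f = 0) : Φ.oddD (Sum.inl μ) (Φ.dxProd l * f) = 0 := by
  induction l with
  | nil => rw [dxProd_nil, one_mul, h]
  | cons ν l ih =>
    rw [List.mem_cons, not_or] at hμ
    rw [dxProd_cons, mul_assoc, oddD_dx_mul_of_ne hμ.1, ih hμ.2, mul_zero, neg_zero]

theorem strip_dxProd_mul {l : List (Fin Φ.dim)} (hl : l.Nodup) {f : Φ.Form} (hf : Φ.IsDxFree f) :
    Φ.strip l (Φ.dxProd l * f) = f := by
  induction l with
  | nil => rw [dxProd_nil, strip_nil, one_mul]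
  | cons ν l ih =>
    rw [List.nodup_cons] at hl
    rw [strip_cons, dxProd_cons, mul_assoc, oddD_dx_mul_self, oddD_dxProd_mul hl.1 (hf ν),
      mul_zero, sub_zero, ih hl.2]

theorem strip_totalD (l : List (Fin Φ.dim)) (μ : Fin Φ.dim) (f : Φ.Form) :
    Φ.strip l (Φ.totalD μ f) = Φ.totalD μ (Φ.strip l f) := by
  induction l generalizing f with
  | nil => rfl
  | cons ν l ih => rw [strip_cons, strip_cons, oddD_inl_totalD, ih]

theorem HasGhost.strip {g : ℝ} {f : Φ.Form} (h : Φ.HasGhost g f) (l : List (Fin Φ.dim)) :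
    Φ.HasGhost g (Φ.strip l f) := by
  induction l generalizing f with
  | nil => exact h
  | cons ν l ih => rw [strip_cons]; exact ih (h.oddD_inl ν)

theorem density_vol_mul {f : Φ.Form} (hf : Φ.IsDxFree f) : Φ.density (Φ.vol * f) = f := by
  rw [density_eq_strip, vol_eq_dxProd, strip_dxProd_mul (List.nodup_finRange _) hf]

theorem isDxFree_density (f : Φ.Form) : Φ.IsDxFree (Φ.density f) := fun μ => by
  rw [density_eq_strip]
  exact oddD_strip (Or.inl (List.mem_finRange μ))

theorem HasDegree.vol_mul_density {f : Φ.Form} (h : Φ.HasDegree Φ.dim f) :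
    Φ.vol * Φ.density f = f := by
  rw [density_eq_strip, vol_eq_dxProd, dxProd_mul_strip (List.nodup_finRange _)]
  exact fun μ _ => h.dxProj_eq μ

theorem HasGhost.density {g : ℝ} {f : Φ.Form} (h : Φ.HasGhost g f) :
    Φ.HasGhost g (Φ.density f) := by
  rw [density_eq_strip]
  exact h.strip _

/-- The variational derivatives of an exact form of top degree vanish. -/
theorem eulerL_density_d (z : Φ.Species) (m : Φ.Form) : Φ.eulerL z (Φ.density (Φ.d m)) = 0 := by
  rw [density_eq_strip, d_apply, map_sum, eulerL_eq, map_sum, map_sum]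
  refine Finset.sum_eq_zero fun μ _ => ?_
  -- The `dx^μ` are constant, so an exact form is a sum of total derivatives, and stripping off the
  -- `dx` commutes with these.
  have h : Φ.dx μ * Φ.totalD μ m = Φ.totalD μ (Φ.dx μ * m) := by
    rw [totalD_mul, totalD_dx, zero_mul, zero_add]
  rw [h, strip_totalD, ← eulerL_eq, eulerL_totalD]

theorem hasGhost_dxProd (l : List (Fin Φ.dim)) : Φ.HasGhost 0 (Φ.dxProd l) := by
  induction l with
  | nil => exact hasGhost_one
  | cons μ l ih => rw [dxProd_cons]; exact ((hasGhost_dx μ).mul ih).of_eq (add_zero _)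

theorem hasGhost_vol : Φ.HasGhost 0 Φ.vol := hasGhost_dxProd _

theorem hasDegree_dxProd (l : List (Fin Φ.dim)) : Φ.HasDegree l.length (Φ.dxProd l) := by
  induction l with
  | nil =>
    rw [dxProd_nil, List.length_nil, Nat.cast_zero]
    exact IsDxFree.hasDegree fun μ => oddD_one _
  | cons μ l ih =>
    rw [dxProd_cons, List.length_cons]
    exact ((hasDegree_dx μ).mul ih).of_eq (by push_cast; ring)

theorem hasDegree_vol : Φ.HasDegree Φ.dim Φ.vol := by
  have h := hasDegree_dxProd (List.finRange Φ.dim)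
  rwa [List.length_finRange] at h

theorem totalD_dxProd (ν : Fin Φ.dim) (l : List (Fin Φ.dim)) : Φ.totalD ν (Φ.dxProd l) = 0 := by
  induction l with
  | nil =>
    have h := totalD_mul ν (1 : Φ.Form) 1
    rw [one_mul, one_mul, mul_one] at h
    exact left_eq_add.1 h
  | cons μ l ih => rw [dxProd_cons, totalD_mul, totalD_dx, ih, zero_mul, mul_zero, add_zero]

theorem dx_mul_vol (μ : Fin Φ.dim) : Φ.dx μ * Φ.vol = 0 := by
  rw [← hasDegree_vol.dxProj_eq μ, dxProj_apply, ← mul_assoc, dx_mul_dx, zero_mul]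

/-- Off the diagonal, differentiate the vanishing product of `dx^ν` with the volume form. The
contracted volume forms are the `(n-1)`-forms dual to the total derivatives. -/
theorem dx_mul_oddD_vol (μ ν : Fin Φ.dim) :
    Φ.dx ν * Φ.oddD (Sum.inl μ) Φ.vol = if μ = ν then Φ.vol else 0 := by
  split_ifs with h
  · subst h
    rw [← dxProj_apply, hasDegree_vol.dxProj_eq]
  · have h' := oddD_dx_mul_of_ne h Φ.vol
    rw [dx_mul_vol, LinearMap.map_zero] at h'
    exact neg_eq_zero.1 h'.symm

/-! ### Divergences as exact forms of top degree. -/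

variable (Φ) in
/-- The densities of ghost number `g` that are total divergences. -/
def divergences (g : ℤ) : Submodule ℝ Φ.Form :=
  ((Φ.Forms g (Φ.dim - 1)).map Φ.d).comap (LinearMap.mulLeft ℝ Φ.vol)

theorem mem_divergences {g : ℤ} {f : Φ.Form} :
    f ∈ Φ.divergences g ↔ Φ.vol * f ∈ (Φ.Forms g (Φ.dim - 1)).map Φ.d := Iff.rfl

theorem totalD_mem_divergences {g : ℤ} {f : Φ.Form} (h : Φ.HasGhost g f) (hf : Φ.IsDxFree f)
    (μ : Fin Φ.dim) : Φ.totalD μ f ∈ Φ.divergences g := by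
  -- The contraction of the volume form by direction `μ`, times `f`: in its differential only the
  -- derivative in this direction survives.
  refine mem_divergences.2 ⟨Φ.oddD (Sum.inl μ) Φ.vol * f, mem_Forms.2 ⟨?_, ?_⟩, ?_⟩
  · exact ((hasGhost_vol.oddD_inl μ).mul h).of_eq (zero_add _)
  · exact ((hasDegree_vol.oddD μ).mul hf.hasDegree).of_eq (by push_cast; ring)
  · rw [d_apply, Finset.sum_eq_single μ]
    · rw [totalD_mul, ← oddD_inl_totalD, vol_eq_dxProd, totalD_dxProd, LinearMap.map_zero, zero_mul,
        zero_add, ← mul_assoc, ← vol_eq_dxProd, dx_mul_oddD_vol, if_pos rfl]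
    · intro ν _ hν
      rw [totalD_mul, ← oddD_inl_totalD, vol_eq_dxProd, totalD_dxProd, LinearMap.map_zero, zero_mul,
        zero_add, ← mul_assoc, ← vol_eq_dxProd, dx_mul_oddD_vol, if_neg (Ne.symm hν), zero_mul]
    · intro h; exact absurd (Finset.mem_univ μ) h

/-- Integration by parts. -/
theorem totalDI_mul_sub_mem_divergences {g : ℤ} {g₁ g₂ : ℝ} {f h : Φ.Form} (hf : Φ.HasGhost g₁ f)
    (hh : Φ.HasGhost g₂ h) (hg : g₁ + g₂ = g) (hf' : Φ.IsDxFree f) (hh' : Φ.IsDxFree h)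
    (I : Φ.MultiIndex) :
    Φ.totalDI I f * h - (-1 : ℝ) ^ I.degree • (f * Φ.totalDI I h) ∈ Φ.divergences g := by
  induction I using MultiIndex.induction generalizing h with
  | zero =>
    rw [totalDI_zero, totalDI_zero, map_zero, pow_zero, one_smul, sub_self]
    exact Submodule.zero_mem _
  | add I μ ih =>
    have h1 := totalD_mem_divergences (((hf.totalDI I).mul hh).of_eq hg)
      ((hf'.totalDI I).mul hh') μ
    have h2 := ih (hh.totalD μ) (hh'.totalD μ)
    have h3 := Submodule.sub_mem _ h1 h2
    rw [totalD_mul, totalDI_totalD] at h3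
    rw [totalDI_add_single, totalDI_add_single, map_add, Finsupp.degree_single, pow_succ,
      mul_neg_one, neg_smul, sub_neg_eq_add]
    convert h3 using 1
    abel

/-! ### The antibracket -/

/-- The bracket pairs the Hamiltonian characteristic of `a` with the variational derivatives of `b`,
which is what integration by parts leaves of the prolonged field acting on `b`. -/
theorem bracketDensity_eq (a b : Φ.Form) :
    Φ.bracketDensity a b = ∑ w, Φ.brstGen a w * Φ.eulerL w b := by
  rw [Fintype.sum_sum_type, ← Finset.sum_add_distrib, bracketDensity]
  refine Finset.sum_congr rfl fun A _ => ?_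
  change _ = -Φ.eulerR (Sum.inr A) a * _ + Φ.eulerR (Sum.inl A) a * _
  rw [neg_mul, sub_eq_add_neg, add_comm]

/-- Up to a total divergence, the antibracket is given by the Hamiltonian vector field of its
first argument. -/
theorem s_sub_bracketDensity_mem_divergences {g₁ g₂ : ℤ} {a b : Φ.Form} (ha : Φ.HasGhost g₁ a)
    (hb : Φ.HasGhost g₂ b) (ha' : Φ.IsDxFree a) (hb' : Φ.IsDxFree b) :
    Φ.s a b - Φ.bracketDensity a b ∈ Φ.divergences (g₁ + g₂ + 1) := by
  obtain ⟨T, hT⟩ := exists_finset_product b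
  rw [bracketDensity_eq, s_eq, vectorField_eq_sum _ hT, Finset.sum_product,
    ← Finset.sum_sub_distrib]
  refine Submodule.sum_mem _ fun w _ => ?_
  rw [eulerL_eq_sum w hT, Finset.mul_sum, ← Finset.sum_sub_distrib]
  refine Submodule.sum_mem _ fun I _ => ?_
  rw [mul_smul_comm]
  refine totalDI_mul_sub_mem_divergences (ha.brstGen w) (hb.jetD (w, I)) ?_ (ha'.brstGen w)
    (hb'.jetD _) I
  push_cast
  ring

theorem eulerL_parityInvolution (z : Φ.Species) (f : Φ.Form) :
    Φ.eulerL z (Φ.parityInvolution f) =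
      sgn (Φ.par z) • Φ.parityInvolution (Φ.eulerL z f) := by
  obtain ⟨T, hT⟩ := exists_finset_product f
  have hT' : ∀ v, Φ.jetD v (Φ.parityInvolution f) ≠ 0 →
      v ∈ (Finset.univ : Finset Φ.Species) ×ˢ T := fun v hv => hT v fun h => hv (by
    rw [← one_smul ℝ (Φ.jetD v _), ← sgn_mul_self (Φ.par v.1), mul_smul, ← parityInvolution_jetD, h,
      LinearMap.map_zero, smul_zero])
  rw [eulerL_eq_sum z hT, eulerL_eq_sum z hT', map_sum, Finset.smul_sum]
  refine Finset.sum_congr rfl fun I _ => ?_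
  rw [LinearMap.map_smul, parityInvolution_totalDI, parityInvolution_jetD, LinearMap.map_smul,
    smul_comm (sgn _), smul_smul (sgn _), sgn_mul_self, one_smul]

/-- Graded antisymmetry of the antibracket. -/
theorem two_smul_bracketDensity (a b : Φ.Form) :
    (2 : ℝ) • Φ.bracketDensity a b =
      -Φ.bracketDensity b a - Φ.parityInvolution (Φ.bracketDensity b (Φ.parityInvolution a)) +
        Φ.bracketDensity b (Φ.parityInvolution a) - Φ.parityInvolution (Φ.bracketDensity b a) := by
  -- Conjugation exchanges the two factors in each summand, so one of the brackets is summed over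
  -- swapped species. For homogeneous arguments the identity becomes the rule `(a,b) =
  -- -(-1)^((ε(a)+1)(ε(b)+1)) (b,a)`; the four terms encode this sign for mixed parities.
  have hsum : ∀ c : Φ.Form, Φ.bracketDensity b c =
      ∑ w : Φ.Species, Φ.brstGen b w.swap * Φ.eulerL w.swap c := fun c => by
    rw [bracketDensity_eq, ← Equiv.sum_comp (Equiv.sumComm Φ.Field Φ.Field)]
    rfl
  rw [hsum, hsum, bracketDensity_eq, map_sum, map_sum, Finset.smul_sum, ← Finset.sum_neg_distrib,
    ← Finset.sum_sub_distrib, ← Finset.sum_add_distrib, ← Finset.sum_sub_distrib]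
  refine Finset.sum_congr rfl fun w _ => ?_
  rw [brstGen_eq, brstGen_eq, Sum.swap_swap, orient_swap, eulerL_parityInvolution, par_swap]
  generalize Φ.eulerL w.swap a = F
  generalize Φ.eulerL w b = G
  rw [smul_mul_assoc, smul_comm, two_smul_mul]
  rcases ZMod.eq_zero_or_one (Φ.par w) with h | h
  · rw [h, zero_add, twist_one, twist_zero, sgn_one]
    simp only [neg_smul, one_smul, smul_mul_assoc, mul_neg, neg_mul, LinearMap.map_neg,
      LinearMap.map_smul, parityInvolution_mul, parityInvolution_parityInvolution, smul_add,
      smul_sub, neg_neg]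
    abel
  · rw [h, show (1 + 1 : ZMod 2) = 0 from rfl, twist_one, twist_zero, sgn_zero]
    simp only [neg_smul, one_smul, smul_mul_assoc, neg_mul, LinearMap.map_neg,
      LinearMap.map_smul, parityInvolution_mul, parityInvolution_parityInvolution, smul_add,
      smul_sub, neg_neg]
    abel

/-! ### Conjugation by the volume form -/

theorem dx_mul_parityConj {Y : Φ.Form →ₗ[ℝ] Φ.Form}
    (hY : ∀ μ f, Φ.dx μ * Y f = parityConj Y (Φ.dx μ * f)) (μ : Fin Φ.dim) (f : Φ.Form) :
    Φ.dx μ * parityConj Y f = parityConj (parityConj Y) (Φ.dx μ * f) := by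
  have h := congrArg Φ.parityInvolution (hY μ (Φ.parityInvolution f))
  rw [parityInvolution_dx_mul, ← parityConj_apply, parityConj_apply Y (Φ.dx μ * _),
    parityInvolution_parityInvolution, parityInvolution_dx_mul, parityInvolution_parityInvolution,
    LinearMap.map_neg] at h
  rw [parityConj_parityConj]
  exact neg_injective h

theorem dxProd_mul_apply {Y : Φ.Form →ₗ[ℝ] Φ.Form}
    (hY : ∀ μ f, Φ.dx μ * Y f = parityConj Y (Φ.dx μ * f)) (l : List (Fin Φ.dim)) (f : Φ.Form) :
    Φ.dxProd l * Y f = parityConj^[l.length] Y (Φ.dxProd l * f) := by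
  have hY' : ∀ n μ f, Φ.dx μ * parityConj^[n] Y f = parityConj (parityConj^[n] Y) (Φ.dx μ * f) := by
    intro n
    induction n with
    | zero => exact hY
    | succ n ih =>
      rw [Function.iterate_succ_apply']
      exact dx_mul_parityConj ih
  induction l with
  | nil => rw [dxProd_nil, one_mul, one_mul]; rfl
  | cons μ l ih =>
    rw [dxProd_cons, mul_assoc, ih, hY', List.length_cons, Function.iterate_succ_apply', mul_assoc]

/-- Each `dx^μ` that passes the field conjugates it once. The iterated conjugate is thus the
operator on forms that corresponds to the Hamiltonian field on densities. -/
theorem vol_mul_s (a f : Φ.Form) : Φ.vol * Φ.s a f = parityConj^[Φ.dim] (Φ.s a) (Φ.vol * f) := by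
  have h := dxProd_mul_apply (Y := Φ.s a) (fun μ f => vectorField_dx_mul _ μ f)
    (List.finRange Φ.dim) f
  rwa [List.length_finRange] at h

theorem parityInvolution_dxProd_mul (l : List (Fin Φ.dim)) (f : Φ.Form) :
    Φ.parityInvolution (Φ.dxProd l * f) =
      (-1 : ℝ) ^ l.length • (Φ.dxProd l * Φ.parityInvolution f) := by
  induction l with
  | nil => rw [dxProd_nil, one_mul, one_mul, List.length_nil, pow_zero, one_smul]
  | cons μ l ih =>
    rw [dxProd_cons, mul_assoc, parityInvolution_dx_mul, ih, List.length_cons, pow_succ,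
      mul_neg_one, neg_smul, mul_smul_comm, mul_assoc]

theorem parityInvolution_vol_mul (f : Φ.Form) :
    Φ.parityInvolution (Φ.vol * f) = (-1 : ℝ) ^ Φ.dim • (Φ.vol * Φ.parityInvolution f) := by
  have h := parityInvolution_dxProd_mul (List.finRange Φ.dim) f
  rwa [List.length_finRange] at h

theorem parityConj_iterate_of_even (X : Φ.Form →ₗ[ℝ] Φ.Form) {n : ℕ} (hn : Even n) :
    parityConj^[n] X = X := by
  obtain ⟨k, rfl⟩ := hn
  induction k with
  | zero => rfl
  | succ k ih =>
    rw [show k + 1 + (k + 1) = k + k + 1 + 1 by ring, Function.iterate_succ_apply',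
      Function.iterate_succ_apply', ih, parityConj_parityConj]

theorem parityConj_iterate_of_odd (X : Φ.Form →ₗ[ℝ] Φ.Form) {n : ℕ} (hn : Odd n) :
    parityConj^[n] X = parityConj X := by
  obtain ⟨k, rfl⟩ := hn
  change parityConj^[Nat.succ (2 * k)] X = _
  rw [Function.iterate_succ_apply', parityConj_iterate_of_even X ⟨k, two_mul k⟩]

theorem parityInvolution_mem_divergences {g : ℤ} {f : Φ.Form} (h : f ∈ Φ.divergences g) :
    Φ.parityInvolution f ∈ Φ.divergences g := by
  obtain ⟨m, hm, he⟩ := mem_divergences.1 h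
  have h1 : Φ.vol * Φ.parityInvolution f =
      (-1 : ℝ) ^ Φ.dim • Φ.parityInvolution (Φ.vol * f) := by
    rw [parityInvolution_vol_mul, smul_smul, ← mul_pow, neg_one_mul, neg_neg, one_pow, one_smul]
  rw [mem_divergences, h1, ← he, parityInvolution_d]
  exact Submodule.smul_mem _ _ (Submodule.neg_mem _ ⟨_, parityInvolution_mem_Forms hm, rfl⟩)

/-! ### Symmetries of the BRST complex -/

/-- The graded commutators of `X` with `s` and `d` vanish, where `X'` is obtained from `X` by a
change of the sign of the odd part. -/
structure IsSymmetry (L : Φ.Form) (X X' : Φ.Form →ₗ[ℝ] Φ.Form) (r : ℤ) : Prop where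
  s_left : ∀ f, Φ.s L (X f) = X' (Φ.s L f)
  s_right : ∀ f, Φ.s L (X' f) = X (Φ.s L f)
  d_left : ∀ f, Φ.d (X f) = X' (Φ.d f)
  d_right : ∀ f, Φ.d (X' f) = X (Φ.d f)
  mem_left : ∀ {g k : ℤ} {f}, f ∈ Φ.Forms g k → X f ∈ Φ.Forms (g + r) k
  mem_right : ∀ {g k : ℤ} {f}, f ∈ Φ.Forms g k → X' f ∈ Φ.Forms (g + r) k

theorem IsSymmetry.symm {L : Φ.Form} {X X' : Φ.Form →ₗ[ℝ] Φ.Form} {r : ℤ}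
    (h : IsSymmetry L X X' r) : IsSymmetry L X' X r :=
  ⟨h.s_right, h.s_left, h.d_right, h.d_left, h.mem_right, h.mem_left⟩

theorem IsSymmetry.iterate {L : Φ.Form} {X : Φ.Form →ₗ[ℝ] Φ.Form} {r : ℤ}
    (h : IsSymmetry L X (parityConj X) r) (n : ℕ) :
    IsSymmetry L (parityConj^[n] X) (parityConj (parityConj^[n] X)) r := by
  rcases Nat.even_or_odd n with hn | hn
  · rwa [parityConj_iterate_of_even X hn]
  · rw [parityConj_iterate_of_odd X hn, parityConj_parityConj]
    exact h.symm

/-! ### Degrees and signs of the BRST differential. -/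

theorem IsMasterLagrangian.hasParity {L : Φ.Form} (hL : Φ.IsMasterLagrangian L) :
    Φ.HasParity 0 L := by
  rw [HasParity, hL.even, sgn_zero, one_smul]

theorem IsMasterLagrangian.hasGhost {L : Φ.Form} (hL : Φ.IsMasterLagrangian L) :
    Φ.HasGhost (0 : ℤ) L := (mem_Forms.1 hL.mem).1

theorem IsMasterLagrangian.isDxFree {L : Φ.Form} (hL : Φ.IsMasterLagrangian L) :
    Φ.IsDxFree L := ((mem_Forms.1 hL.mem).2.of_eq Int.cast_zero).isDxFree

theorem IsMasterLagrangian.s_mem_Forms {L : Φ.Form} (hL : Φ.IsMasterLagrangian L) {g k : ℤ}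
    {f : Φ.Form} (h : f ∈ Φ.Forms g k) : Φ.s L f ∈ Φ.Forms (g + 1) k := by
  have := FieldContent.s_mem_Forms hL.isDxFree hL.hasGhost h
  rwa [zero_add] at this

theorem IsMasterLagrangian.parityInvolution_s {L : Φ.Form} (hL : Φ.IsMasterLagrangian L)
    (f : Φ.Form) : Φ.parityInvolution (Φ.s L f) = -Φ.s L (Φ.parityInvolution f) := by
  have h := hL.hasParity.twist_s 1 f
  rwa [twist_one, twist_one, sgn_one, neg_one_smul] at h

theorem IsMasterLagrangian.parityConj_s {L : Φ.Form} (hL : Φ.IsMasterLagrangian L) :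
    parityConj (Φ.s L) = -Φ.s L :=
  LinearMap.ext fun f => by
    rw [parityConj_apply, hL.parityInvolution_s, parityInvolution_parityInvolution,
      LinearMap.neg_apply]

theorem IsMasterLagrangian.d_s {L : Φ.Form} (hL : Φ.IsMasterLagrangian L) (f : Φ.Form) :
    Φ.d (Φ.s L f) = -Φ.s L (Φ.d f) := by
  rw [FieldContent.d_s, hL.parityConj_s, LinearMap.neg_apply]

theorem IsMasterLagrangian.s_vol_mul {L : Φ.Form} (hL : Φ.IsMasterLagrangian L) (f : Φ.Form) :
    Φ.vol * Φ.s L f = (-1 : ℝ) ^ Φ.dim • Φ.s L (Φ.vol * f) := by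
  rw [vol_mul_s]
  rcases Nat.even_or_odd Φ.dim with hn | hn
  · rw [parityConj_iterate_of_even _ hn, hn.neg_one_pow, one_smul]
  · rw [parityConj_iterate_of_odd _ hn, hn.neg_one_pow, neg_one_smul, hL.parityConj_s,
      LinearMap.neg_apply]

/-! ### Symmetries acting on cocycles and coboundaries. -/

theorem mem_cocycles {L : Φ.Form} {g k : ℤ} {f : Φ.Form} :
    f ∈ Φ.cocycles L g k ↔
      f ∈ Φ.Forms g k ∧ ∃ m ∈ Φ.Forms (g + 1) (k - 1), Φ.d m = -Φ.s L f := Iff.rfl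

theorem mem_coboundaries {L : Φ.Form} {g k : ℤ} {f : Φ.Form} :
    f ∈ Φ.coboundaries L g k ↔
      ∃ b ∈ Φ.Forms (g - 1) k, ∃ m ∈ Φ.Forms g (k - 1), Φ.s L b + Φ.d m = f := by
  rw [coboundaries, Submodule.mem_sup]
  constructor
  · rintro ⟨_, ⟨b, hb, rfl⟩, _, ⟨m, hm, rfl⟩, h⟩
    exact ⟨b, hb, m, hm, h⟩
  · rintro ⟨b, hb, m, hm, h⟩
    exact ⟨_, ⟨b, hb, rfl⟩, _, ⟨m, hm, rfl⟩, h⟩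

theorem IsMasterLagrangian.map_d_le_cocycles {L : Φ.Form} (hL : Φ.IsMasterLagrangian L) {g k : ℤ}
    {f : Φ.Form} (h : f ∈ (Φ.Forms g (k - 1)).map Φ.d) : f ∈ Φ.cocycles L g k := by
  obtain ⟨m, hm, rfl⟩ := h
  exact mem_cocycles.2 ⟨d_mem_Forms hm, Φ.s L m, hL.s_mem_Forms hm, hL.d_s m⟩

theorem map_d_le_coboundaries {L : Φ.Form} {g k : ℤ} {f : Φ.Form}
    (h : f ∈ (Φ.Forms g (k - 1)).map Φ.d) : f ∈ Φ.coboundaries L g k :=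
  (le_sup_right : _ ≤ Φ.coboundaries L g k) h

theorem IsSymmetry.map_cocycles {L : Φ.Form} {X X' : Φ.Form →ₗ[ℝ] Φ.Form} {r : ℤ}
    (h : IsSymmetry L X X' r) {g k : ℤ} {f : Φ.Form} (hf : f ∈ Φ.cocycles L g k) :
    X f ∈ Φ.cocycles L (g + r) k := by
  obtain ⟨h1, m, hm, he⟩ := mem_cocycles.1 hf
  refine mem_cocycles.2 ⟨h.mem_left h1, X m, ?_, ?_⟩
  · rw [add_right_comm]
    exact h.mem_left hm
  · rw [h.d_left, he, LinearMap.map_neg, h.s_left]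

/-- The companion `X'` acts on the primitives, because `s` and `d` turn it back into `X`. -/
theorem IsSymmetry.map_coboundaries {L : Φ.Form} {X X' : Φ.Form →ₗ[ℝ] Φ.Form} {r : ℤ}
    (h : IsSymmetry L X X' r) {g k : ℤ} {f : Φ.Form} (hf : f ∈ Φ.coboundaries L g k) :
    X f ∈ Φ.coboundaries L (g + r) k := by
  obtain ⟨b, hb, m, hm, rfl⟩ := mem_coboundaries.1 hf
  refine mem_coboundaries.2 ⟨X' b, ?_, X' m, h.mem_right hm, ?_⟩
  · rw [add_sub_right_comm]
    exact h.mem_right hb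
  · rw [h.s_right, h.d_right, LinearMap.map_add]

/-- The variational derivatives of `(S, a)` vanish if `a` is the density of a cocycle. -/
theorem IsMasterLagrangian.eulerL_s_density {L : Φ.Form} (hL : Φ.IsMasterLagrangian L) {g : ℤ}
    {ω : Φ.Form} (hω : ω ∈ Φ.cocycles L g Φ.dim) (z : Φ.Species) :
    Φ.eulerL z (Φ.s L (Φ.density ω)) = 0 := by
  obtain ⟨h1, m, -, he⟩ := mem_cocycles.1 hω
  have hd := ((mem_Forms.1 h1).2.of_eq (Int.cast_natCast _)).vol_mul_density
  -- Moving `s` past the volume form costs the sign `(-1) ^ n`; the cocycle condition then makes the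
  -- form exact.
  have h2 : Φ.vol * Φ.s L (Φ.density ω) = Φ.d (-((-1 : ℝ) ^ Φ.dim • m)) := by
    rw [hL.s_vol_mul, hd, LinearMap.map_neg, LinearMap.map_smul, he, smul_neg, neg_neg]
  rw [← density_vol_mul (hL.isDxFree.s (isDxFree_density ω)), h2, eulerL_density_d]

/-- Commutation with `s` uses the vanishing variational derivatives, commutation with `d` only that
the field is evolutionary. The ghost number grows by that of `a` plus one, the ghost number of the
antibracket. -/
theorem IsMasterLagrangian.isSymmetry_s {L : Φ.Form} (hL : Φ.IsMasterLagrangian L) {g : ℤ}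
    {a : Φ.Form} (ha : Φ.IsDxFree a) (hg : Φ.HasGhost g a)
    (h0 : ∀ z, Φ.eulerL z (Φ.s L a) = 0) :
    IsSymmetry L (Φ.s a) (parityConj (Φ.s a)) (g + 1) where
  s_left := hL.hasParity.s_s h0
  s_right f := by
    rw [parityConj_apply, ← neg_neg (Φ.s L _), ← hL.parityInvolution_s, hL.hasParity.s_s h0,
      parityConj_apply, parityInvolution_parityInvolution, hL.parityInvolution_s,
      parityInvolution_parityInvolution, LinearMap.map_neg, neg_neg]
  d_left := FieldContent.d_s a
  d_right f := by
    rw [parityConj_apply, ← neg_neg (Φ.d _), ← parityInvolution_d, FieldContent.d_s,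
      parityConj_apply, parityInvolution_parityInvolution, parityInvolution_d,
      parityInvolution_parityInvolution, LinearMap.map_neg, neg_neg]
  mem_left h := FieldContent.s_mem_Forms ha hg h
  mem_right h :=
    parityInvolution_mem_Forms (FieldContent.s_mem_Forms ha hg (parityInvolution_mem_Forms h))

/-- The operator whose action on a density `a` is the antibracket `(a, b)`, if `X` is the
Hamiltonian vector field of `b`. -/
def rightOp (X : Φ.Form →ₗ[ℝ] Φ.Form) : Φ.Form →ₗ[ℝ] Φ.Form :=
  (1 / 2 : ℝ) • (-X - parityConj X + X ∘ₗ Φ.parityInvolution - Φ.parityInvolution ∘ₗ X)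

theorem rightOp_apply (X : Φ.Form →ₗ[ℝ] Φ.Form) (f : Φ.Form) :
    rightOp X f = (1 / 2 : ℝ) • (-X f - parityConj X f + X (Φ.parityInvolution f) -
      Φ.parityInvolution (X f)) := rfl

/-- An odd `T` exchanges `X` with `parityConj X`, and it exchanges `X ∘ P` with `-P ∘ X` for the
parity involution `P`. Both pairs enter `rightOp X` so that these exchanges preserve it. An operator
acting from the right thus commutes with `s` and `d` without a sign and is its own companion. -/
theorem rightOp_comm {T X : Φ.Form →ₗ[ℝ] Φ.Form} (h : ∀ f, T (X f) = parityConj X (T f))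
    (h' : ∀ f, T (parityConj X f) = X (T f))
    (hT : ∀ f, Φ.parityInvolution (T f) = -T (Φ.parityInvolution f)) (f : Φ.Form) :
    T (rightOp X f) = rightOp X (T f) := by
  have h1 : T (Φ.parityInvolution (X f)) = -X (Φ.parityInvolution (T f)) := by
    rw [← neg_neg (T _), ← hT, h, parityConj_apply, parityInvolution_parityInvolution]
  have h2 : T (X (Φ.parityInvolution f)) = -Φ.parityInvolution (X (T f)) := by
    rw [h, parityConj_apply, hT, parityInvolution_parityInvolution, LinearMap.map_neg,
      LinearMap.map_neg]
  rw [rightOp_apply, rightOp_apply, LinearMap.map_smul, LinearMap.map_sub, LinearMap.map_add,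
    LinearMap.map_sub, LinearMap.map_neg, h, h', h1, h2]
  congr 1
  abel

theorem IsSymmetry.rightOp {L : Φ.Form} (hL : Φ.IsMasterLagrangian L)
    {X : Φ.Form →ₗ[ℝ] Φ.Form} {r : ℤ} (h : IsSymmetry L X (parityConj X) r) :
    IsSymmetry L (rightOp X) (rightOp X) r := by
  have hs := rightOp_comm h.s_left h.s_right hL.parityInvolution_s
  have hd := rightOp_comm h.d_left h.d_right parityInvolution_d
  have hm : ∀ {g k : ℤ} {f}, f ∈ Φ.Forms g k → FieldContent.rightOp X f ∈ Φ.Forms (g + r) k :=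
    fun hf => Submodule.smul_mem _ _ (Submodule.sub_mem _ (Submodule.add_mem _
      (Submodule.sub_mem _ (Submodule.neg_mem _ (h.mem_left hf)) (h.mem_right hf))
      (h.mem_left (parityInvolution_mem_Forms hf))) (parityInvolution_mem_Forms (h.mem_left hf)))
  exact ⟨hs, hs, hd, hd, hm, hm⟩

/-- An action from the right is insensitive to the volume form on the left. In even dimension each
term passes separately; in odd dimension the terms are permuted in pairs. -/
theorem rightOp_vol_mul (b f : Φ.Form) :
    rightOp (Φ.s b) (Φ.vol * f) = Φ.vol * rightOp (Φ.s b) f := by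
  have hX := vol_mul_s b
  have hP := parityInvolution_vol_mul (Φ := Φ)
  rw [rightOp_apply, rightOp_apply, mul_smul_comm, mul_sub, mul_add, mul_sub, mul_neg]
  congr 1
  rcases Nat.even_or_odd Φ.dim with hn | hn
  · rw [parityConj_iterate_of_even _ hn] at hX
    simp only [hn.neg_one_pow, one_smul] at hP
    simp only [parityConj_apply, hP, ← hX]
  · rw [parityConj_iterate_of_odd _ hn] at hX
    simp only [hn.neg_one_pow, neg_one_smul] at hP
    have hP' : ∀ f, Φ.vol * Φ.parityInvolution f = -Φ.parityInvolution (Φ.vol * f) := fun f => by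
      rw [hP, neg_neg]
    have hX' : ∀ f, Φ.s b (Φ.vol * f) = Φ.vol * parityConj (Φ.s b) f := fun f => by
      rw [parityConj_apply, hP', hX, parityConj_apply, parityInvolution_parityInvolution, hP,
        LinearMap.map_neg, parityInvolution_parityInvolution, neg_neg]
    simp only [← hX, hX', hP, LinearMap.map_neg, parityConj_apply,
      parityInvolution_parityInvolution]
    abel

/-! ### The antibracket as an operator on either argument. -/

theorem antibracket_sub_left {g₁ g₂ : ℤ} {ω₁ ω₂ : Φ.Form} (h₁ : ω₁ ∈ Φ.Forms g₁ Φ.dim)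
    (h₂ : ω₂ ∈ Φ.Forms g₂ Φ.dim) :
    parityConj^[Φ.dim] (Φ.s (Φ.density ω₁)) ω₂ - Φ.antibracket ω₁ ω₂ ∈
      (Φ.Forms (g₁ + g₂ + 1) (Φ.dim - 1)).map Φ.d := by
  have h := s_sub_bracketDensity_mem_divergences (mem_Forms.1 h₁).1.density
    (mem_Forms.1 h₂).1.density (isDxFree_density ω₁) (isDxFree_density ω₂)
  rwa [mem_divergences, mul_sub, vol_mul_s,
    ((mem_Forms.1 h₂).2.of_eq (Int.cast_natCast _)).vol_mul_density] at h

/-- Antisymmetry rewrites `(a, b)` through brackets with `b` in the first slot, evaluated on `a` and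
on its parity conjugate. Each of them is the Hamiltonian field of `b` up to a divergence, and
divergences are stable under the parity involution. -/
theorem antibracket_sub_right {g₁ g₂ : ℤ} {ω₁ ω₂ : Φ.Form} (h₁ : ω₁ ∈ Φ.Forms g₁ Φ.dim)
    (h₂ : ω₂ ∈ Φ.Forms g₂ Φ.dim) :
    rightOp (Φ.s (Φ.density ω₂)) ω₁ - Φ.antibracket ω₁ ω₂ ∈
      (Φ.Forms (g₁ + g₂ + 1) (Φ.dim - 1)).map Φ.d := by
  have hω₁ := ((mem_Forms.1 h₁).2.of_eq (Int.cast_natCast _)).vol_mul_density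
  have ha := (mem_Forms.1 h₁).1.density
  have hb := (mem_Forms.1 h₂).1.density
  have ha' := isDxFree_density ω₁
  have hb' := isDxFree_density ω₂
  rw [antibracket, ← hω₁, density_vol_mul ha', rightOp_vol_mul, ← mul_sub, ← mem_divergences]
  generalize Φ.density ω₁ = a at *
  generalize Φ.density ω₂ = b at *
  have e1 := s_sub_bracketDensity_mem_divergences hb ha hb' ha'
  have e2 := s_sub_bracketDensity_mem_divergences hb ha.parityInvolution hb' ha'.parityInvolution
  have e1' := parityInvolution_mem_divergences e1
  have e2' := parityInvolution_mem_divergences e2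
  rw [add_comm g₂ g₁] at e1 e2 e1' e2'
  have e := Submodule.smul_mem _ (1 / 2 : ℝ) (Submodule.sub_mem _ (Submodule.add_mem _
    (Submodule.sub_mem _ (Submodule.neg_mem _ e1) e2') e2) e1')
  have h := two_smul_bracketDensity a b
  have h' : Φ.bracketDensity a b = (1 / 2 : ℝ) • (2 : ℝ) • Φ.bracketDensity a b := by
    rw [smul_smul]; norm_num
  rw [h', h, rightOp_apply, ← smul_sub, parityConj_apply]
  convert e using 2
  simp only [LinearMap.map_sub]
  abel

/-! ### Descents and depth -/

/-- Total derivatives commute and the `dx^μ` anticommute, so the double sum equals its own negative.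
-/
theorem d_d (f : Φ.Form) : Φ.d (Φ.d f) = 0 := by
  have h : Φ.d (Φ.d f) = ∑ μ, ∑ ν, Φ.dx μ * (Φ.dx ν * Φ.totalD μ (Φ.totalD ν f)) := by
    rw [d_apply]
    refine Finset.sum_congr rfl fun μ _ => ?_
    rw [d_apply, map_sum, Finset.mul_sum]
    refine Finset.sum_congr rfl fun ν _ => ?_
    rw [totalD_mul, totalD_dx, zero_mul, zero_add]
  have h' : Φ.d (Φ.d f) = -Φ.d (Φ.d f) := by
    conv_lhs => rw [h, Finset.sum_comm]
    rw [h, ← Finset.sum_neg_distrib]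
    refine Finset.sum_congr rfl fun μ _ => ?_
    rw [← Finset.sum_neg_distrib]
    refine Finset.sum_congr rfl fun ν _ => ?_
    rw [dx_mul_dx_mul, totalD_comm]
  have h2 : (2 : ℝ) • Φ.d (Φ.d f) = 0 := by
    rw [two_smul]
    exact add_eq_zero_iff_eq_neg.2 h'
  rw [← one_smul ℝ (Φ.d (Φ.d f)), show (1 : ℝ) = 1 / 2 * 2 by norm_num, mul_smul, h2, smul_zero]

theorem toClass_eq_zero {L : Φ.Form} {g k : ℤ} {ω : Φ.cocycles L g k} :
    Φ.toClass L g k ω = 0 ↔ (ω : Φ.Form) ∈ Φ.coboundaries L g k :=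
  Submodule.Quotient.mk_eq_zero _

theorem toClass_eq {L : Φ.Form} {g k : ℤ} {ω ω' : Φ.cocycles L g k} :
    Φ.toClass L g k ω = Φ.toClass L g k ω' ↔ (ω - ω' : Φ.Form) ∈ Φ.coboundaries L g k := by
  rw [← sub_eq_zero, ← LinearMap.map_sub, toClass_eq_zero]
  rfl

theorem toClass_surjective (L : Φ.Form) (g k : ℤ) : Function.Surjective (Φ.toClass L g k) :=
  Submodule.mkQ_surjective _

theorem depth_zero (L : Φ.Form) (g k : ℤ) : Φ.depth L (0 : Φ.Cohomology L g k) = 0 :=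
  if_pos rfl

/-- A possibly trivial descent can be shortened until its last element is nontrivial. -/
theorem IsMasterLagrangian.depth_le_of_descent {L : Φ.Form} (hL : Φ.IsMasterLagrangian L)
    {g k : ℤ} {c : Φ.Cohomology L g k} {l : ℕ} {η : ℕ → Φ.Form} (h0 : η 0 ∈ Φ.cocycles L g k)
    (hc : Φ.toClass L g k ⟨η 0, h0⟩ = c) (mem : ∀ i ≤ l, η i ∈ Φ.Forms (g + i) (k - i))
    (step : ∀ i < l, Φ.s L (η i) + Φ.d (η (i + 1)) = 0) (last : Φ.s L (η l) = 0) :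
    Φ.depth L c ≤ l := by
  induction l generalizing η with
  | zero =>
    -- A descent of length zero with trivial last element starts from an `s`-exact form; its class
    -- is zero and has depth `0` by convention.
    by_cases hn : η 0 ∈ (Φ.Forms (g + (0 : ℕ) - 1) (k - (0 : ℕ))).map (Φ.s L)
    · have hc0 : c = 0 := by
        rw [← hc, toClass_eq_zero]
        obtain ⟨b, hb, he⟩ := hn
        refine mem_coboundaries.2 ⟨b, ?_, 0, Submodule.zero_mem _, ?_⟩
        · rw [Nat.cast_zero, add_zero, sub_zero] at hb
          exact hb
        · rw [LinearMap.map_zero, add_zero]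
          exact he
      rw [hc0, depth_zero]
      exact zero_le
    · rw [depth]
      split_ifs
      · exact zero_le
      · exact iInf₂_le 0 ⟨η, h0, hc, mem, step, last, hn⟩
  | succ l ih =>
    by_cases hn : η (l + 1) ∈
        (Φ.Forms (g + (l + 1 : ℕ) - 1) (k - (l + 1 : ℕ))).map (Φ.s L)
    · obtain ⟨b, hb, he⟩ := hn
      have hb' : b ∈ Φ.Forms (g + l) (k - l - 1) := by
        have e1 : g + ((l + 1 : ℕ) : ℤ) - 1 = g + l := by push_cast; ring
        have e2 : k - ((l + 1 : ℕ) : ℤ) = k - l - 1 := by push_cast; ring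
        rwa [e1, e2] at hb
      -- Here `η (l + 1)` is `s b`, so `s (η l) = -d (s b) = s (d b)`. The corrected element closes
      -- the descent one step earlier, and the step leading to it is unchanged because `d` squares
      -- to zero.
      have hs : Φ.s L (η l - Φ.d b) = 0 := by
        rw [LinearMap.map_sub, sub_eq_add_neg, ← hL.d_s, he]
        exact step l (Nat.lt_succ_self l)
      have hm : η l - Φ.d b ∈ Φ.Forms (g + l) (k - l) :=
        Submodule.sub_mem _ (mem l (Nat.le_succ l)) (d_mem_Forms hb')
      have hlt : ∀ i < l, Function.update η l (η l - Φ.d b) i = η i :=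
        fun i hi => Function.update_of_ne hi.ne _ _
      have hzero : ∃ h0' : Function.update η l (η l - Φ.d b) 0 ∈ Φ.cocycles L g k,
          Φ.toClass L g k ⟨_, h0'⟩ = c := by
        -- For `l = 0` the correction changes the representative itself, but only by an exact form;
        -- otherwise the starting element is untouched.
        rcases Nat.eq_zero_or_pos l with rfl | hl
        · rw [Nat.cast_zero, add_zero, sub_zero] at hb'
          have hd : Φ.d b ∈ (Φ.Forms g (k - 1)).map Φ.d := ⟨b, hb', rfl⟩
          have h0' : Function.update η 0 (η 0 - Φ.d b) 0 ∈ Φ.cocycles L g k := by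
            rw [Function.update_self]
            exact Submodule.sub_mem _ h0 (hL.map_d_le_cocycles hd)
          refine ⟨h0', ?_⟩
          rw [← hc, toClass_eq]
          change Function.update η 0 (η 0 - Φ.d b) 0 - η 0 ∈ _
          rw [Function.update_self, sub_sub_cancel_left]
          exact Submodule.neg_mem _ (map_d_le_coboundaries hd)
        · have h0' : Function.update η l (η l - Φ.d b) 0 ∈ Φ.cocycles L g k := by
            rwa [hlt 0 hl]
          refine ⟨h0', ?_⟩
          rw [← hc]
          congr 1
          exact Subtype.ext (hlt 0 hl)
      obtain ⟨h0', hc'⟩ := hzero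
      refine (ih h0' hc' ?_ ?_ ?_).trans (by exact_mod_cast Nat.le_succ l)
      · intro i hi
        rcases hi.lt_or_eq with h | rfl
        · rw [hlt i h]
          exact mem i (hi.trans (Nat.le_succ l))
        · rw [Function.update_self]
          exact hm
      · intro i hi
        rw [hlt i hi]
        rcases (Nat.succ_le_of_lt hi).lt_or_eq with h | h
        · rw [hlt (i + 1) h]
          exact step i (hi.trans (Nat.lt_succ_self l))
        · have h' : i + 1 = l := h
          subst h'
          rw [Function.update_self, LinearMap.map_sub, d_d, sub_zero]
          exact step i (hi.trans (Nat.lt_succ_self _))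
      · rw [Function.update_self]
        exact hs
    · rw [depth]
      split_ifs
      · exact zero_le
      · exact iInf₂_le (l + 1) ⟨η, h0, hc, mem, step, last, hn⟩

/-- Both differentials pass `X` with the same companion, so `X` applied to each element gives a
descent of the same length, possibly with trivial last element. The zero class needs the separate
hypothesis `h0`, since its depth `0` is a convention and need not come from a descent. -/
theorem IsSymmetry.depth_le {L : Φ.Form} (hL : Φ.IsMasterLagrangian L)
    {X X' : Φ.Form →ₗ[ℝ] Φ.Form} {r g g' k : ℤ} (h : IsSymmetry L X X' r) (hg : g + r = g')
    {c : Φ.Cohomology L g k} {c' : Φ.Cohomology L g' k} (h0 : c = 0 → c' = 0)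
    (hc : ∀ ω (hω : ω ∈ Φ.cocycles L g k), Φ.toClass L g k ⟨ω, hω⟩ = c →
      ∃ hω' : X ω ∈ Φ.cocycles L g' k, Φ.toClass L g' k ⟨X ω, hω'⟩ = c') :
    Φ.depth L c' ≤ Φ.depth L c := by
  by_cases hz : c = 0
  · rw [h0 hz, depth_zero]
    exact zero_le
  · rw [depth, depth, if_neg hz, ← depth]
    refine le_iInf₂ fun l ⟨η, hη, hηc, hd⟩ => ?_
    obtain ⟨h', hc'⟩ := hc _ hη hηc
    refine hL.depth_le_of_descent (η := fun i => X (η i)) h' hc' ?_ ?_ ?_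
    · intro i hi
      rw [← hg, add_right_comm]
      exact h.mem_left (hd.mem i hi)
    · intro i hi
      rw [h.s_left, h.d_left, ← LinearMap.map_add, hd.step i hi, LinearMap.map_zero]
    · rw [h.s_left, hd.last, LinearMap.map_zero]

/-! ### Bilinearity of the antibracket -/

theorem eulerL_add (z : Φ.Species) (a b : Φ.Form) :
    Φ.eulerL z (a + b) = Φ.eulerL z a + Φ.eulerL z b := by
  simp only [eulerL_eq, LinearMap.map_add]

theorem eulerL_smul (z : Φ.Species) (r : ℝ) (a : Φ.Form) :
    Φ.eulerL z (r • a) = r • Φ.eulerL z a := by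
  simp only [eulerL_eq, LinearMap.map_smul]

variable (Φ) in
/-- The antibracket as a bilinear map. -/
def antibracketₗ : Φ.Form →ₗ[ℝ] Φ.Form →ₗ[ℝ] Φ.Form :=
  LinearMap.mk₂ ℝ Φ.antibracket
    (fun a a' b => by
      simp only [antibracket, bracketDensity_eq, density_eq_strip, LinearMap.map_add, brstGen_eq,
        eulerL_add, smul_add, add_mul, Finset.sum_add_distrib, mul_add])
    (fun r a b => by
      simp only [antibracket, bracketDensity_eq, density_eq_strip, LinearMap.map_smul, brstGen_eq,
        eulerL_smul, smul_comm _ r, smul_mul_assoc, ← Finset.smul_sum, mul_smul_comm])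
    (fun a b b' => by
      simp only [antibracket, bracketDensity_eq, density_eq_strip, LinearMap.map_add,
        eulerL_add, mul_add, Finset.sum_add_distrib])
    (fun r a b => by
      simp only [antibracket, bracketDensity_eq, density_eq_strip, LinearMap.map_smul,
        eulerL_smul, ← Finset.smul_sum, mul_smul_comm])

/-- A bilinear map that vanishes on the kernels of two surjections descends to their targets. -/
theorem exists_bilinear_descent {V₁ V₂ Q₁ Q₂ W : Type*} [AddCommGroup V₁] [Module ℝ V₁]
    [AddCommGroup V₂] [Module ℝ V₂] [AddCommGroup Q₁] [Module ℝ Q₁] [AddCommGroup Q₂] [Module ℝ Q₂]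
    [AddCommGroup W] [Module ℝ W] (β : V₁ →ₗ[ℝ] V₂ →ₗ[ℝ] W) {q₁ : V₁ →ₗ[ℝ] Q₁} {q₂ : V₂ →ₗ[ℝ] Q₂}
    (h₁ : Function.Surjective q₁) (h₂ : Function.Surjective q₂)
    (hβ₁ : ∀ x y, q₁ x = 0 → β x y = 0) (hβ₂ : ∀ x y, q₂ y = 0 → β x y = 0) :
    ∃ B : Q₁ →ₗ[ℝ] Q₂ →ₗ[ℝ] W, ∀ x y, B (q₁ x) (q₂ y) = β x y := by
  -- Linear sections exist over a field; the kernel conditions make the value independent of their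
  -- choice.
  obtain ⟨s₁, hs₁⟩ := q₁.exists_rightInverse_of_surjective (LinearMap.range_eq_top.2 h₁)
  obtain ⟨s₂, hs₂⟩ := q₂.exists_rightInverse_of_surjective (LinearMap.range_eq_top.2 h₂)
  refine ⟨β.compl₁₂ s₁ s₂, fun x y => ?_⟩
  have e₁ : q₁ (s₁ (q₁ x) - x) = 0 := by
    rw [map_sub, sub_eq_zero]
    exact LinearMap.congr_fun hs₁ (q₁ x)
  have e₂ : q₂ (s₂ (q₂ y) - y) = 0 := by
    rw [map_sub, sub_eq_zero]
    exact LinearMap.congr_fun hs₂ (q₂ y)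
  have k₁ := hβ₁ _ (s₂ (q₂ y)) e₁
  have k₂ := hβ₂ x _ e₂
  rw [map_sub, LinearMap.sub_apply, sub_eq_zero] at k₁
  rw [map_sub, sub_eq_zero] at k₂
  rw [LinearMap.compl₁₂_apply, k₁, k₂]

/-! ### The antibracket in cohomology -/

section Cohomology

variable {L : Φ.Form} {g₁ g₂ : ℤ} {ω₁ ω₂ : Φ.Form}

theorem IsMasterLagrangian.isSymmetry_left (hL : Φ.IsMasterLagrangian L)
    (h₁ : ω₁ ∈ Φ.cocycles L g₁ Φ.dim) :
    IsSymmetry L (parityConj^[Φ.dim] (Φ.s (Φ.density ω₁)))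
      (parityConj (parityConj^[Φ.dim] (Φ.s (Φ.density ω₁)))) (g₁ + 1) :=
  (hL.isSymmetry_s (isDxFree_density ω₁) (mem_Forms.1 (mem_cocycles.1 h₁).1).1.density
    (hL.eulerL_s_density h₁)).iterate Φ.dim

theorem IsMasterLagrangian.isSymmetry_right (hL : Φ.IsMasterLagrangian L)
    (h₂ : ω₂ ∈ Φ.cocycles L g₂ Φ.dim) :
    IsSymmetry L (rightOp (Φ.s (Φ.density ω₂))) (rightOp (Φ.s (Φ.density ω₂))) (g₂ + 1) :=
  (hL.isSymmetry_s (isDxFree_density ω₂) (mem_Forms.1 (mem_cocycles.1 h₂).1).1.density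
    (hL.eulerL_s_density h₂)).rightOp hL

theorem IsMasterLagrangian.antibracket_mem_cocycles (hL : Φ.IsMasterLagrangian L)
    (h₁ : ω₁ ∈ Φ.cocycles L g₁ Φ.dim) (h₂ : ω₂ ∈ Φ.cocycles L g₂ Φ.dim) :
    Φ.antibracket ω₁ ω₂ ∈ Φ.cocycles L (g₁ + g₂ + 1) Φ.dim := by
  have h := (hL.isSymmetry_right h₂).map_cocycles h₁
  rw [← add_assoc] at h
  have hd := hL.map_d_le_cocycles
    (antibracket_sub_right (mem_cocycles.1 h₁).1 (mem_cocycles.1 h₂).1)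
  have := Submodule.sub_mem _ h hd
  rwa [sub_sub_cancel] at this

/-- The class of `Xω`, for an operator `X` that represents the antibracket up to exact forms. -/
theorem IsMasterLagrangian.exists_toClass_eq (hL : Φ.IsMasterLagrangian L) {g k : ℤ}
    {ω ω' : Φ.Form} (h : ω' ∈ Φ.cocycles L g k) (hd : ω - ω' ∈ (Φ.Forms g (k - 1)).map Φ.d) :
    ∃ hω : ω ∈ Φ.cocycles L g k, Φ.toClass L g k ⟨ω, hω⟩ = Φ.toClass L g k ⟨ω', h⟩ := by
  have hω : ω ∈ Φ.cocycles L g k := by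
    have := Submodule.add_mem _ (hL.map_d_le_cocycles hd) h
    rwa [sub_add_cancel] at this
  exact ⟨hω, toClass_eq.2 (map_d_le_coboundaries hd)⟩

/-- The cocycle `ω₂` stays fixed and supplies the symmetry; the coboundary `ω₁` is the argument on
which this symmetry acts. -/
theorem IsMasterLagrangian.antibracket_mem_coboundaries_left (hL : Φ.IsMasterLagrangian L)
    (h₁ : ω₁ ∈ Φ.cocycles L g₁ Φ.dim) (h₂ : ω₂ ∈ Φ.cocycles L g₂ Φ.dim)
    (h : ω₁ ∈ Φ.coboundaries L g₁ Φ.dim) :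
    Φ.antibracket ω₁ ω₂ ∈ Φ.coboundaries L (g₁ + g₂ + 1) Φ.dim := by
  have h' := (hL.isSymmetry_right h₂).map_coboundaries h
  rw [← add_assoc] at h'
  have := Submodule.sub_mem _ h' (map_d_le_coboundaries
    (antibracket_sub_right (mem_cocycles.1 h₁).1 (mem_cocycles.1 h₂).1))
  rwa [sub_sub_cancel] at this

theorem IsMasterLagrangian.antibracket_mem_coboundaries_right (hL : Φ.IsMasterLagrangian L)
    (h₁ : ω₁ ∈ Φ.cocycles L g₁ Φ.dim) (h₂ : ω₂ ∈ Φ.cocycles L g₂ Φ.dim)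
    (h : ω₂ ∈ Φ.coboundaries L g₂ Φ.dim) :
    Φ.antibracket ω₁ ω₂ ∈ Φ.coboundaries L (g₁ + g₂ + 1) Φ.dim := by
  have h' := (hL.isSymmetry_left h₁).map_coboundaries h
  rw [show g₂ + (g₁ + 1) = g₁ + g₂ + 1 by ring] at h'
  have := Submodule.sub_mem _ h' (map_d_le_coboundaries
    (antibracket_sub_left (mem_cocycles.1 h₁).1 (mem_cocycles.1 h₂).1))
  rwa [sub_sub_cancel] at this

/-- The class of the antibracket of two cocycles. -/
def IsMasterLagrangian.antibracketClass (hL : Φ.IsMasterLagrangian L) (g₁ g₂ : ℤ) :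
    Φ.cocycles L g₁ Φ.dim →ₗ[ℝ] Φ.cocycles L g₂ Φ.dim →ₗ[ℝ]
      Φ.Cohomology L (g₁ + g₂ + 1) Φ.dim :=
  LinearMap.mk₂ ℝ (fun ω₁ ω₂ => Φ.toClass L (g₁ + g₂ + 1) Φ.dim
      ⟨Φ.antibracket ω₁ ω₂, hL.antibracket_mem_cocycles ω₁.2 ω₂.2⟩)
    (fun a a' b => by
      rw [← LinearMap.map_add]
      exact congrArg _ (Subtype.ext (Φ.antibracketₗ.map_add₂ a.1 a'.1 b.1)))
    (fun r a b => by
      rw [← LinearMap.map_smul]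
      exact congrArg _ (Subtype.ext (Φ.antibracketₗ.map_smul₂ r a.1 b.1)))
    (fun a b b' => by
      rw [← LinearMap.map_add]
      exact congrArg _ (Subtype.ext ((Φ.antibracketₗ a.1).map_add b.1 b'.1)))
    (fun r a b => by
      rw [← LinearMap.map_smul]
      exact congrArg _ (Subtype.ext ((Φ.antibracketₗ a.1).map_smul r b.1)))

end Cohomology

end FieldContent

end LocalBRST

end

/-! ### The proposition. -/

theorem mainTheorem7 (Φ : LocalBRST.FieldContent) (L : Φ.Form) (hL : Φ.IsMasterLagrangian L)
    (g₁ g₂ : ℤ) :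
    ∃ B : Φ.Cohomology L g₁ Φ.dim →ₗ[ℝ] Φ.Cohomology L g₂ Φ.dim →ₗ[ℝ]
        Φ.Cohomology L (g₁ + g₂ + 1) Φ.dim,
      (∀ (ω₁ : Φ.cocycles L g₁ Φ.dim) (ω₂ : Φ.cocycles L g₂ Φ.dim),
        ∃ h : Φ.antibracket ω₁ ω₂ ∈ Φ.cocycles L (g₁ + g₂ + 1) Φ.dim,
          B (Φ.toClass L g₁ Φ.dim ω₁) (Φ.toClass L g₂ Φ.dim ω₂) =
            Φ.toClass L (g₁ + g₂ + 1) Φ.dim ⟨Φ.antibracket ω₁ ω₂, h⟩) ∧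
      ∀ (c₁ : Φ.Cohomology L g₁ Φ.dim) (c₂ : Φ.Cohomology L g₂ Φ.dim),
        Φ.depth L (B c₁ c₂) ≤ min (Φ.depth L c₁) (Φ.depth L c₂) := by
  open LocalBRST FieldContent in
  obtain ⟨B, hB⟩ := exists_bilinear_descent (hL.antibracketClass g₁ g₂)
    (toClass_surjective L g₁ Φ.dim) (toClass_surjective L g₂ Φ.dim)
    (fun ω₁ ω₂ h => toClass_eq_zero.2
      (hL.antibracket_mem_coboundaries_left ω₁.2 ω₂.2 (toClass_eq_zero.1 h)))
    (fun ω₁ ω₂ h => toClass_eq_zero.2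
      (hL.antibracket_mem_coboundaries_right ω₁.2 ω₂.2 (toClass_eq_zero.1 h)))
  have hB' : ∀ {ω₁ ω₂} (h₁ : ω₁ ∈ Φ.cocycles L g₁ Φ.dim) (h₂ : ω₂ ∈ Φ.cocycles L g₂ Φ.dim),
      B (Φ.toClass L g₁ Φ.dim ⟨ω₁, h₁⟩) (Φ.toClass L g₂ Φ.dim ⟨ω₂, h₂⟩) =
        Φ.toClass L (g₁ + g₂ + 1) Φ.dim ⟨_, hL.antibracket_mem_cocycles h₁ h₂⟩ :=
    fun h₁ h₂ => hB ⟨_, h₁⟩ ⟨_, h₂⟩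
  refine ⟨B, fun ω₁ ω₂ => ⟨_, hB' ω₁.2 ω₂.2⟩, fun c₁ c₂ => le_min ?_ ?_⟩
  -- For the bound by the depth of `c₁`, a representative of `c₂` is fixed and its right action
  -- transports the descents of `c₁`.
  · obtain ⟨⟨ω₂, h₂⟩, rfl⟩ := toClass_surjective L g₂ Φ.dim c₂
    refine (hL.isSymmetry_right h₂).depth_le hL (add_assoc _ _ _).symm
      (fun h => by rw [h, LinearMap.map_zero, LinearMap.zero_apply]) ?_
    rintro ω₁ h₁ rfl
    rw [hB' h₁ h₂]
    exact hL.exists_toClass_eq _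
      (antibracket_sub_right (mem_cocycles.1 h₁).1 (mem_cocycles.1 h₂).1)
  -- Dually, the Hamiltonian field of a representative of `c₁` transports the descents of `c₂`.
  · obtain ⟨⟨ω₁, h₁⟩, rfl⟩ := toClass_surjective L g₁ Φ.dim c₁
    refine (hL.isSymmetry_left h₁).depth_le hL (show g₂ + (g₁ + 1) = g₁ + g₂ + 1 by ring)
      (fun h => by rw [h, LinearMap.map_zero]) ?_
    rintro ω₂ h₂ rfl
    rw [hB' h₁ h₂]
    exact hL.exists_toClass_eq _
      (antibracket_sub_left (mem_cocycles.1 h₁).1 (mem_cocycles.1 h₂).1)
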